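/- **Conventions.** We use the sc-calculus of Hofer–Wysocki–Zehnder. A sc-Banach space $\mathbb{E}$ is a sequence of Banach spaces $E_0\supset E_1\supset\cdots$ with compact inclusions such that $E_\infty=\bigcap_m E_m$ is dense in every $E_m$; $\mathbb{E}^1$ is the shifted space with levels $E_{m+1}$; $\mathbb{R}^n$ carries the constant sc-structure. A map is sc$^0$ if it is continuous on every level; it is sc$^1$ if, in addition, at every $x$ of level $1$ there is a bounded operator $D_xf:E_0\to F_0$ with $|f(x+\xi)-f(x)-D_xf\,\xi|_0/|\xi|_1\to0$ as $|\xi|_1\to 0$, and the tangent map $Tf(x,\xi)=(f(x),D_xf\,\xi)$ is sc$^0$; sc-smoothness is obtained by iteration. A partial quadrant $C\subset\mathbb{E}$ is the preimage of a standard one $[0,\infty)^s\times\mathbb{E}'\subset\mathbb{R}^s\times\mathbb{E}'$ under a linear sc-isomorphism; $d_C(x)$ is the number of the first $s$ coordinates of $x$ that vanish, and $\mathbb{E}_x$ is the subspace of vectors whose corresponding coordinates vanish. A sc-germ of neighborhoods $U=U(C,0)$ is a decreasing sequence of relatively open neighborhoods $U(m)$ of $0$ in $C\cap E_m$; sc-smoothness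 of a germ is defined using the sets $U(m)$ in place of the levels of $U(0)$, and a map of germs carries $U(m)$ into $U'(m)$ for every $m$. **Retracts.** For $U\subset C$ open, a *tame sc-retraction* is a sc-smooth $r:U\to U$ with $r\circ r=r$, $d_C(r(x))=d_C(x)$ on $U$, and such that at every smooth point $x$ of $\mathcal{O}=r(U)$ there is a sc-subspace $A\subset\mathbb{E}_x$ with $\mathbb{E}=T_x\mathcal{O}\oplus A$ (sc-splitting), where $T_x\mathcal{O}=D_xr(\mathbb{E})$. A strong bundle map $U\lhd\mathbb{F}\to U'\lhd\mathbb{F}'$ has the form $(x,\xi)\mapsto(\varphi(x),\Gamma(x,\xi))$, is linear in $\xi$, and is sc-smooth both as a map $U\times\mathbb{F}\to U'\times\mathbb{F}'$ and as a map $U\times\mathbb{F}^1\to U'\times\mathbb{F}'^1$. A *tame bundle retraction* is a strong bundle map $R(x,\xi)=(r(x),\Gamma(x,\xi))$ of $U\lhd\mathbb{F}$ to itself with $R\circ R=R$ and $r$ a tame sc-retraction; its image $K$ is a tame bundle retract covering $\mathcal{O}=r(U)$, and $K\to\mathcal{O}$ is a tame local bundle model. If $U\subset\mathbb{R}^n\times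 C$ and $r$ preserves the $\mathbb{R}^n$-coordinate, then $R$, $K$ and $K\to\mathcal{O}$ are called *$\mathbb{R}^n$-sliced*. **Germs.** Let $K\to\mathcal{O}$ be a tame local bundle model with $0\in\mathcal{O}$, and let $\sigma:\mathcal{O}\to K$ be a sc-smooth section with principal part $\boldsymbol\sigma$. It is a *local sc-Fredholm germ* if there are: (a) a sc-germ of neighborhoods $U(C,0)$ and a tame bundle retraction $R=(r,\Gamma)$ on $U(0)\lhd\mathbb{F}$ with $r(U(0))=\mathcal{O}$ and image $K$; (b) a filling: a sc-smooth germ $\mathbf{h}:U(C,0)\to\mathbb{F}$ such that $\mathbf{h}=\boldsymbol\sigma$ on $\mathcal{O}$; $\mathbf{h}(x)=\Gamma(r(x),\mathbf{h}(x))$ implies $x\in\mathcal{O}$; and the linearization at $0$ of $x\mapsto\mathbf{h}(x)-\Gamma(r(x),\mathbf{h}(x))$ restricts to a linear sc-isomorphism $\ker D_0r\to\ker\Gamma(0,\cdot)$; (c) a sc$^+$-section $\mathfrak{s}$ over $U$ (principal part sc-smooth into $\mathbb{F}^1$) with $\mathfrak{s}(0)=\mathbf{h}(0)$, a sc-Banach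 space $\mathbb{W}$, integers $k\ge s\ge0$ and $k'\ge0$, a sc-germ of neighborhoods $U'$ of $0$ in $[0,\infty)^s\times\mathbb{R}^{k-s}\times\mathbb{W}$, and a strong bundle isomorphism $\Psi:U\lhd\mathbb{F}\to U'\lhd(\mathbb{R}^{k'}\times\mathbb{W})$ covering a sc-diffeomorphism $\psi:U\to U'$ with $\psi(0)=0$, such that the principal part $\mathbf{b}$ of $\Psi\circ(\mathbf{h}-\mathfrak{s})\circ\psi^{-1}$ is a basic germ: it is a sc-smooth germ with $\mathbf{b}(0)=0$ whose $\mathbb{W}$-component is $w-B(a,w)$, where $B$ is a sc-smooth germ, $B(0)=0$, and for all $\epsilon>0$, $m\ge0$ there is $\delta>0$ such that $\|B(a,w)-B(a,w')\|_m\le\epsilon\|w-w'\|_m$ whenever $\|(a,w)\|_m,\|(a,w')\|_m<\delta$. Its index is $\mathrm{ind}(\sigma)=k-k'$. If $C=[0,\infty)^s\times\mathbb{E}'$ is standard, $\sigma$ is a *tame sc-Fredholm germ* if these structures can be chosen so that $\psi(v,e)=(v,\overline\psi(e))$ for a linear sc-isomorphism $\overline\psi:\mathbb{E}'\to\mathbb{R}^{k-s}\times\mathbb{W}$.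 If $K\to\mathcal{O}$ is an $\mathbb{R}^n$-sliced local bundle model over $\mathbb{R}^n\times C$ with $C=[0,\infty)^s\times\mathbb{E}'$, then $\sigma$ is an *$\mathbb{R}^n$-sliced sc-Fredholm germ* if they can be chosen so that $R$ is $\mathbb{R}^n$-sliced, $\mathbb{W}=\tilde{\mathbb{W}}\times\mathbb{R}^n$, and $\psi(p,v,e)=(v,\overline\psi(e),\lambda(p,v,e))$ for a linear sc-isomorphism $\overline\psi:\mathbb{E}'\to\mathbb{R}^{k-s}\times\tilde{\mathbb{W}}$ and a map $\lambda$ to $\mathbb{R}^n$ that is $C^1$ on every level. **Lemma.** Let $C=[0,\infty)^s\times\mathbb{E}'\subset\mathbb{R}^s\times\mathbb{E}'=\mathbb{E}$, let $K\to\mathcal{O}$ be an $\mathbb{R}^n$-sliced local bundle model with $\mathcal{O}\subset\mathbb{R}^n\times C$ and $K\subset(\mathbb{R}^n\times C)\lhd\mathbb{F}$, and let $\sigma:\mathcal{O}\to K$ be an $\mathbb{R}^n$-sliced sc-Fredholm germ. Put $\tilde{\mathcal{O}}=\mathcal{O}\cap(\{0\}\times C)$ and $\tilde K=K\cap(\{0\}\times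 C\lhd\mathbb{F})$, viewed in $C$ and in $C\lhd\mathbb{F}$. Then $\tilde\sigma=\sigma|_{\tilde{\mathcal{O}}}:\tilde{\mathcal{O}}\to\tilde K$ is a tame sc-Fredholm germ (in particular, $\tilde K\to\tilde{\mathcal{O}}$ is a tame local bundle model), and $$\mathrm{ind}(\tilde\sigma)=\mathrm{ind}(\sigma)-n,$$ where both indices may be computed from any structures as in (a)–(c) for $\sigma$ and for $\tilde\sigma$, respectively. -/

import Mathlib

universe u v w

noncomputable section

namespace ScFred

/-! ### Sc-Banach spaces -/

/-- The composite inclusion `X m → X 0` of a sequence `X 0 ← X 1 ← X 2 ← ⋯`. -/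
def scIota {X : ℕ → Type u} [∀ m, NormedAddCommGroup (X m)] [∀ m, NormedSpace ℝ (X m)]
    (incl : ∀ m, X (m + 1) →L[ℝ] X m) : ∀ m, X m →L[ℝ] X 0
  | 0 => ContinuousLinearMap.id ℝ (X 0)
  | m + 1 => (scIota incl m).comp (incl m)

/-- A sc-Banach space: a sequence of Banach spaces `X 0 ← X 1 ← X 2 ← ⋯` and continuous linear
injections, each of them a compact operator, such that the smooth points (the points that lie in
every level) are dense in every level. A point of the sc-Banach space is a point of `X 0`. -/
structure ScBanach where
  /-- the levels -/
  X : ℕ → Type u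
  [nacg : ∀ m, NormedAddCommGroup (X m)]
  [nspace : ∀ m, NormedSpace ℝ (X m)]
  [complete : ∀ m, CompleteSpace (X m)]
  /-- the inclusion of level `m + 1` in level `m` -/
  incl : ∀ m, X (m + 1) →L[ℝ] X m
  incl_injective : ∀ m, Function.Injective (incl m)
  incl_compact : ∀ m, IsCompactOperator (incl m)
  dense_smooth : ∀ m, Dense {x : X m | ∀ k, scIota incl m x ∈ Set.range (scIota incl k)}

attribute [instance] ScBanach.nacg ScBanach.nspace ScBanach.complete

/-- The inclusion of level `m` in level `0`. -/
def ScBanach.ι (E : ScBanach.{u}) (m : ℕ) : E.X m →L[ℝ] E.X 0 := scIota E.incl m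

/-- `x` is a smooth point, i.e. it lies in every level. -/
def ScBanach.IsSmoothPt (E : ScBanach.{u}) (x : E.X 0) : Prop := ∀ m, x ∈ Set.range (E.ι m)

theorem scIota_shift {X : ℕ → Type u} [∀ m, NormedAddCommGroup (X m)]
    [∀ m, NormedSpace ℝ (X m)] (incl : ∀ m, X (m + 1) →L[ℝ] X m) (m : ℕ) (x : X (m + 1)) :
    scIota incl (m + 1) x
      = incl 0 (scIota (X := fun k => X (k + 1)) (fun k => incl (k + 1)) m x) := by
  induction m with
  | zero => rfl
  | succ m ih => exact ih (incl (m + 1) x)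

theorem scIota_injective {X : ℕ → Type u} [∀ m, NormedAddCommGroup (X m)]
    [∀ m, NormedSpace ℝ (X m)] (incl : ∀ m, X (m + 1) →L[ℝ] X m)
    (h : ∀ m, Function.Injective (incl m)) (m : ℕ) : Function.Injective (scIota incl m) := by
  induction m with
  | zero => exact fun _ _ h => h
  | succ m ih => exact ih.comp (h m)

theorem scIota_prod {X : ℕ → Type u} {Y : ℕ → Type v} [∀ m, NormedAddCommGroup (X m)]
    [∀ m, NormedSpace ℝ (X m)] [∀ m, NormedAddCommGroup (Y m)] [∀ m, NormedSpace ℝ (Y m)]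
    (i : ∀ m, X (m + 1) →L[ℝ] X m) (j : ∀ m, Y (m + 1) →L[ℝ] Y m) (m : ℕ) (x : X m × Y m) :
    scIota (X := fun k => X k × Y k) (fun k => (i k).prodMap (j k)) m x
      = (scIota i m x.1, scIota j m x.2) := by
  induction m with
  | zero => rfl
  | succ m ih => exact ih (i m x.1, j m x.2)

theorem scIota_const {V : Type u} [NormedAddCommGroup V] [NormedSpace ℝ V] (m : ℕ) (x : V) :
    scIota (X := fun _ => V) (fun _ => ContinuousLinearMap.id ℝ V) m x = x := by
  induction m with
  | zero => rfl
  | succ m ih => exact ih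

/-- The shifted sc-Banach space `𝔼¹`, with `m`-th level `E (m + 1)`. -/
abbrev ScBanach.shift (E : ScBanach.{u}) : ScBanach.{u} where
  X := fun m => E.X (m + 1)
  incl := fun m => E.incl (m + 1)
  incl_injective := fun m => E.incl_injective (m + 1)
  incl_compact := fun m => E.incl_compact (m + 1)
  dense_smooth := fun m => by
    refine (E.dense_smooth (m + 1)).mono ?_
    intro x hx k
    obtain ⟨y, hy⟩ := hx (k + 1)
    refine ⟨y, E.incl_injective 0 ?_⟩
    rw [← scIota_shift, ← scIota_shift]
    exact hy

/-- The product `𝔼 × 𝔽`, with `m`-th level `E m × F m`. (Mathlib's norm on a product is the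
maximum norm; it is equivalent to the sum norm.) -/
abbrev ScBanach.prod (E : ScBanach.{u}) (F : ScBanach.{v}) : ScBanach.{max u v} where
  X := fun m => E.X m × F.X m
  incl := fun m => (E.incl m).prodMap (F.incl m)
  incl_injective := fun m => (E.incl_injective m).prodMap (F.incl_injective m)
  incl_compact := fun m => by
    have h1 : IsCompactOperator
        (((ContinuousLinearMap.inl ℝ (E.X m) (F.X m)) ∘ (E.incl m)) ∘
          (ContinuousLinearMap.fst ℝ (E.X (m + 1)) (F.X (m + 1)))) :=
      ((E.incl_compact m).clm_comp _).comp_clm _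
    have h2 : IsCompactOperator
        (((ContinuousLinearMap.inr ℝ (E.X m) (F.X m)) ∘ (F.incl m)) ∘
          (ContinuousLinearMap.snd ℝ (E.X (m + 1)) (F.X (m + 1)))) :=
      ((F.incl_compact m).clm_comp _).comp_clm _
    have h3 : ⇑((E.incl m).prodMap (F.incl m)) =
        ((ContinuousLinearMap.inl ℝ (E.X m) (F.X m)) ∘ (E.incl m)) ∘
            (ContinuousLinearMap.fst ℝ (E.X (m + 1)) (F.X (m + 1))) +
          ((ContinuousLinearMap.inr ℝ (E.X m) (F.X m)) ∘ (F.incl m)) ∘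
            (ContinuousLinearMap.snd ℝ (E.X (m + 1)) (F.X (m + 1))) := by
      funext x
      simp
      rfl
    rw [h3]
    exact h1.add h2
  dense_smooth := fun m => by
    refine ((E.dense_smooth m).prod (F.dense_smooth m)).mono ?_
    rintro ⟨x, y⟩ ⟨hx, hy⟩ k
    obtain ⟨x', hx'⟩ := hx k
    obtain ⟨y', hy'⟩ := hy k
    refine ⟨(x', y'), ?_⟩
    rw [scIota_prod, scIota_prod]
    exact Prod.ext hx' hy'

/-- `ℝⁿ` with its Euclidean norm and the constant sc-structure. -/
abbrev eucl (n : ℕ) : ScBanach.{0} where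
  X := fun _ => EuclideanSpace ℝ (Fin n)
  incl := fun _ => ContinuousLinearMap.id ℝ _
  incl_injective := fun _ => Function.injective_id
  incl_compact := fun _ =>
    ⟨Metric.closedBall 0 1, isCompact_closedBall 0 1, Metric.closedBall_mem_nhds 0 one_pos⟩
  dense_smooth := fun m => by
    have : {x : EuclideanSpace ℝ (Fin n) | ∀ k,
        scIota (X := fun _ => EuclideanSpace ℝ (Fin n))
          (fun _ => ContinuousLinearMap.id ℝ _) m x ∈
        Set.range (scIota (X := fun _ => EuclideanSpace ℝ (Fin n))
          (fun _ => ContinuousLinearMap.id ℝ _) k)} = Set.univ := by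
      refine Set.eq_univ_of_forall fun x k => ⟨x, ?_⟩
      rw [scIota_const, scIota_const]
    rw [this]
    exact dense_univ

/-- A linear sc-isomorphism: compatible topological linear isomorphisms of all levels. -/
structure ScEquiv (E : ScBanach.{u}) (F : ScBanach.{v}) where
  /-- the isomorphism of the `m`-th levels -/
  lvl : ∀ m, E.X m ≃L[ℝ] F.X m
  comm : ∀ m (x : E.X (m + 1)), lvl m (E.incl m x) = F.incl m (lvl (m + 1) x)

/-- The level-`m` part `A ∩ E m` of a linear subspace `A ⊆ E 0`. -/
def lvlSub (E : ScBanach.{u}) (A : Submodule ℝ (E.X 0)) (m : ℕ) : Submodule ℝ (E.X m) :=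
  A.comap (E.ι m : E.X m →ₗ[ℝ] E.X 0)

/-- A sc-subspace: a closed subspace `A` of `E 0` whose levels `A ∩ E m` form a sc-Banach space.
(Closedness of the levels, and compactness of their inclusions, are automatic; what remains is
density of the smooth points.) -/
def IsScSubspace (E : ScBanach.{u}) (A : Submodule ℝ (E.X 0)) : Prop :=
  IsClosed (A : Set (E.X 0)) ∧
    ∀ m, (lvlSub E A m : Set (E.X m)) ⊆ closure {x | x ∈ lvlSub E A m ∧ E.IsSmoothPt (E.ι m x)}

/-- A sc-splitting `𝔼 = A ⊕ B`. -/
def IsScSplitting (E : ScBanach.{u}) (A B : Submodule ℝ (E.X 0)) : Prop :=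
  IsScSubspace E A ∧ IsScSubspace E B ∧ ∀ m, IsCompl (lvlSub E A m) (lvlSub E B m)

/-! ### Sc-calculus

A map between sc-Banach spaces is given as a map of the `0`-levels, used only on its domain. The
domain is a family `D` with `D m ⊆ E m`. For a set `U` in a sc-Banach space this is `lev U`, the
family of the `U ∩ E m`; a general family serves for germs. -/

/-- The family `U ∩ E m` of a subset `U` of a sc-Banach space. -/
def lev (E : ScBanach.{u}) (U : Set (E.X 0)) (m : ℕ) : Set (E.X m) := E.ι m ⁻¹' U

/-- `f` is of class sc⁰ on `D`: it maps `D m` into `F m`, continuously, for every `m`. -/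
def Sc0 (E : ScBanach.{u}) (F : ScBanach.{v}) (D : ∀ m, Set (E.X m)) (f : E.X 0 → F.X 0) :
    Prop :=
  ∀ m, ∃ g : E.X m → F.X m, ContinuousOn g (D m) ∧ ∀ x ∈ D m, F.ι m (g x) = f (E.ι m x)

/-- The bounded operator `T : E 0 → F 0` is the sc-differential of `f` at `x ∈ D 1`:
`|f (x + ξ) - f x - T ξ|₀ / |ξ|₁ → 0` as `|ξ|₁ → 0`, `ξ ∈ E 1`, `x + ξ ∈ D 1`. -/
def HasScDerivAt (E : ScBanach.{u}) (F : ScBanach.{v}) (D : ∀ m, Set (E.X m))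
    (f : E.X 0 → F.X 0) (x : E.X 1) (T : E.X 0 →L[ℝ] F.X 0) : Prop :=
  HasFDerivWithinAt (fun y : E.X 1 => f (E.ι 1 y)) (T.comp (E.ι 1)) (D 1) x

/-- The tangent space `T𝔼 = 𝔼¹ × 𝔼`. -/
abbrev ScBanach.tan (E : ScBanach.{u}) : ScBanach.{u} := E.shift.prod E

/-- The tangent `TD` of a domain `D`; its `m`-th level is `D (m + 1) × E m`. -/
def tanDom (E : ScBanach.{u}) (D : ∀ m, Set (E.X m)) (m : ℕ) : Set (E.tan.X m) :=
  {z | z.1 ∈ D (m + 1)}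

/-- `Tf` is the tangent map `(x, ξ) ↦ (f x, D_x f ξ)` of `f` on `TD`. -/
def IsTangentMap (E : ScBanach.{u}) (F : ScBanach.{v}) (D : ∀ m, Set (E.X m))
    (f : E.X 0 → F.X 0) (Tf : E.tan.X 0 → F.tan.X 0) : Prop :=
  ∀ x ∈ D 1, ∃ T : E.X 0 →L[ℝ] F.X 0, HasScDerivAt E F D f x T ∧
    ∀ ξ : E.X 0, F.ι 1 (Tf (x, ξ)).1 = f (E.ι 1 x) ∧ (Tf (x, ξ)).2 = T ξ

/-- `f` is of class scᵏ on `D`. -/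
def ScCk : ∀ (_ : ℕ) (E : ScBanach.{u}) (F : ScBanach.{v}) (_ : ∀ m, Set (E.X m))
    (_ : E.X 0 → F.X 0), Prop
  | 0, E, F, D, f => Sc0 E F D f
  | k + 1, E, F, D, f => Sc0 E F D f ∧
      ∃ Tf : E.tan.X 0 → F.tan.X 0, IsTangentMap E F D f Tf ∧
        ScCk k E.tan F.tan (tanDom E D) Tf

/-- `f` is sc-smooth on `D`. -/
def ScSmooth (E : ScBanach.{u}) (F : ScBanach.{v}) (D : ∀ m, Set (E.X m)) (f : E.X 0 → F.X 0) :
    Prop :=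
  ∀ k, ScCk k E F D f

/-! ### Partial quadrants -/

/-- A partial quadrant `C = Ψ⁻¹([0,∞)ˢ × 𝔼')` in `𝔼`, given together with a linear
sc-isomorphism `Ψ : 𝔼 → ℝˢ × 𝔼'`. -/
structure PartialQuadrant (E : ScBanach.{u}) where
  /-- the number of half-line factors -/
  s : ℕ
  /-- the complementary factor -/
  E' : ScBanach.{u}
  /-- the linear change of coordinates -/
  Ψ : ScEquiv E ((eucl s).prod E')

namespace PartialQuadrant

variable {E : ScBanach.{u}}

/-- The underlying set of a partial quadrant. -/
def carrier (C : PartialQuadrant E) : Set (E.X 0) := {x | ∀ i, 0 ≤ (C.Ψ.lvl 0 x).1 i}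

/-- The degeneracy index `d_C(x)`. -/
def degen (C : PartialQuadrant E) (x : E.X 0) : ℕ := {i | (C.Ψ.lvl 0 x).1 i = 0}.ncard

/-- The subspace `𝔼_x` of the vectors whose `i`-th coordinate vanishes whenever the `i`-th
coordinate of `x` does, `i = 1, …, s`. -/
def corner (C : PartialQuadrant E) (x : E.X 0) : Submodule ℝ (E.X 0) where
  carrier := {v | ∀ i, (C.Ψ.lvl 0 x).1 i = 0 → (C.Ψ.lvl 0 v).1 i = 0}
  add_mem' := by
    intro a b ha hb i hi
    simp [ha i hi, hb i hi]
  zero_mem' := by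
    intro i _
    simp
  smul_mem' := by
    intro c a ha i hi
    simp [ha i hi]

/-- `U` is relatively open in `C`. -/
def RelOpen (C : PartialQuadrant E) (U : Set (E.X 0)) : Prop :=
  ∃ V : Set (E.X 0), IsOpen V ∧ U = V ∩ C.carrier

/-- A sc-germ of neighborhoods around `0 ∈ C`: a decreasing sequence of relatively open
neighborhoods `D m` of `0` in `C ∩ E m`. -/
structure IsScGerm (C : PartialQuadrant E) (D : ∀ m, Set (E.X m)) : Prop where
  rel_open : ∀ m, ∃ V : Set (E.X m), IsOpen V ∧ D m = V ∩ lev E C.carrier m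
  zero_mem : ∀ m, (0 : E.X m) ∈ D m
  anti : ∀ m, ∀ x ∈ D (m + 1), E.incl m x ∈ D m

end PartialQuadrant

/-- The standard partial quadrant `[0,∞)ˢ × 𝔼'` in `ℝˢ × 𝔼'`. -/
def stdQuadrant (s : ℕ) (E' : ScBanach.{u}) : PartialQuadrant ((eucl s).prod E') where
  s := s
  E' := E'
  Ψ := { lvl := fun _ => ContinuousLinearEquiv.refl ℝ _, comm := fun _ _ => rfl }

/-- The partial quadrant `ℝⁿ × C` in `ℝⁿ × 𝔼`. -/
def euclProd (n : ℕ) {E : ScBanach.{u}} (C : PartialQuadrant E) :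
    PartialQuadrant ((eucl n).prod E) where
  s := C.s
  E' := (eucl n).prod C.E'
  Ψ :=
    { lvl := fun m =>
        ((ContinuousLinearEquiv.refl ℝ ((eucl n).X m)).prodCongr (C.Ψ.lvl m)).trans
          (((ContinuousLinearEquiv.prodAssoc ℝ ((eucl n).X m) ((eucl C.s).X m)
              (C.E'.X m)).symm.trans
            ((ContinuousLinearEquiv.prodComm ℝ ((eucl n).X m) ((eucl C.s).X m)).prodCongr
              (ContinuousLinearEquiv.refl ℝ (C.E'.X m)))).trans
            (ContinuousLinearEquiv.prodAssoc ℝ ((eucl C.s).X m) ((eucl n).X m) (C.E'.X m)))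
      comm := fun m x => by
        have h := C.Ψ.comm m x.2
        simp only [Prod.ext_iff] at h ⊢
        exact ⟨h.1, rfl, h.2⟩ }

/-! ### Tame sc-retractions -/

/-- A tame sc-retraction `r : U → U` on a relatively open subset `U` of `C`. Here `T_x𝒪` is the
range of the sc-differential of `r` at the smooth point `x ∈ 𝒪 = r(U)`. -/
structure IsTameRetraction {E : ScBanach.{u}} (C : PartialQuadrant E) (U : Set (E.X 0))
    (r : E.X 0 → E.X 0) : Prop where
  rel_open : C.RelOpen U
  mapsTo : Set.MapsTo r U U
  smooth : ScSmooth E E (lev E U) r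
  idem : ∀ x ∈ U, r (r x) = r x
  degen_eq : ∀ x ∈ U, C.degen (r x) = C.degen x
  splitting : ∀ x : E.X 1, E.ι 1 x ∈ r '' U → E.IsSmoothPt (E.ι 1 x) →
    ∀ T : E.X 0 →L[ℝ] E.X 0, HasScDerivAt E E (lev E U) r x T →
      ∃ A : Submodule ℝ (E.X 0),
        IsScSplitting E (LinearMap.range (T : E.X 0 →ₗ[ℝ] E.X 0)) A ∧ A ≤ C.corner (E.ι 1 x)

/-! ### Strong bundles -/

/-- The domain of the total space of the trivial bundle with fiber `𝔽` over `D`. -/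
def bundleDom (E : ScBanach.{u}) (F : ScBanach.{v}) (D : ∀ m, Set (E.X m)) (m : ℕ) :
    Set ((E.prod F).X m) :=
  {z | z.1 ∈ D m}

/-- `(x, ξ) ↦ (φ x, Γ x ξ)` is a strong bundle map `D ◁ 𝔽 → D' ◁ 𝔽'`: it is linear in the fibers
and sc-smooth for the two filtrations `D m × F (m + i)`, `i = 0, 1`. (That it preserves the whole
double filtration `D m × F k`, `k ≤ m + 1`, follows.) -/
structure IsStrongBundleMap {E E' : ScBanach.{u}} {F : ScBanach.{v}} {F' : ScBanach.{w}}
    (D : ∀ m, Set (E.X m)) (D' : ∀ m, Set (E'.X m)) (φ : E.X 0 → E'.X 0)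
    (Γ : E.X 0 → F.X 0 →ₗ[ℝ] F'.X 0) : Prop where
  base : ∀ m, ∀ x ∈ D m, ∃ y ∈ D' m, E'.ι m y = φ (E.ι m x)
  smooth_zero : ScSmooth (E.prod F) (E'.prod F') (bundleDom E F D)
    (fun z => (φ z.1, Γ z.1 z.2))
  smooth_one : ∃ Γ₁ : E.X 0 → F.X 1 → F'.X 1,
    (∀ x ∈ D 0, ∀ ξ : F.X 1, F'.ι 1 (Γ₁ x ξ) = Γ x (F.ι 1 ξ)) ∧
      ScSmooth (E.prod F.shift) (E'.prod F'.shift) (bundleDom E F.shift D)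
        (fun z => (φ z.1, Γ₁ z.1 z.2))

/-- `R(x, ξ) = (r x, Γ x ξ)` is a tame bundle retraction of `U ◁ 𝔽`. -/
structure IsTameBundleRetraction {E : ScBanach.{u}} (C : PartialQuadrant E) (F : ScBanach.{v})
    (U : Set (E.X 0)) (r : E.X 0 → E.X 0) (Γ : E.X 0 → F.X 0 →ₗ[ℝ] F.X 0) : Prop where
  tame : IsTameRetraction C U r
  bundle : IsStrongBundleMap (lev E U) (lev E U) r Γ
  idem : ∀ x ∈ U, ∀ ξ, Γ (r x) (Γ x ξ) = Γ x ξ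

/-- The image `R(U ◁ 𝔽)` of `R(x, ξ) = (r x, Γ x ξ)`. -/
def bundleImage {E : ScBanach.{u}} {F : ScBanach.{v}} (U : Set (E.X 0)) (r : E.X 0 → E.X 0)
    (Γ : E.X 0 → F.X 0 →ₗ[ℝ] F.X 0) : Set (E.X 0 × F.X 0) :=
  {z | ∃ x ∈ U, ∃ ξ, z = (r x, Γ x ξ)}

/-- `K` is a tame bundle retract in `C ◁ 𝔽` covering the tame sc-retract `O`; the tame local
bundle model is the projection `K → O`. -/
def IsTameBundleRetract {E : ScBanach.{u}} (C : PartialQuadrant E) (F : ScBanach.{v})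
    (O : Set (E.X 0)) (K : Set (E.X 0 × F.X 0)) : Prop :=
  ∃ U r Γ, IsTameBundleRetraction C F U r Γ ∧ r '' U = O ∧ bundleImage U r Γ = K

/-- `K` is an `ℝⁿ`-sliced bundle retract in `ℝⁿ × C ◁ 𝔽` covering the `ℝⁿ`-sliced sc-retract
`O`: the retraction can be chosen to preserve the `ℝⁿ`-coordinate. -/
def IsSlicedBundleRetract (n : ℕ) {E : ScBanach.{u}} (C : PartialQuadrant E) (F : ScBanach.{v})
    (O : Set (((eucl n).prod E).X 0)) (K : Set (((eucl n).prod E).X 0 × F.X 0)) : Prop :=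
  ∃ U r Γ, IsTameBundleRetraction (euclProd n C) F U r Γ ∧ (∀ x ∈ U, (r x).1 = x.1) ∧
    r '' U = O ∧ bundleImage U r Γ = K

/-- `σ` is the principal part of a sc-smooth section of `K → O`: `σ ∘ r` is sc-smooth for a
sc-retraction `r` onto `O` (the choice does not matter). -/
def IsScSmoothSection {E : ScBanach.{u}} (C : PartialQuadrant E) (F : ScBanach.{v})
    (O : Set (E.X 0)) (K : Set (E.X 0 × F.X 0)) (σ : E.X 0 → F.X 0) : Prop :=
  (∀ x ∈ O, (x, σ x) ∈ K) ∧
    ∃ U r, IsTameRetraction C U r ∧ r '' U = O ∧ ScSmooth E F (lev E U) (fun x => σ (r x))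

/-- `s` is the principal part of a sc⁺-section over `D`: it is sc-smooth as a map into `𝔽¹`. -/
def IsScPlus {E : ScBanach.{u}} {F : ScBanach.{v}} (D : ∀ m, Set (E.X m))
    (s : E.X 0 → F.X 0) : Prop :=
  ∃ s₁ : E.X 0 → F.X 1, (∀ x ∈ D 0, F.ι 1 (s₁ x) = s x) ∧ ScSmooth E F.shift D s₁

/-! ### Sc-Fredholm germs -/

/-- `b : [0,∞)ˢ × ℝᵈ × 𝕎 → ℝ^k' × 𝕎` (principal part, defined on the germ `D` around `0`) is a
basic germ: it is a sc-smooth germ with `b 0 = 0`, its `𝕎`-component is `w - B(a, w)` with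
`a ∈ [0,∞)ˢ × ℝᵈ`, and the sc-smooth germ `B` satisfies `B 0 = 0` and is contractive in `w` on
every level. -/
structure IsBasicGerm {s d k' : ℕ} {W : ScBanach.{u}}
    (D : ∀ m, Set (((eucl s).prod ((eucl d).prod W)).X m))
    (b : ((eucl s).prod ((eucl d).prod W)).X 0 → ((eucl k').prod W).X 0) : Prop where
  germ : (stdQuadrant s ((eucl d).prod W)).IsScGerm D
  smooth : ScSmooth ((eucl s).prod ((eucl d).prod W)) ((eucl k').prod W) D b
  zero : b 0 = 0
  form : ∃ B : ((eucl s).prod ((eucl d).prod W)).X 0 → W.X 0,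
    ScSmooth ((eucl s).prod ((eucl d).prod W)) W D B ∧ B 0 = 0 ∧
    (∀ y ∈ D 0, (b y).2 = y.2.2 - B y) ∧
    ∀ ε : ℝ, 0 < ε → ∀ m : ℕ, ∃ δ : ℝ, 0 < δ ∧
      ∀ (v : (eucl s).X m) (q : (eucl d).X m) (w w' : W.X m),
        (v, (q, w)) ∈ D m → (v, (q, w')) ∈ D m →
        ‖v‖ + ‖q‖ + ‖w‖ < δ → ‖v‖ + ‖q‖ + ‖w'‖ < δ →
        ∀ z z' : W.X m,
          W.ι m z = B (((eucl s).prod ((eucl d).prod W)).ι m (v, (q, w))) →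
          W.ι m z' = B (((eucl s).prod ((eucl d).prod W)).ι m (v, (q, w'))) →
          ‖z - z'‖ ≤ ε * ‖w - w'‖

/-- The structures on a section `σ` of `K → O` that make it a local sc-Fredholm germ, with
`k = s + d`. -/
structure FredholmData {E : ScBanach.{u}} (C : PartialQuadrant E) (F : ScBanach.{v})
    (O : Set (E.X 0)) (K : Set (E.X 0 × F.X 0)) (σ : E.X 0 → F.X 0)
    (W : ScBanach.{u}) (s d k' : ℕ) where
  /-- the sc-germ of neighborhoods `U(C, 0)` -/
  U : ∀ m, Set (E.X m)
  germ : C.IsScGerm U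
  /-- the tame sc-retraction on `U(0)` -/
  r : E.X 0 → E.X 0
  /-- the fiber part of the tame bundle retraction `R(x, ξ) = (r x, Γ x ξ)` -/
  Γ : E.X 0 → F.X 0 →ₗ[ℝ] F.X 0
  retraction : IsTameBundleRetraction C F (U 0) r Γ
  image_base : r '' (U 0) = O
  image_total : bundleImage (U 0) r Γ = K
  /-- the principal part of the filling -/
  h : E.X 0 → F.X 0
  h_smooth : ScSmooth E F U h
  fill_eq : ∀ x ∈ O, σ x = h x
  fill_mem : ∀ x ∈ U 0, h x = Γ (r x) (h x) → x ∈ O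
  /-- the differential of `r` at `0` -/
  Dr : E.X 0 →L[ℝ] E.X 0
  hasDeriv_r : HasScDerivAt E E (lev E (U 0)) r 0 Dr
  /-- the differential at `0` of `x ↦ (id - Γ (r x)) (h x)` -/
  DL : E.X 0 →L[ℝ] F.X 0
  hasDeriv_L : HasScDerivAt E F U (fun x => h x - Γ (r x) (h x)) 0 DL
  fill_iso : ∀ m, ∃ e : lvlSub E (LinearMap.ker (Dr : E.X 0 →ₗ[ℝ] E.X 0)) m ≃L[ℝ]
      lvlSub F (LinearMap.ker (Γ 0)) m,
    ∀ x, F.ι m (e x : F.X m) = DL (E.ι m (x : E.X m))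
  /-- the principal part of the sc⁺-section -/
  𝔰 : E.X 0 → F.X 0
  𝔰_plus : IsScPlus U 𝔰
  𝔰_zero : 𝔰 0 = h 0
  /-- the sc-germ of neighborhoods around `0 ∈ [0,∞)ˢ × ℝᵈ × 𝕎` -/
  U' : ∀ m, Set (((eucl s).prod ((eucl d).prod W)).X m)
  germ' : (stdQuadrant s ((eucl d).prod W)).IsScGerm U'
  /-- the sc-diffeomorphism `ψ : U → U'` -/
  ψ : E.X 0 → ((eucl s).prod ((eucl d).prod W)).X 0
  /-- the inverse of `ψ` -/
  ψinv : ((eucl s).prod ((eucl d).prod W)).X 0 → E.X 0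
  /-- the fiber part of the strong bundle isomorphism `Ψ : U ◁ 𝔽 → U' ◁ ℝ^k' × 𝕎` -/
  G : E.X 0 → F.X 0 →ₗ[ℝ] ((eucl k').prod W).X 0
  /-- the fiber part of the inverse of `Ψ` -/
  Ginv : ((eucl s).prod ((eucl d).prod W)).X 0 → ((eucl k').prod W).X 0 →ₗ[ℝ] F.X 0
  bundle : IsStrongBundleMap U U' ψ G
  bundle_inv : IsStrongBundleMap U' U ψinv Ginv
  left_inv : ∀ x ∈ U 0, ψinv (ψ x) = x ∧ ∀ ξ, Ginv (ψ x) (G x ξ) = ξ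
  right_inv : ∀ y ∈ U' 0, ψ (ψinv y) = y ∧ ∀ η, G (ψinv y) (Ginv y η) = η
  ψ_zero : ψ 0 = 0
  basic : IsBasicGerm U' (fun y => G (ψinv y) (h (ψinv y) - 𝔰 (ψinv y)))

/-- The standing assumptions on a section germ: `K → O` is a tame local bundle model over
`O ∋ 0`, and `σ` is (the principal part of) a sc-smooth section of it. -/
structure IsSectionGerm {E : ScBanach.{u}} (C : PartialQuadrant E) (F : ScBanach.{v})
    (O : Set (E.X 0)) (K : Set (E.X 0 × F.X 0)) (σ : E.X 0 → F.X 0) : Prop where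
  retract : IsTameBundleRetract C F O K
  zero_mem : 0 ∈ O
  smooth : IsScSmoothSection C F O K σ

/-- `σ` is a local sc-Fredholm germ, and `i` is its index, `i = k - k'` with `k = s + d`. -/
def HasFredholmIndex {E : ScBanach.{u}} (C : PartialQuadrant E) (F : ScBanach.{v})
    (O : Set (E.X 0)) (K : Set (E.X 0 × F.X 0)) (σ : E.X 0 → F.X 0) (i : ℤ) : Prop :=
  IsSectionGerm C F O K σ ∧ ∃ (W : ScBanach.{u}) (s d k' : ℕ),
    Nonempty (FredholmData C F O K σ W s d k') ∧ i = ((s + d : ℕ) : ℤ) - (k' : ℤ)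

/-- `σ` is a tame sc-Fredholm germ, the partial quadrant being `[0,∞)ˢ × 𝔼'`: the
sc-diffeomorphism `ψ` can be chosen as the restriction of a linear sc-isomorphism
`(v, e) ↦ (v, ψ' e)` with `ψ' : 𝔼' → ℝᵈ × 𝕎`. -/
def IsTameFredholmGerm (s : ℕ) (E' : ScBanach.{u}) (F : ScBanach.{v})
    (O : Set (((eucl s).prod E').X 0)) (K : Set (((eucl s).prod E').X 0 × F.X 0))
    (σ : ((eucl s).prod E').X 0 → F.X 0) : Prop :=
  IsSectionGerm (stdQuadrant s E') F O K σ ∧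
    ∃ (W : ScBanach.{u}) (d k' : ℕ) (D : FredholmData (stdQuadrant s E') F O K σ W s d k')
      (ψ' : ScEquiv E' ((eucl d).prod W)),
      ∀ x ∈ D.U 0, D.ψ x = (x.1, ψ'.lvl 0 x.2)

/-- `σ` is an `ℝⁿ`-sliced sc-Fredholm germ of the `ℝⁿ`-sliced local bundle model `K → O` over
`ℝⁿ × [0,∞)ˢ × 𝔼'`: the structures of a local sc-Fredholm germ can be chosen with an `ℝⁿ`-sliced
retraction, with `𝕎 = 𝕎' × ℝⁿ`, and with `ψ(p, v, e) = (v, ψ' e, lam(p, v, e))` for a linear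
sc-isomorphism `ψ' : 𝔼' → ℝᵈ × 𝕎'` and a map `lam` to `ℝⁿ` that is `C¹` on every level. -/
def IsSlicedFredholmGerm (n s : ℕ) (E' : ScBanach.{u}) (F : ScBanach.{v})
    (O : Set (((eucl n).prod ((eucl s).prod E')).X 0))
    (K : Set (((eucl n).prod ((eucl s).prod E')).X 0 × F.X 0))
    (σ : ((eucl n).prod ((eucl s).prod E')).X 0 → F.X 0) : Prop :=
  IsSectionGerm (euclProd n (stdQuadrant s E')) F O K σ ∧
    ∃ (W' : ScBanach.{u}) (d k' : ℕ)
      (D : FredholmData (euclProd n (stdQuadrant s E')) F O K σ (W'.prod (eucl n)) s d k')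
      (ψ' : ScEquiv E' ((eucl d).prod W'))
      (lam : ((eucl n).prod ((eucl s).prod E')).X 0 → EuclideanSpace ℝ (Fin n)),
      (∀ x ∈ D.U 0, (D.r x).1 = x.1) ∧
      (∀ x ∈ D.U 0,
        D.ψ x = (x.2.1, ((ψ'.lvl 0 x.2.2).1, ((ψ'.lvl 0 x.2.2).2, lam x)))) ∧
      ∀ m, ContDiffOn ℝ 1
        (fun x : ((eucl n).prod ((eucl s).prod E')).X m =>
          lam (((eucl n).prod ((eucl s).prod E')).ι m x)) (D.U m)

/-! ### The induced retracts and section -/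

/-- The induced retract `O ∩ ({0} × C)`, viewed in `𝔼`. -/
def sliceBase (n : ℕ) {E : ScBanach.{u}} (O : Set (((eucl n).prod E).X 0)) : Set (E.X 0) :=
  {x | ((0, x) : ((eucl n).prod E).X 0) ∈ O}

/-- The induced bundle retract `K ∩ ({0} × C ◁ 𝔽)`, viewed in `𝔼 ◁ 𝔽`. -/
def sliceTotal (n : ℕ) {E : ScBanach.{u}} {F : ScBanach.{v}}
    (K : Set (((eucl n).prod E).X 0 × F.X 0)) : Set (E.X 0 × F.X 0) :=
  {z | (((0, z.1) : ((eucl n).prod E).X 0), z.2) ∈ K}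

/-- The principal part of the restriction of `σ` to `O ∩ ({0} × C)`. -/
def sliceSection (n : ℕ) {E : ScBanach.{u}} {F : ScBanach.{v}}
    (σ : ((eucl n).prod E).X 0 → F.X 0) (x : E.X 0) : F.X 0 :=
  σ ((0, x) : ((eucl n).prod E).X 0)

end ScFred

end

universe w'

noncomputable section

namespace ScFred

open Set Filter Topology

/-! Everything is restricted to the parameter value `p = 0`. Since `r` preserves `p`, the map `x ↦
(r (0, x)).2` retracts onto the slice of `O`, and the bundle retraction, the filling and the
sc⁺-section restrict as well. Two points need an argument.

Tameness. At a smooth point let `S` be the differential of `r`. It has the form `S (p, ξ) = (p, P p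
+ T ξ)`, with `T` the differential of the sliced retraction. The map `M (p, e) = e - P p` is onto,
and its kernel is the graph of `P`, which consists of the vectors `S (p, 0)` and so lies in the
tangent space. Hence `M` carries a sc-splitting by the tangent space and `A` to a sc-splitting of
`𝔼` by the range of `T` and `M A` (`IsScSplitting.map`). For `M A` to lie in the corner subspace, `P
p` must lie there: along `t ↦ (t p, x)` each vanishing half-line coordinate of `r` has a minimum at
`t = 0` (`deriv_parameter_mem_corner`).

Normal form. The linear map `(v, e) ↦ (v, ψ' e)` becomes the chart, and the `ℝⁿ`-factor of the
target `ℝ^k' × (𝕎' × ℝⁿ)` joins the finite-dimensional part, so `k'` becomes `k' + n` while `s + d`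
stays. The new contraction term is the `𝕎'`-component of `B (v, q, (w, lam))`. As `lam` is `C¹`, it
is Lipschitz near `0`, which costs only a factor `1 + c` (`isBasicGerm_slice`). The filling
condition survives because the differential of `r` at `0` preserves `p`, so its kernel already lies
over `p = 0`.

These structures have an index smaller by `n`. The remaining claim is that the index does not depend
on the structures (`FredholmData.index_eq`). Let `A` be the differential at `0` of filling minus
sc⁺-section. Contractivity of `B` makes `A`, in charts, a compact perturbation of `(a, w) ↦ (0, w)`.
For two fillings of the same section the operators `A` agree modulo compacts on the common tangent
space, and on complements they are isomorphisms modulo compacts; so they agree up to isomorphisms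
and compact operators (`IsFilledSplit.exists_compactEq`). The Fredholm alternative then equates the
dimension differences (`add_eq_add_of_compactEq_modelOp`).

Underneath lies the sc-chain rule (`HasScDerivAt.comp`): differentials depend only strongly
continuously on the point, and compactness of `E 1 → E 0` makes up for it. -/

/-! ### Linear sc-operators -/

/-- A linear sc-operator: compatible bounded operators between all levels. -/
structure ScLin (E : ScBanach.{u}) (F : ScBanach.{v}) where
  /-- the operator between the `m`-th levels -/
  lvl : ∀ m, E.X m →L[ℝ] F.X m
  comm : ∀ m (x : E.X (m + 1)), lvl m (E.incl m x) = F.incl m (lvl (m + 1) x)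

theorem ScBanach.ι_injective (E : ScBanach.{u}) (m : ℕ) : Function.Injective (E.ι m) :=
  scIota_injective E.incl E.incl_injective m

theorem ScBanach.ι_succ (E : ScBanach.{u}) (m : ℕ) (x : E.X (m + 1)) :
    E.ι (m + 1) x = E.ι m (E.incl m x) := rfl

theorem ScBanach.ι_one_shift (E : ScBanach.{u}) (m : ℕ) (x : E.X (m + 1)) :
    E.ι 1 (E.shift.ι m x) = E.ι (m + 1) x :=
  (scIota_shift E.incl m x).symm

theorem ScBanach.ι_prod (E : ScBanach.{u}) (F : ScBanach.{v}) (m : ℕ) (x : (E.prod F).X m) :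
    (E.prod F).ι m x = (E.ι m x.1, F.ι m x.2) :=
  scIota_prod E.incl F.incl m x

theorem eucl_ι (n m : ℕ) (x : (eucl n).X m) : (eucl n).ι m x = x :=
  scIota_const (V := EuclideanSpace ℝ (Fin n)) m x

theorem ScBanach.dense_range_ι (E : ScBanach.{u}) (m : ℕ) : DenseRange (E.ι m) :=
  (E.dense_smooth 0).mono fun _ hx => by exact hx m

namespace ScLin

variable {E : ScBanach.{u}} {F : ScBanach.{v}} {G : ScBanach.{w}}

theorem ι_lvl (L : ScLin E F) (m : ℕ) (x : E.X m) : F.ι m (L.lvl m x) = L.lvl 0 (E.ι m x) := by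
  induction m with
  | zero => rfl
  | succ m ih => rw [F.ι_succ, E.ι_succ, ← L.comm, ih]

/-- The operator induced on the shifted spaces. -/
@[simps] def shift (L : ScLin E F) : ScLin E.shift F.shift where
  lvl m := L.lvl (m + 1)
  comm m x := L.comm (m + 1) x

@[simps] def comp (L : ScLin F G) (M : ScLin E F) : ScLin E G where
  lvl m := (L.lvl m).comp (M.lvl m)
  comm m x := by simp [M.comm, L.comm]

@[simps] def id (E : ScBanach.{u}) : ScLin E E where
  lvl _ := ContinuousLinearMap.id ℝ _
  comm _ _ := rfl

@[simps] def fst (E : ScBanach.{u}) (F : ScBanach.{v}) : ScLin (E.prod F) E where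
  lvl _ := ContinuousLinearMap.fst ℝ _ _
  comm _ _ := rfl

@[simps] def snd (E : ScBanach.{u}) (F : ScBanach.{v}) : ScLin (E.prod F) F where
  lvl _ := ContinuousLinearMap.snd ℝ _ _
  comm _ _ := rfl

@[simps] def zero (E : ScBanach.{u}) (F : ScBanach.{v}) : ScLin E F where
  lvl _ := 0
  comm m x := by simp

@[simps] def prodMk (L : ScLin E F) (M : ScLin E G) : ScLin E (F.prod G) where
  lvl m := (L.lvl m).prod (M.lvl m)
  comm m x := by
    simp only [ContinuousLinearMap.prod_apply, L.comm, M.comm]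
    rfl

@[simps] def sub (L M : ScLin E F) : ScLin E F where
  lvl m := L.lvl m - M.lvl m
  comm m x := by simp [L.comm, M.comm]

/-- The second factor inclusion. -/
abbrev inr (E : ScBanach.{u}) (F : ScBanach.{v}) : ScLin F (E.prod F) := (zero F E).prodMk (id F)

/-- The tangent map of a linear sc-operator. -/
abbrev tan (L : ScLin E F) : ScLin E.tan F.tan :=
  (L.shift.comp (fst E.shift E)).prodMk (L.comp (snd E.shift E))

end ScLin

namespace ScEquiv

variable {E : ScBanach.{u}} {F : ScBanach.{v}}

@[simps] def toScLin (L : ScEquiv E F) : ScLin E F where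
  lvl m := (L.lvl m : E.X m →L[ℝ] F.X m)
  comm m x := L.comm m x

@[simps] def symm (L : ScEquiv E F) : ScEquiv F E where
  lvl m := (L.lvl m).symm
  comm m x := by
    rw [ContinuousLinearEquiv.symm_apply_eq, L.comm, ContinuousLinearEquiv.apply_symm_apply]

theorem ι_lvl (L : ScEquiv E F) (m : ℕ) (x : E.X m) : F.ι m (L.lvl m x) = L.lvl 0 (E.ι m x) :=
  L.toScLin.ι_lvl m x

end ScEquiv

/-! ### Domains -/

/-- A domain for the sc-calculus: a decreasing family of sets, each of them relatively open in a
convex set with nonempty interior. -/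
structure IsScDom (E : ScBanach.{u}) (D : ∀ m, Set (E.X m)) : Prop where
  anti : ∀ m, ∀ x ∈ D (m + 1), E.incl m x ∈ D m
  rel_open : ∀ m, ∃ V C : Set (E.X m), IsOpen V ∧ Convex ℝ C ∧ (interior C).Nonempty ∧ D m = V ∩ C

namespace IsScDom

variable {E : ScBanach.{u}} {D : ∀ m, Set (E.X m)}

theorem ι_mem (h : IsScDom E D) (m : ℕ) : ∀ x ∈ D m, E.ι m x ∈ D 0 := by
  induction m with
  | zero => exact fun x hx => hx
  | succ m ih => exact fun x hx => ih _ (h.anti m x hx)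

theorem ι_shift_mem (h : IsScDom E D) (m : ℕ) : ∀ x ∈ D (m + 1), E.shift.ι m x ∈ D 1 := by
  induction m with
  | zero => exact fun x hx => hx
  | succ m ih => exact fun x hx => ih _ (h.anti (m + 1) x hx)

/-- This is the purpose of the convex set with nonempty interior: its tangent cones span, also at
boundary points of the quadrant, so differentials are unique. -/
theorem uniqueDiff (h : IsScDom E D) (m : ℕ) : ∀ x ∈ D m, UniqueDiffWithinAt ℝ (D m) x := by
  obtain ⟨V, C, hV, hC, hi, e⟩ := h.rel_open m
  intro x hx
  rw [e] at hx ⊢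
  rw [inter_comm]
  exact (uniqueDiffWithinAt_convex hC hi (subset_closure hx.2)).inter (hV.mem_nhds hx.1)

/-- Mean value and Lipschitz estimates need segments that stay in the domain. -/
theorem exists_convex_nhds (h : IsScDom E D) (m : ℕ) (x : E.X m) (hx : x ∈ D m) (δ : ℝ)
    (hδ : 0 < δ) : ∃ ρ, 0 < ρ ∧ ρ ≤ δ ∧ Convex ℝ (Metric.ball x ρ ∩ D m) := by
  obtain ⟨V, C, hV, hC, _, e⟩ := h.rel_open m
  rw [e] at hx ⊢
  obtain ⟨ρ, hρ, hρV⟩ := Metric.isOpen_iff.1 hV x hx.1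
  refine ⟨min ρ δ, lt_min hρ hδ, min_le_right _ _, ?_⟩
  have : Metric.ball x (min ρ δ) ∩ (V ∩ C) = Metric.ball x (min ρ δ) ∩ C := by
    rw [← inter_assoc,
      inter_eq_left.2 ((Metric.ball_subset_ball (min_le_left ρ δ)).trans hρV)]
  rw [this]
  exact (convex_ball _ _).inter hC

theorem tanDom (h : IsScDom E D) : IsScDom E.tan (tanDom E D) where
  anti m x hx := h.anti (m + 1) _ hx
  rel_open m := by
    obtain ⟨V, C, hV, hC, hi, e⟩ := h.rel_open (m + 1)
    refine ⟨V ×ˢ univ, C ×ˢ univ, hV.prod isOpen_univ, hC.prod convex_univ, ?_, ?_⟩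
    · rw [interior_prod_eq, interior_univ]
      exact hi.prod univ_nonempty
    · ext z
      simp [ScFred.tanDom, e]

theorem bundleDom (h : IsScDom E D) (F : ScBanach.{v}) :
    IsScDom (E.prod F) (bundleDom E F D) where
  anti m x hx := h.anti m _ hx
  rel_open m := by
    obtain ⟨V, C, hV, hC, hi, e⟩ := h.rel_open m
    refine ⟨V ×ˢ univ, C ×ˢ univ, hV.prod isOpen_univ, hC.prod convex_univ, ?_, ?_⟩
    · rw [interior_prod_eq, interior_univ]
      exact hi.prod univ_nonempty
    · ext z
      simp [ScFred.bundleDom, e]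

end IsScDom

namespace PartialQuadrant

variable {E : ScBanach.{u}} (C : PartialQuadrant E)

theorem mem_lev_carrier (m : ℕ) (x : E.X m) :
    x ∈ lev E C.carrier m ↔ ∀ i, 0 ≤ (C.Ψ.lvl m x).1 i := by
  have h := C.Ψ.ι_lvl m x
  rw [ScBanach.ι_prod, eucl_ι] at h
  simp only [lev, carrier, mem_preimage, mem_ofPred_eq, ← h]

theorem isOpen_pos (m : ℕ) : IsOpen {x : E.X m | ∀ i, 0 < (C.Ψ.lvl m x).1 i} := by
  simp only [ofPred_forall]
  refine isOpen_iInter_of_finite fun i => isOpen_lt continuous_const ?_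
  fun_prop

theorem convex_lev (m : ℕ) : Convex ℝ (lev E C.carrier m) := by
  intro x hx y hy a b ha hb hab
  rw [mem_lev_carrier] at *
  intro i
  have := add_nonneg (mul_nonneg ha (hx i)) (mul_nonneg hb (hy i))
  simpa using this

theorem interior_lev_nonempty (m : ℕ) : (interior (lev E C.carrier m)).Nonempty := by
  refine ⟨(C.Ψ.lvl m).symm (WithLp.toLp 2 fun _ => 1, 0), mem_interior.2
    ⟨_, fun x hx => (C.mem_lev_carrier m x).2 fun i => (hx i).le, C.isOpen_pos m, ?_⟩⟩
  simp

variable {C}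

theorem IsScGerm.isScDom {D : ∀ m, Set (E.X m)} (h : C.IsScGerm D) : IsScDom E D where
  anti := h.anti
  rel_open m := by
    obtain ⟨V, hV, e⟩ := h.rel_open m
    exact ⟨V, _, hV, C.convex_lev m, C.interior_lev_nonempty m, e⟩

theorem RelOpen.isScDom {U : Set (E.X 0)} (h : C.RelOpen U) : IsScDom E (lev E U) where
  anti m x hx := hx
  rel_open m := by
    obtain ⟨V, hV, rfl⟩ := h
    exact ⟨E.ι m ⁻¹' V, _, hV.preimage (E.ι m).continuous, C.convex_lev m,
      C.interior_lev_nonempty m, rfl⟩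

end PartialQuadrant

/-! ### The sc-differential -/

section Deriv

variable {E : ScBanach.{u}} {F : ScBanach.{v}} {G : ScBanach.{w}} {D : ∀ m, Set (E.X m)}

/-- The defining limit sees only directions in `E 1`; density of `E 1` in `E 0` and continuity
determine the operator on all of `E 0`. -/
theorem HasScDerivAt.unique {f : E.X 0 → F.X 0} {x : E.X 1} {S T : E.X 0 →L[ℝ] F.X 0}
    (hx : UniqueDiffWithinAt ℝ (D 1) x) (hS : HasScDerivAt E F D f x S)
    (hT : HasScDerivAt E F D f x T) : S = T := by
  have h := hx.eq hS hT
  refine ContinuousLinearMap.coeFn_injective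
    ((E.dense_range_ι 1).equalizer S.continuous T.continuous ?_)
  funext y
  exact DFunLike.congr_fun h y

theorem ScLin.hasScDerivAt (L : ScLin E F) (x : E.X 1) : HasScDerivAt E F D (L.lvl 0) x (L.lvl 0) :=
  ((L.lvl 0).comp (E.ι 1)).hasFDerivWithinAt

theorem HasScDerivAt.clm_comp {f : E.X 0 → F.X 0} {x : E.X 1} {S : E.X 0 →L[ℝ] F.X 0}
    (hf : HasScDerivAt E F D f x S) (L : F.X 0 →L[ℝ] G.X 0) :
    HasScDerivAt E G D (fun y => L (f y)) x (L.comp S) :=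
  L.hasFDerivAt.comp_hasFDerivWithinAt x hf

/-- Precomposition with a linear sc-operator. -/
theorem HasScDerivAt.comp_scLin {D' : ∀ m, Set (F.X m)} {f : F.X 0 → G.X 0} {x : E.X 1}
    {S : F.X 0 →L[ℝ] G.X 0} (L : ScLin E F) (hf : HasScDerivAt F G D' f (L.lvl 1 x) S)
    (hL : MapsTo (L.lvl 1) (D 1) (D' 1)) :
    HasScDerivAt E G D (fun y => f (L.lvl 0 y)) x (S.comp (L.lvl 0)) := by
  have h := HasFDerivWithinAt.comp x hf (L.lvl 1).hasFDerivWithinAt hL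
  refine (h.congr_fderiv ?_).congr (fun y _ => ?_) ?_
  · ext y
    simp [L.ι_lvl]
  · simp [L.ι_lvl]
  · simp [L.ι_lvl]

theorem HasScDerivAt.congr {f g : E.X 0 → F.X 0} {x : E.X 1} {S : E.X 0 →L[ℝ] F.X 0}
    (hf : HasScDerivAt E F D f x S) (hx : x ∈ D 1) (h : ∀ y ∈ D 1, g (E.ι 1 y) = f (E.ι 1 y)) :
    HasScDerivAt E F D g x S :=
  HasFDerivWithinAt.congr hf h (h x hx)

end Deriv

/-! ### Jointly continuous families of linear maps -/

/-- A jointly continuous family is uniformly continuous in the parameter on compact sets. -/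
theorem eventually_norm_sub_le_of_continuousOn {X F G : Type*} [TopologicalSpace X]
    [NormedAddCommGroup F] [NormedAddCommGroup G] {Λ : X → F → G} {s : Set X} {y₀ : X}
    (hΛ : ContinuousOn (fun z : X × F => Λ z.1 z.2) (s ×ˢ univ)) (hy : y₀ ∈ s) {K : Set F}
    (hK : IsCompact K) {ε : ℝ} (hε : 0 < ε) :
    ∀ᶠ y in 𝓝[s] y₀, ∀ k ∈ K, ‖Λ y k - Λ y₀ k‖ ≤ ε := by
  -- The condition `y ∈ s` is moved into the predicate, so that the tube argument over the compact
  -- set `K` runs with full neighborhoods of `y₀`.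
  have key : ∀ᶠ y in 𝓝 y₀, ∀ k ∈ K, y ∈ s → ‖Λ y k - Λ y₀ k‖ ≤ ε := by
    refine hK.eventually_forall_of_forall_eventually
      (P := fun y k => y ∈ s → ‖Λ y k - Λ y₀ k‖ ≤ ε) fun k _ => ?_
    have h1 : Tendsto (fun z : X × F => Λ z.1 z.2) (𝓝[s ×ˢ univ] (y₀, k)) (𝓝 (Λ y₀ k)) :=
      hΛ (y₀, k) ⟨hy, mem_univ _⟩
    have h2 : Tendsto (fun z : X × F => Λ y₀ z.2) (𝓝 (y₀, k)) (𝓝 (Λ y₀ k)) := by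
      have h3 : Tendsto (fun z : X × F => (y₀, z.2)) (𝓝 (y₀, k)) (𝓝[s ×ˢ univ] (y₀, k)) := by
        refine tendsto_nhdsWithin_iff.2 ⟨?_, Eventually.of_forall fun z => ⟨hy, mem_univ _⟩⟩
        exact (continuous_const.prodMk continuous_snd).tendsto (y₀, k)
      exact h1.comp h3
    have h4 := (h1.sub (h2.mono_left nhdsWithin_le_nhds)).norm
    rw [sub_self, norm_zero] at h4
    have h5 := h4.eventually (eventually_le_nhds hε)
    rw [eventually_nhdsWithin_iff] at h5
    filter_upwards [h5] with z hz hzs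
    exact hz ⟨hzs, mem_univ _⟩
  rw [eventually_nhdsWithin_iff]
  filter_upwards [key] with y hy hys k hk
  exact hy k hk hys

section Families

variable {X F G : Type*} [TopologicalSpace X] [NormedAddCommGroup F] [NormedSpace ℝ F]
  [NormedAddCommGroup G] [NormedSpace ℝ G] {Λ : X → F → G} {s : Set X} {y₀ : X}

/-- A family of linear maps that is jointly continuous is locally bounded. -/
theorem eventually_norm_le_of_continuousOn (hΛ : ContinuousOn (fun z : X × F => Λ z.1 z.2) (s ×ˢ univ))
    (hsmul : ∀ y ∈ s, ∀ (c : ℝ) η, Λ y (c • η) = c • Λ y η) (hy : y₀ ∈ s) :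
    ∃ c, 0 < c ∧ ∀ᶠ y in 𝓝[s] y₀, ∀ η, ‖Λ y η‖ ≤ c * ‖η‖ := by
  have h0 : Λ y₀ 0 = 0 := by simpa using hsmul y₀ hy 0 0
  have h1 := hΛ (y₀, 0) ⟨hy, mem_univ _⟩
  rw [ContinuousWithinAt, nhdsWithin_prod_eq, nhdsWithin_univ] at h1
  simp only [h0] at h1
  have h2 := h1 (Metric.closedBall_mem_nhds (0 : G) one_pos)
  obtain ⟨p, hp, q, hq, hpq⟩ := eventually_prod_iff.1 h2
  obtain ⟨δ, hδ, hδq⟩ := Metric.eventually_nhds_iff_ball.1 hq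
  -- Near `y₀` the maps send the ball of radius `δ` into the unit ball; rescaling `η` to norm `δ /
  -- 2` gives the constant `2 / δ`.
  refine ⟨2 / δ, by positivity, ?_⟩
  filter_upwards [hp, self_mem_nhdsWithin] with y hy hys η
  rcases eq_or_ne η 0 with rfl | hη
  · have : Λ y 0 = 0 := by simpa using hsmul y hys 0 0
    simp [this]
  have hn : 0 < ‖η‖ := norm_pos_iff.2 hη
  have h3 : ((δ / 2 / ‖η‖) • η) ∈ Metric.ball (0 : F) δ := by
    rw [mem_ball_zero_iff, norm_smul, Real.norm_of_nonneg (by positivity),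
      div_mul_cancel₀ _ hn.ne']
    linarith
  have h4 := hpq hy (hδq _ h3)
  simp only [hsmul y hys, mem_closedBall_zero_iff, norm_smul] at h4
  rw [Real.norm_of_nonneg (by positivity : 0 ≤ δ / 2 / ‖η‖)] at h4
  have h5 : ‖Λ y η‖ ≤ (δ / 2 / ‖η‖)⁻¹ * 1 := by
    rw [← div_eq_inv_mul, le_div_iff₀ (by positivity)]
    linarith
  refine h5.trans_eq ?_
  field_simp

/-- The same, with the compact set replaced by the image of a compact operator. -/
theorem eventually_norm_sub_le_mul_of_isCompactOperator {H : Type*} [NormedAddCommGroup H]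
    [NormedSpace ℝ H] (hΛ : ContinuousOn (fun z : X × F => Λ z.1 z.2) (s ×ˢ univ))
    (hsmul : ∀ y ∈ s, ∀ (c : ℝ) η, Λ y (c • η) = c • Λ y η) (hy : y₀ ∈ s)
    {T : H →L[ℝ] F} (hT : IsCompactOperator T) {ε : ℝ} (hε : 0 < ε) :
    ∀ᶠ y in 𝓝[s] y₀, ∀ ξ, ‖Λ y (T ξ) - Λ y₀ (T ξ)‖ ≤ ε * ‖ξ‖ := by
  obtain ⟨K, hK, hTK⟩ :=
    IsCompactOperator.image_closedBall_subset_compact (f := (T : H →ₗ[ℝ] F)) hT 1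
  filter_upwards [eventually_norm_sub_le_of_continuousOn hΛ hy hK hε, self_mem_nhdsWithin]
    with y h hys ξ
  rcases eq_or_ne ξ 0 with rfl | hξ
  · have h0 : ∀ z ∈ s, Λ z 0 = 0 := fun z hz => by simpa using hsmul z hz 0 0
    simp [h0 y hys, h0 y₀ hy]
  have hn : 0 < ‖ξ‖ := norm_pos_iff.2 hξ
  have h1 := h (T (‖ξ‖⁻¹ • ξ)) (hTK ⟨_, by simp [norm_smul, hn.ne'], rfl⟩)
  rw [map_smul, hsmul y hys, hsmul y₀ hy, ← smul_sub, norm_smul, norm_inv, norm_norm,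
    ← div_eq_inv_mul, div_le_iff₀ hn] at h1
  exact h1

end Families

/-! ### The chain rule -/

section ChainRule

variable {E : ScBanach.{u}} {F : ScBanach.{v}} {G : ScBanach.{w}}
  {D : ∀ m, Set (E.X m)} {D' : ∀ m, Set (F.X m)}

theorem isCompactOperator_ι_one (E : ScBanach.{u}) : IsCompactOperator (E.ι 1) :=
  E.incl_compact 0

/-- The mean value estimate for a sc-differentiable map on a convex part of its domain. -/
theorem norm_sub_sub_le_of_hasScDerivAt {f : F.X 0 → G.X 0} {S : F.X 1 → F.X 0 →L[ℝ] G.X 0}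
    {N : Set (F.X 1)} (hN : Convex ℝ N) (hND : N ⊆ D' 1)
    (hf : ∀ y ∈ N, HasScDerivAt F G D' f y (S y)) {y₀ y₁ : F.X 1} (h₀ : y₀ ∈ N) (h₁ : y₁ ∈ N)
    {c : ℝ} (hc : ∀ y ∈ N, ‖S y (F.ι 1 (y₁ - y₀)) - S y₀ (F.ι 1 (y₁ - y₀))‖ ≤ c) :
    ‖f (F.ι 1 y₁) - f (F.ι 1 y₀) - S y₀ (F.ι 1 (y₁ - y₀))‖ ≤ c := by
  have hmem : ∀ t ∈ Icc (0 : ℝ) 1, y₀ + t • (y₁ - y₀) ∈ N := fun t ht =>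
    hN.add_smul_sub_mem h₀ h₁ ht
  have hline : ∀ t : ℝ, HasDerivWithinAt (fun t : ℝ => y₀ + t • (y₁ - y₀)) (y₁ - y₀)
      (Icc 0 1) t := fun t => by
    have := ((hasDerivAt_id t).smul_const (y₁ - y₀)).const_add y₀
    simpa using this.hasDerivWithinAt
  -- Subtracting the linear term `t • S y₀ (y₁ - y₀)` leaves a curve whose velocity is the
  -- difference of differentials bounded by `c`.
  have hd : ∀ t ∈ Icc (0 : ℝ) 1, HasDerivWithinAt
      (fun t : ℝ => f (F.ι 1 (y₀ + t • (y₁ - y₀))) - t • S y₀ (F.ι 1 (y₁ - y₀)))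
      (S (y₀ + t • (y₁ - y₀)) (F.ι 1 (y₁ - y₀)) - S y₀ (F.ι 1 (y₁ - y₀))) (Icc 0 1) t := by
    intro t ht
    have h1 : HasFDerivWithinAt (fun y : F.X 1 => f (F.ι 1 y))
        ((S (y₀ + t • (y₁ - y₀))).comp (F.ι 1)) (D' 1) (y₀ + t • (y₁ - y₀)) :=
      hf _ (hmem t ht)
    have h2 := h1.comp_hasDerivWithinAt t (hline t) fun r hr => hND (hmem r hr)
    have h3 := ((hasDerivAt_id t).smul_const (S y₀ (F.ι 1 (y₁ - y₀)))).hasDerivWithinAt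
      (s := Icc (0 : ℝ) 1)
    rw [one_smul] at h3
    exact h2.sub h3
  have := norm_image_sub_le_of_norm_deriv_le_segment_01' hd fun t ht =>
    hc _ (hmem t (Ico_subset_Icc_self ht))
  simpa [sub_right_comm] using this

/-- The chain rule of sc-calculus at a point. -/
theorem HasScDerivAt.comp (hD' : IsScDom F D') {f : F.X 0 → G.X 0}
    {S : F.X 1 → F.X 0 →L[ℝ] G.X 0} (hf : ∀ y ∈ D' 1, HasScDerivAt F G D' f y (S y))
    (hS : ContinuousOn (fun z : F.X 1 × F.X 0 => S z.1 z.2) (D' 1 ×ˢ univ))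
    {g : E.X 0 → F.X 0} {x : E.X 1} {T : E.X 0 →L[ℝ] F.X 0} (hg : HasScDerivAt E F D g x T)
    (hx : x ∈ D 1) {g₁ : E.X 1 → F.X 1} (hg₁ : ContinuousWithinAt g₁ (D 1) x)
    (hgg : ∀ y ∈ D 1, F.ι 1 (g₁ y) = g (E.ι 1 y)) (hmem : ∀ᶠ y in 𝓝[D 1] x, g₁ y ∈ D' 1) :
    HasScDerivAt E G D (fun y => f (g y)) x ((S (g₁ x)).comp T) := by
  have hyD : g₁ x ∈ D' 1 := hmem.self_of_nhdsWithin hx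
  have hsmul : ∀ y ∈ D' 1, ∀ (c : ℝ) η, S y (c • η) = c • S y η := fun y _ c η => map_smul _ _ _
  -- The decisive compactness: `S` need not be continuous in operator norm, but it is uniformly
  -- close to `S (g₁ x)` on the image of a compact operator.
  have hTc : IsCompactOperator (T.comp (E.ι 1)) := (isCompactOperator_ι_one E).clm_comp T
  obtain ⟨c, hc, hbound⟩ := eventually_norm_le_of_continuousOn hS hsmul hyD
  rw [HasScDerivAt, hasFDerivWithinAt_iff_isLittleO, Asymptotics.isLittleO_iff]
  intro ε hε
  -- With increment `T (y - x) + o` and `‖o‖ ≤ ε₁ ‖y - x‖`: one `ε₁` from varying `S` on `T (y -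
  -- x)`, `2 c ε₁` from varying `S` on `o`, and `c ε₁` from `S (g₁ x) o`.
  obtain ⟨ε₁, hε₁, hε₂⟩ : ∃ ε₁ > 0, ε₁ + 3 * c * ε₁ ≤ ε := by
    refine ⟨ε / (1 + 3 * c), by positivity, le_of_eq ?_⟩
    field_simp
  have hcomp := eventually_norm_sub_le_mul_of_isCompactOperator hS hsmul hyD hTc hε₁
  obtain ⟨ρ₀, hρ₀, hball⟩ := Metric.mem_nhdsWithin_iff.1 (hbound.and hcomp)
  obtain ⟨ρ, hρ, hρρ₀, hconv⟩ := hD'.exists_convex_nhds 1 (g₁ x) hyD ρ₀ hρ₀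
  have hN : ∀ y ∈ Metric.ball (g₁ x) ρ ∩ D' 1, (∀ η, ‖S y η‖ ≤ c * ‖η‖) ∧
      ∀ ξ, ‖S y (T (E.ι 1 ξ)) - S (g₁ x) (T (E.ι 1 ξ))‖ ≤ ε₁ * ‖ξ‖ := fun y hy =>
    hball ⟨Metric.ball_subset_ball hρρ₀ hy.1, hy.2⟩
  have hx0 : g₁ x ∈ Metric.ball (g₁ x) ρ ∩ D' 1 := ⟨Metric.mem_ball_self hρ, hyD⟩
  have hgo : ∀ᶠ y in 𝓝[D 1] x,
      ‖g (E.ι 1 y) - g (E.ι 1 x) - T (E.ι 1 (y - x))‖ ≤ ε₁ * ‖y - x‖ :=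
    (hasFDerivWithinAt_iff_isLittleO.1 hg).def hε₁
  filter_upwards [hgo, hmem, hg₁ (Metric.ball_mem_nhds _ hρ), self_mem_nhdsWithin]
    with y h1 h2 h3 hyD1
  set o := g (E.ι 1 y) - g (E.ι 1 x) - T (E.ι 1 (y - x)) with ho
  have hΔ : F.ι 1 (g₁ y - g₁ x) = T (E.ι 1 (y - x)) + o := by
    rw [map_sub, hgg y hyD1, hgg x hx, ho]
    abel
  have hmv := norm_sub_sub_le_of_hasScDerivAt (D' := D') (f := f) (S := S) hconv
    inter_subset_right (fun z hz => hf z hz.2) hx0 ⟨h3, h2⟩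
    (c := (ε₁ + 2 * c * ε₁) * ‖y - x‖) (fun z hz => by
      rw [hΔ, map_add, map_add, add_sub_add_comm]
      have e1 := (hN z hz).2 (y - x)
      have e2 := (hN z hz).1 o
      have e3 := (hN _ hx0).1 o
      have e4 : ‖S z o - S (g₁ x) o‖ ≤ c * ‖o‖ + c * ‖o‖ := (norm_sub_le _ _).trans (add_le_add e2 e3)
      have e5 : c * ‖o‖ ≤ c * (ε₁ * ‖y - x‖) := by gcongr
      refine (norm_add_le _ _).trans ?_
      linarith)
  rw [hgg y hyD1, hgg x hx, hΔ, map_add] at hmv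
  have e6 : ‖S (g₁ x) o‖ ≤ c * (ε₁ * ‖y - x‖) := ((hN _ hx0).1 o).trans (by gcongr)
  have e7 : f (g (E.ι 1 y)) - f (g (E.ι 1 x)) - ((S (g₁ x)).comp T).comp (E.ι 1) (y - x)
      = (f (g (E.ι 1 y)) - f (g (E.ι 1 x)) - (S (g₁ x) (T (E.ι 1 (y - x))) + S (g₁ x) o))
        + S (g₁ x) o := by
    simp only [ContinuousLinearMap.comp_apply]
    abel
  have e8 : (ε₁ + 3 * c * ε₁) * ‖y - x‖ ≤ ε * ‖y - x‖ := by gcongr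
  rw [e7]
  refine (norm_add_le _ _).trans ?_
  linarith

/-- The product rule for a family of linear maps, at a point where its argument vanishes. -/
theorem HasScDerivAt.family_apply {H : ScBanach.{w}} {X : Type*} [TopologicalSpace X]
    {Λ : X → F.X 0 → H.X 0} {s : Set X}
    (hΛ : ContinuousOn (fun z : X × F.X 0 => Λ z.1 z.2) (s ×ˢ univ))
    (hsmul : ∀ y ∈ s, ∀ (c : ℝ) η, Λ y (c • η) = c • Λ y η)
    (hadd : ∀ y ∈ s, ∀ η η', Λ y (η + η') = Λ y η + Λ y η')
    {α : E.X 0 → X} {β : E.X 0 → F.X 0} {x : E.X 1} {T : E.X 0 →L[ℝ] F.X 0}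
    (hβ : HasScDerivAt E F D β x T) (hβx : β (E.ι 1 x) = 0) (hx : x ∈ D 1)
    (hα : ContinuousWithinAt (fun y : E.X 1 => α (E.ι 1 y)) (D 1) x)
    (hmem : ∀ y ∈ D 1, α (E.ι 1 y) ∈ s) {Λ₀ : F.X 0 →L[ℝ] H.X 0}
    (hΛ₀ : ∀ η, Λ₀ η = Λ (α (E.ι 1 x)) η) :
    HasScDerivAt E H D (fun y => Λ (α y) (β y)) x (Λ₀.comp T) := by
  have hxs := hmem x hx
  -- No derivative of `Λ` in its parameter enters, because `β` vanishes at `x`; strong continuity on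
  -- the compact image suffices.
  have hTc : IsCompactOperator (T.comp (E.ι 1)) := (isCompactOperator_ι_one E).clm_comp T
  obtain ⟨c, hc, hbound⟩ := eventually_norm_le_of_continuousOn hΛ hsmul hxs
  have hα' : Tendsto (fun y : E.X 1 => α (E.ι 1 y)) (𝓝[D 1] x) (𝓝[s] (α (E.ι 1 x))) :=
    tendsto_nhdsWithin_iff.2 ⟨hα, eventually_nhdsWithin_of_forall hmem⟩
  rw [HasScDerivAt, hasFDerivWithinAt_iff_isLittleO, Asymptotics.isLittleO_iff]
  intro ε hε
  obtain ⟨ε₁, hε₁, hε₂⟩ : ∃ ε₁ > 0, ε₁ + c * ε₁ ≤ ε := by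
    refine ⟨ε / (1 + c), by positivity, le_of_eq ?_⟩
    field_simp
  have hcomp := eventually_norm_sub_le_mul_of_isCompactOperator hΛ hsmul hxs hTc hε₁
  have hβo : ∀ᶠ y in 𝓝[D 1] x,
      ‖β (E.ι 1 y) - β (E.ι 1 x) - T (E.ι 1 (y - x))‖ ≤ ε₁ * ‖y - x‖ :=
    (hasFDerivWithinAt_iff_isLittleO.1 hβ).def hε₁
  filter_upwards [hβo, hα'.eventually hbound, hα'.eventually hcomp, self_mem_nhdsWithin]
    with y h1 h2 h3 hyD1
  rw [hβx, sub_zero] at h1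
  have h4 := h2 (β (E.ι 1 y) - T (E.ι 1 (y - x)))
  have h5 := h3 (y - x)
  have h0 : Λ (α (E.ι 1 x)) 0 = 0 := by simpa using hsmul _ hxs 0 0
  have h6 : Λ (α (E.ι 1 y)) (β (E.ι 1 y)) = Λ (α (E.ι 1 y)) (T (E.ι 1 (y - x)))
      + Λ (α (E.ι 1 y)) (β (E.ι 1 y) - T (E.ι 1 (y - x))) := by
    rw [← hadd _ (hmem y hyD1), add_sub_cancel]
  simp only [ContinuousLinearMap.comp_apply] at h5 ⊢
  rw [hβx, h0, sub_zero, hΛ₀, h6, add_sub_right_comm]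
  have h7 : c * ‖β (E.ι 1 y) - T (E.ι 1 (y - x))‖ ≤ c * (ε₁ * ‖y - x‖) := by gcongr
  have e8 : (ε₁ + c * ε₁) * ‖y - x‖ ≤ ε * ‖y - x‖ := by gcongr
  refine (norm_add_le _ _).trans ?_
  linarith

end ChainRule

/-! ### Sc-smooth maps -/

section Smooth

theorem Sc0.congr {E : ScBanach.{u}} {F : ScBanach.{v}} {D : ∀ m, Set (E.X m)}
    {f g : E.X 0 → F.X 0} (hf : Sc0 E F D f)
    (h : ∀ m, ∀ x ∈ D m, g (E.ι m x) = f (E.ι m x)) : Sc0 E F D g := fun m => by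
  obtain ⟨φ, hφ, e⟩ := hf m
  exact ⟨φ, hφ, fun x hx => by rw [e x hx, h m x hx]⟩

theorem ScCk.congr {E : ScBanach.{u}} {F : ScBanach.{v}} {D : ∀ m, Set (E.X m)}
    {f g : E.X 0 → F.X 0} {k : ℕ} (hf : ScCk k E F D f)
    (h : ∀ m, ∀ x ∈ D m, g (E.ι m x) = f (E.ι m x)) : ScCk k E F D g := by
  cases k with
  | zero => exact Sc0.congr hf h
  | succ k =>
    obtain ⟨h0, Tf, hT, hk⟩ := hf
    refine ⟨h0.congr h, Tf, fun x hx => ?_, hk⟩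
    obtain ⟨T, hd, hTf⟩ := hT x hx
    exact ⟨T, hd.congr hx (h 1), fun ξ => by rw [h 1 x hx]; exact hTf ξ⟩

theorem ScSmooth.congr {E : ScBanach.{u}} {F : ScBanach.{v}} {D : ∀ m, Set (E.X m)}
    {f g : E.X 0 → F.X 0} (hf : ScSmooth E F D f)
    (h : ∀ m, ∀ x ∈ D m, g (E.ι m x) = f (E.ι m x)) : ScSmooth E F D g :=
  fun k => (hf k).congr h

theorem ScCk.sc0 {E : ScBanach.{u}} {F : ScBanach.{v}} {D : ∀ m, Set (E.X m)} {f : E.X 0 → F.X 0}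
    {k : ℕ} (hf : ScCk k E F D f) : Sc0 E F D f := by
  cases k with
  | zero => exact hf
  | succ k => exact hf.1

theorem ScSmooth.sc0 {E : ScBanach.{u}} {F : ScBanach.{v}} {D : ∀ m, Set (E.X m)}
    {f : E.X 0 → F.X 0} (hf : ScSmooth E F D f) : Sc0 E F D f := hf 0

theorem Sc0.continuousOn {E : ScBanach.{u}} {F : ScBanach.{v}} {D : ∀ m, Set (E.X m)}
    {f : E.X 0 → F.X 0} (hf : Sc0 E F D f) : ContinuousOn f (D 0) := by
  obtain ⟨g, hg, e⟩ := hf 0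
  exact hg.congr fun x hx => (e x hx).symm

/-- `f` maps the domain `D` into the domain `D'`. -/
def ScMapsTo (E : ScBanach.{u}) (F : ScBanach.{v}) (D : ∀ m, Set (E.X m)) (D' : ∀ m, Set (F.X m))
    (f : E.X 0 → F.X 0) : Prop :=
  ∀ m, ∀ x ∈ D m, ∃ y ∈ D' m, F.ι m y = f (E.ι m x)

/-- The differentials of a map of class sc¹ form a jointly continuous family. -/
theorem ScCk.exists_deriv {E : ScBanach.{u}} {F : ScBanach.{v}} {D : ∀ m, Set (E.X m)}
    {f : E.X 0 → F.X 0} (hf : ScCk 1 E F D f) :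
    ∃ S : E.X 1 → E.X 0 →L[ℝ] F.X 0, (∀ x ∈ D 1, HasScDerivAt E F D f x (S x)) ∧
      ContinuousOn (fun z : E.X 1 × E.X 0 => S z.1 z.2) (D 1 ×ˢ univ) := by
  obtain ⟨-, Tf, hT, h0⟩ := hf
  choose! S hS hTf using hT
  refine ⟨S, hS, ?_⟩
  have h1 : ContinuousOn (fun z => (Tf z).2) (tanDom E D 0) :=
    continuous_snd.comp_continuousOn (Sc0.continuousOn h0)
  refine (h1.mono fun z hz => hz.1).congr fun z hz => ?_
  exact ((hTf z.1 hz.1 z.2).2).symm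

theorem ScCk.mono_one {E : ScBanach.{u}} {F : ScBanach.{v}} {D : ∀ m, Set (E.X m)}
    {f : E.X 0 → F.X 0} {k : ℕ} (hf : ScCk (k + 1) E F D f) : ScCk 1 E F D f := by
  obtain ⟨h0, Tf, hT, hk⟩ := hf
  exact ⟨h0, Tf, hT, hk.sc0⟩

theorem Sc0.comp {E : ScBanach.{u}} {F : ScBanach.{v}} {G : ScBanach.{w}}
    {D : ∀ m, Set (E.X m)} {D' : ∀ m, Set (F.X m)} {f : F.X 0 → G.X 0} {g : E.X 0 → F.X 0}
    (hf : Sc0 F G D' f) (hg : Sc0 E F D g) (hm : ScMapsTo E F D D' g) :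
    Sc0 E G D (fun x => f (g x)) := fun m => by
  obtain ⟨φ, hφ, eφ⟩ := hf m
  obtain ⟨γ, hγ, eγ⟩ := hg m
  have hmaps : MapsTo γ (D m) (D' m) := fun x hx => by
    obtain ⟨y, hy, e⟩ := hm m x hx
    rwa [F.ι_injective m ((eγ x hx).trans e.symm)]
  refine ⟨fun x => φ (γ x), hφ.comp hγ hmaps, fun x hx => ?_⟩
  rw [eφ _ (hmaps hx), eγ x hx]

/-- The chain rule of sc-calculus. -/
theorem ScCk.comp (k : ℕ) : ∀ {E : ScBanach.{u}} {F : ScBanach.{v}} {G : ScBanach.{w}}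
    {D : ∀ m, Set (E.X m)} {D' : ∀ m, Set (F.X m)} {f : F.X 0 → G.X 0} {g : E.X 0 → F.X 0},
    IsScDom E D → IsScDom F D' → ScCk k F G D' f → ScCk k E F D g → ScMapsTo E F D D' g →
    ScCk k E G D (fun x => f (g x)) := by
  induction k with
  | zero => exact fun _ _ hf hg hm => Sc0.comp hf hg hm
  | succ k ih =>
    intro E F G D D' f g hD hD' hf hg hm
    obtain ⟨S, hS, hSc⟩ := ScCk.exists_deriv hf.mono_one
    refine ⟨hf.sc0.comp hg.sc0 hm, ?_⟩
    obtain ⟨-, Tf, hTf, hfk⟩ := hf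
    obtain ⟨hg0, Tg, hTg, hgk⟩ := hg
    obtain ⟨γ, hγ, eγ⟩ := hg0 1
    have hmaps : MapsTo γ (D 1) (D' 1) := fun x hx => by
      obtain ⟨y, hy, e⟩ := hm 1 x hx
      rwa [F.ι_injective 1 ((eγ x hx).trans e.symm)]
    have hTg1 : ∀ x ∈ D 1, ∀ ξ, (Tg (x, ξ)).1 = γ x := fun x hx ξ => by
      obtain ⟨T, -, h⟩ := hTg x hx
      exact F.ι_injective 1 ((h ξ).1.trans (eγ x hx).symm)
    refine ⟨fun z => Tf (Tg z), fun x hx => ?_, ih hD.tanDom hD'.tanDom hfk hgk ?_⟩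
    · obtain ⟨T, hT, h⟩ := hTg x hx
      obtain ⟨S', hS', h'⟩ := hTf (γ x) (hmaps hx)
      have hSS : S (γ x) = S' :=
        (hS _ (hmaps hx)).unique (hD'.uniqueDiff 1 _ (hmaps hx)) hS'
      refine ⟨(S (γ x)).comp T, HasScDerivAt.comp hD' hS hSc hT hx (hγ x hx) eγ
        (eventually_nhdsWithin_of_forall hmaps), fun ξ => ?_⟩
      have e : Tg (x, ξ) = (γ x, T ξ) := Prod.ext (hTg1 x hx ξ) (h ξ).2
      change G.ι 1 (Tf (Tg (x, ξ))).1 = f (g (E.ι 1 x)) ∧ (Tf (Tg (x, ξ))).2 = S (γ x) (T ξ)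
      rw [e, (h' _).1, (h' _).2, eγ x hx, hSS]
      exact ⟨rfl, rfl⟩
    -- The base component of `Tg` has to land in `D' (m + 1)`, one level higher than `m`; `hm` at
    -- level `m + 1` provides this.
    · rintro m ⟨x, ξ⟩ hx
      obtain ⟨y, hy, e⟩ := hm (m + 1) x hx
      obtain ⟨τ, -, eτ⟩ := hgk.sc0 m
      have e1 := eτ (x, ξ) hx
      rw [ScBanach.ι_prod] at e1
      refine ⟨(y, (τ (x, ξ)).2), hy, ?_⟩
      rw [ScBanach.ι_prod, ← e1]
      refine Prod.ext ?_ rfl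
      have e2 := hTg1 _ (hD.ι_shift_mem m x hx) (E.ι m ξ)
      rw [ScBanach.ι_prod] at e1
      refine Eq.trans ?_ (congrArg Prod.fst e1).symm
      refine Eq.trans ?_ e2.symm
      refine F.ι_injective 1 ?_
      rw [F.ι_one_shift, e, eγ _ (hD.ι_shift_mem m x hx), E.ι_one_shift]

theorem ScSmooth.comp {E : ScBanach.{u}} {F : ScBanach.{v}} {G : ScBanach.{w}}
    {D : ∀ m, Set (E.X m)} {D' : ∀ m, Set (F.X m)} {f : F.X 0 → G.X 0} {g : E.X 0 → F.X 0}
    (hf : ScSmooth F G D' f) (hg : ScSmooth E F D g) (hD : IsScDom E D) (hD' : IsScDom F D')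
    (hm : ScMapsTo E F D D' g) : ScSmooth E G D (fun x => f (g x)) :=
  fun k => ScCk.comp k hD hD' (hf k) (hg k) hm

theorem ScLin.scCk (k : ℕ) : ∀ {E : ScBanach.{u}} {F : ScBanach.{v}} (D : ∀ m, Set (E.X m))
    (L : ScLin E F), ScCk k E F D (L.lvl 0) := by
  have h0 : ∀ {E : ScBanach.{u}} {F : ScBanach.{v}} (D : ∀ m, Set (E.X m)) (L : ScLin E F),
      Sc0 E F D (L.lvl 0) := fun D L m =>
    ⟨L.lvl m, (L.lvl m).continuous.continuousOn, fun x _ => L.ι_lvl m x⟩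
  induction k with
  | zero => exact h0
  | succ k ih =>
    intro E F D L
    refine ⟨h0 D L, L.tan.lvl 0, fun x _ => ⟨L.lvl 0, L.hasScDerivAt x, fun ξ => ⟨?_, rfl⟩⟩,
      ih _ _⟩
    exact L.ι_lvl 1 x

theorem ScLin.scSmooth {E : ScBanach.{u}} {F : ScBanach.{v}} (D : ∀ m, Set (E.X m))
    (L : ScLin E F) : ScSmooth E F D (L.lvl 0) := fun k => L.scCk k D

theorem isScDom_univ (E : ScBanach.{u}) : IsScDom E (fun _ => univ) where
  anti _ _ _ := mem_univ _
  rel_open m := ⟨univ, univ, isOpen_univ, convex_univ, by simp, by simp⟩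

theorem ScSmooth.scLin_comp {E : ScBanach.{u}} {F : ScBanach.{v}} {G : ScBanach.{w}}
    {D : ∀ m, Set (E.X m)} {g : E.X 0 → F.X 0} (L : ScLin F G) (hg : ScSmooth E F D g)
    (hD : IsScDom E D) : ScSmooth E G D (fun x => L.lvl 0 (g x)) :=
  (L.scSmooth _).comp hg hD (isScDom_univ F) fun m x hx => by
    obtain ⟨γ, -, e⟩ := hg.sc0 m
    exact ⟨γ x, mem_univ _, e x hx⟩

theorem ScSmooth.comp_scLin {E : ScBanach.{u}} {F : ScBanach.{v}} {G : ScBanach.{w}}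
    {D : ∀ m, Set (E.X m)} {D' : ∀ m, Set (F.X m)} {f : F.X 0 → G.X 0} (L : ScLin E F)
    (hf : ScSmooth F G D' f) (hD : IsScDom E D) (hD' : IsScDom F D')
    (hm : ∀ m, MapsTo (L.lvl m) (D m) (D' m)) : ScSmooth E G D (fun x => f (L.lvl 0 x)) :=
  hf.comp (L.scSmooth D) hD hD' fun m x hx => ⟨_, hm m hx, L.ι_lvl m x⟩

theorem ScCk.prodMk (k : ℕ) : ∀ {E : ScBanach.{u}} {F : ScBanach.{v}} {G : ScBanach.{w}}
    {D : ∀ m, Set (E.X m)} {f : E.X 0 → F.X 0} {g : E.X 0 → G.X 0}, IsScDom E D →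
    ScCk k E F D f → ScCk k E G D g → ScCk k E (F.prod G) D (fun x => (f x, g x)) := by
  have h0 : ∀ {E : ScBanach.{u}} {F : ScBanach.{v}} {G : ScBanach.{w}}
      {D : ∀ m, Set (E.X m)} {f : E.X 0 → F.X 0} {g : E.X 0 → G.X 0},
      Sc0 E F D f → Sc0 E G D g → Sc0 E (F.prod G) D (fun x => (f x, g x)) := by
    intro E F G D f g hf hg m
    obtain ⟨φ, hφ, eφ⟩ := hf m
    obtain ⟨γ, hγ, eγ⟩ := hg m
    refine ⟨fun x => (φ x, γ x), hφ.prodMk hγ, fun x hx => ?_⟩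
    rw [ScBanach.ι_prod]
    exact Prod.ext (eφ x hx) (eγ x hx)
  induction k with
  | zero => exact fun _ hf hg => h0 hf hg
  | succ k ih =>
    intro E F G D f g hD hf hg
    refine ⟨h0 hf.sc0 hg.sc0, ?_⟩
    obtain ⟨-, Tf, hTf, hfk⟩ := hf
    obtain ⟨-, Tg, hTg, hgk⟩ := hg
    -- The tangent map of the pair is the pair of tangent maps with base and vector components
    -- regrouped.
    let shuffle : ScLin (F.tan.prod G.tan) (F.prod G).tan :=
      { lvl := fun m =>
          (((ContinuousLinearMap.fst ℝ (F.X (m + 1)) (F.X m)).comp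
              (ContinuousLinearMap.fst ℝ (F.tan.X m) (G.tan.X m))).prod
            ((ContinuousLinearMap.fst ℝ (G.X (m + 1)) (G.X m)).comp
              (ContinuousLinearMap.snd ℝ (F.tan.X m) (G.tan.X m)))).prod
          (((ContinuousLinearMap.snd ℝ (F.X (m + 1)) (F.X m)).comp
              (ContinuousLinearMap.fst ℝ (F.tan.X m) (G.tan.X m))).prod
            ((ContinuousLinearMap.snd ℝ (G.X (m + 1)) (G.X m)).comp
              (ContinuousLinearMap.snd ℝ (F.tan.X m) (G.tan.X m))))
        comm := fun _ _ => rfl }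
    have hpair := ih hD.tanDom hfk hgk
    have h1 : ScCk k E.tan (F.prod G).tan (tanDom E D)
        (fun z => shuffle.lvl 0 (Tf z, Tg z)) :=
      ScCk.comp k hD.tanDom (isScDom_univ _) (shuffle.scCk k _) hpair fun m x hx => by
        obtain ⟨γ, -, e⟩ := hpair.sc0 m
        exact ⟨γ x, mem_univ _, e x hx⟩
    refine ⟨_, fun x hx => ?_, h1⟩
    obtain ⟨S, hS, eS⟩ := hTf x hx
    obtain ⟨T, hT, eT⟩ := hTg x hx
    refine ⟨S.prod T, HasFDerivWithinAt.prodMk hS hT, fun ξ => ⟨?_, ?_⟩⟩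
    · rw [ScBanach.ι_prod]
      exact Prod.ext (eS ξ).1 (eT ξ).1
    · exact Prod.ext (eS ξ).2 (eT ξ).2

theorem ScSmooth.prodMk {E : ScBanach.{u}} {F : ScBanach.{v}} {G : ScBanach.{w}}
    {D : ∀ m, Set (E.X m)} {f : E.X 0 → F.X 0} {g : E.X 0 → G.X 0} (hf : ScSmooth E F D f)
    (hg : ScSmooth E G D g) (hD : IsScDom E D) :
    ScSmooth E (F.prod G) D (fun x => (f x, g x)) :=
  fun k => ScCk.prodMk k hD (hf k) (hg k)

theorem ScSmooth.sub {E : ScBanach.{u}} {F : ScBanach.{v}}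
    {D : ∀ m, Set (E.X m)} {f g : E.X 0 → F.X 0} (hf : ScSmooth E F D f)
    (hg : ScSmooth E F D g) (hD : IsScDom E D) : ScSmooth E F D (fun x => f x - g x) :=
  (hf.prodMk hg hD).scLin_comp ((ScLin.fst F F).sub (ScLin.snd F F)) hD

end Smooth

/-! ### Operators up to compact perturbation -/

section Compact

variable {E F G H : Type*} [NormedAddCommGroup E] [NormedSpace ℝ E] [NormedAddCommGroup F]
  [NormedSpace ℝ F] [NormedAddCommGroup G] [NormedSpace ℝ G] [NormedAddCommGroup H]
  [NormedSpace ℝ H]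

/-- Equality up to a compact operator. -/
def CompactEq (A B : E →L[ℝ] F) : Prop := IsCompactOperator (A - B)

theorem CompactEq.symm {A B : E →L[ℝ] F} (h : CompactEq A B) : CompactEq B A := by
  have : IsCompactOperator (-(A - B)) := IsCompactOperator.neg h
  rwa [neg_sub] at this

theorem CompactEq.trans {A B C : E →L[ℝ] F} (h : CompactEq A B) (h' : CompactEq B C) :
    CompactEq A C := by
  have : IsCompactOperator ((A - B) + (B - C)) := IsCompactOperator.add h h'
  rwa [sub_add_sub_cancel] at this

theorem CompactEq.clm_comp {A B : E →L[ℝ] F} (h : CompactEq A B) (L : F →L[ℝ] G) :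
    CompactEq (L.comp A) (L.comp B) := by
  have : IsCompactOperator (L.comp (A - B)) := IsCompactOperator.clm_comp h L
  rwa [ContinuousLinearMap.comp_sub] at this

theorem CompactEq.comp_clm {A B : E →L[ℝ] F} (h : CompactEq A B) (L : G →L[ℝ] E) :
    CompactEq (A.comp L) (B.comp L) := by
  have : IsCompactOperator ((A - B).comp L) := IsCompactOperator.comp_clm h L
  rwa [ContinuousLinearMap.sub_comp] at this

theorem isCompactOperator_prod {T : E →L[ℝ] F × G}
    (h₁ : IsCompactOperator ((ContinuousLinearMap.fst ℝ F G).comp T))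
    (h₂ : IsCompactOperator ((ContinuousLinearMap.snd ℝ F G).comp T)) : IsCompactOperator T := by
  have e : T = (ContinuousLinearMap.inl ℝ F G).comp ((ContinuousLinearMap.fst ℝ F G).comp T) +
      (ContinuousLinearMap.inr ℝ F G).comp ((ContinuousLinearMap.snd ℝ F G).comp T) := by
    ext x <;> simp
  rw [e]
  exact IsCompactOperator.add (IsCompactOperator.clm_comp h₁ (ContinuousLinearMap.inl ℝ F G))
    (IsCompactOperator.clm_comp h₂ (ContinuousLinearMap.inr ℝ F G))

theorem isCompactOperator_of_finiteDimensional_rng [FiniteDimensional ℝ F] (T : E →L[ℝ] F) :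
    IsCompactOperator T :=
  haveI := FiniteDimensional.proper_real F
  isCompactOperator_of_locallyCompactSpace_dom T

theorem isCompactOperator_of_finiteDimensional_dom [FiniteDimensional ℝ E] (T : E →L[ℝ] F) :
    IsCompactOperator T :=
  haveI := FiniteDimensional.proper_real E
  isCompactOperator_of_locallyCompactSpace_rng T

/-- The Fredholm alternative for a compact perturbation of the identity. -/
theorem surjective_of_injective_of_compactEq [CompleteSpace E] {T : E →L[ℝ] E}
    (hT : CompactEq T (ContinuousLinearMap.id ℝ E)) (hi : Function.Injective T) :
    Function.Surjective T := by
  -- The alternative is applied to the compact operator `T - 1` at the value `-1`: an eigenvector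
  -- would be a kernel vector of `T`.
  rcases IsCompactOperator.hasEigenvalue_or_mem_resolventSet hT
    (neg_ne_zero.2 (one_ne_zero (α := ℝ))) with h | h
  · obtain ⟨x, hx⟩ := h.exists_hasEigenvector
    refine absurd (hi ?_) hx.2
    have := hx.apply_eq_smul
    simpa using this
  · rw [spectrum.mem_resolventSet_iff] at h
    intro y
    obtain ⟨S, hS⟩ := h
    -- The invertible operator of the resolvent condition is `-1 - (T - 1) = -T`, hence the sign.
    refine ⟨-(S⁻¹.1 y), ?_⟩
    have h1 : (S.1 * S⁻¹.1) y = y := by simp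
    rw [hS, Algebra.algebraMap_eq_smul_one] at h1
    refine Eq.trans ?_ h1
    simp
    abel

/-! ### Comparison of indices through the Fredholm alternative -/

/-- The projection `ℝᵏ × W → W` followed by the inclusion `W → ℝˡ × W`. -/
def modelOp (k l : ℕ) (W : Type*) [NormedAddCommGroup W] [NormedSpace ℝ W] :
    EuclideanSpace ℝ (Fin k) × W →L[ℝ] EuclideanSpace ℝ (Fin l) × W :=
  (ContinuousLinearMap.inr ℝ _ _).comp (ContinuousLinearMap.snd ℝ _ _)

@[simp] theorem modelOp_apply (k l : ℕ) (W : Type*) [NormedAddCommGroup W] [NormedSpace ℝ W]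
    (x : EuclideanSpace ℝ (Fin k) × W) : modelOp k l W x = (0, x.2) := rfl

theorem exists_injective_not_surjective {V V' : Type*} [NormedAddCommGroup V] [NormedSpace ℝ V]
    [FiniteDimensional ℝ V] [NormedAddCommGroup V'] [NormedSpace ℝ V'] [FiniteDimensional ℝ V']
    (h : Module.finrank ℝ V < Module.finrank ℝ V') :
    ∃ T : V →L[ℝ] V', Function.Injective T ∧ ¬ Function.Surjective T := by
  obtain ⟨T, hT⟩ := Module.Free.exists_linearMap_injective_of_lift_rank_lt (R := ℝ) (M := V) (N' := V') (by
    rw [← Module.finrank_eq_rank, ← Module.finrank_eq_rank, Cardinal.lift_natCast,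
      Cardinal.lift_natCast]
    exact_mod_cast h)
  refine ⟨T.toContinuousLinearMap, hT, fun hs => ?_⟩
  exact absurd (LinearMap.finrank_le_finrank_of_surjective (f := T) hs) (not_le.2 h)

/-- The model operators have indices `k - l` and `k' - l'`, so this is half of the invariance of the
index. If it failed, there would be a linear `j : ℝᵏ × ℝ^l' → ℝˡ × ℝ^k'` that is injective but not
onto. For `z = ((b, c), u)` put `y = Y⁻¹ u` and `x = X⁻¹ (b, y.2)`. The map `z ↦ (j (y.1, x.1), (c,
x.2))` is injective, not onto, and a compact perturbation of the identity, which the Fredholm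
alternative excludes. -/
theorem add_le_add_of_compactEq_modelOp {W W' : Type*} [NormedAddCommGroup W] [NormedSpace ℝ W]
    [NormedAddCommGroup W'] [NormedSpace ℝ W'] [CompleteSpace W'] {k l k' l' : ℕ}
    (X : (EuclideanSpace ℝ (Fin l') × W') ≃L[ℝ] (EuclideanSpace ℝ (Fin l) × W))
    (Y : (EuclideanSpace ℝ (Fin k) × W) ≃L[ℝ] (EuclideanSpace ℝ (Fin k') × W'))
    (h : CompactEq (modelOp k l W) (X.toContinuousLinearMap.comp
      ((modelOp k' l' W').comp Y.toContinuousLinearMap))) : l + k' ≤ k + l' := by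
  by_contra! hlt
  obtain ⟨j, hj, hjs⟩ := exists_injective_not_surjective
    (V := EuclideanSpace ℝ (Fin k) × EuclideanSpace ℝ (Fin l'))
    (V' := EuclideanSpace ℝ (Fin l) × EuclideanSpace ℝ (Fin k')) (by simpa using hlt)
  let Z := (EuclideanSpace ℝ (Fin l) × EuclideanSpace ℝ (Fin k')) ×
    (EuclideanSpace ℝ (Fin k') × W')
  let y : Z →L[ℝ] EuclideanSpace ℝ (Fin k) × W :=
    Y.symm.toContinuousLinearMap.comp (ContinuousLinearMap.snd ℝ _ _)
  let bw : Z →L[ℝ] EuclideanSpace ℝ (Fin l) × W :=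
    ((ContinuousLinearMap.fst ℝ _ _).comp (ContinuousLinearMap.fst ℝ _ _)).prod
      ((ContinuousLinearMap.snd ℝ _ _).comp y)
  let x : Z →L[ℝ] EuclideanSpace ℝ (Fin l') × W' := X.symm.toContinuousLinearMap.comp bw
  let T : Z →L[ℝ] Z :=
    (j.comp (((ContinuousLinearMap.fst ℝ _ _).comp y).prod
      ((ContinuousLinearMap.fst ℝ _ _).comp x))).prod
    (((ContinuousLinearMap.snd ℝ _ _).comp (ContinuousLinearMap.fst ℝ _ _)).prod
      ((ContinuousLinearMap.snd ℝ _ _).comp x))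
  have hT : ∀ z : Z, T z = (j ((y z).1, (x z).1), (z.1.2, (x z).2)) := fun z => rfl
  have hinj : Function.Injective T := by
    refine (injective_iff_map_eq_zero T).2 fun z hz => ?_
    rw [hT] at hz
    have h2 : z.1.2 = 0 := congrArg (fun q : Z => q.2.1) hz
    have h3 : (x z).2 = 0 := congrArg (fun q : Z => q.2.2) hz
    have h4 : ((y z).1, (x z).1) = 0 :=
      hj ((congrArg (fun q : Z => q.1) hz).trans (map_zero j).symm)
    have h5 : x z = 0 := Prod.ext (Prod.mk_eq_zero.1 h4).2 h3
    have h6 : bw z = 0 := X.symm.map_eq_zero_iff.1 h5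
    have h7 : z.1.1 = 0 := (Prod.mk_eq_zero.1 h6).1
    have h8 : y z = 0 := Prod.ext (Prod.mk_eq_zero.1 h4).1 (Prod.mk_eq_zero.1 h6).2
    have h9 : z.2 = 0 := Y.symm.map_eq_zero_iff.1 h8
    exact Prod.ext (Prod.ext h7 h2) h9
  have hnsurj : ¬ Function.Surjective T := fun hs => hjs fun c => by
    obtain ⟨z, hz⟩ := hs (c, 0)
    exact ⟨_, congrArg Prod.fst hz⟩
  refine hnsurj (surjective_of_injective_of_compactEq ?_ hinj)
  refine isCompactOperator_prod (isCompactOperator_of_finiteDimensional_rng _)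
    (isCompactOperator_prod (isCompactOperator_of_finiteDimensional_rng _) ?_)
  -- Only the `W'`-component is not of finite rank. Up to the finite-rank contribution of `b`, `x`
  -- is `X⁻¹` of the model operator at `y`, which `h` replaces modulo compacts by `(0, u.2)`.
  let q : EuclideanSpace ℝ (Fin l) × W →L[ℝ] W' :=
    (ContinuousLinearMap.snd ℝ _ _).comp X.symm.toContinuousLinearMap
  have hX : IsCompactOperator ((q.comp (modelOp k l W - X.toContinuousLinearMap.comp
      ((modelOp k' l' W').comp Y.toContinuousLinearMap))).comp y) :=
    IsCompactOperator.comp_clm (IsCompactOperator.clm_comp h q) y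
  let b : Z →L[ℝ] EuclideanSpace ℝ (Fin l) :=
    (ContinuousLinearMap.fst ℝ _ _).comp (ContinuousLinearMap.fst ℝ _ _)
  have hb : IsCompactOperator ((q.comp (ContinuousLinearMap.inl ℝ _ _)).comp b) :=
    IsCompactOperator.clm_comp (isCompactOperator_of_finiteDimensional_rng b)
      (q.comp (ContinuousLinearMap.inl ℝ _ _))
  have hsum := IsCompactOperator.add hX hb
  refine cast (congrArg IsCompactOperator (funext fun z => ?_)) hsum
  have e1 : bw z = (z.1.1, 0) + modelOp k l W (y z) := by
    rw [modelOp_apply]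
    exact Prod.ext (add_zero _).symm (zero_add _).symm
  have e2 : x z = X.symm (z.1.1, 0) + X.symm (modelOp k l W (y z)) := by
    rw [← map_add, ← e1]
    rfl
  have e3 : Y (y z) = z.2 := Y.apply_symm_apply _
  change (X.symm (modelOp k l W (y z) - X (modelOp k' l' W' (Y (y z))))).2
    + (X.symm (z.1.1, 0)).2 = (x z).2 - z.2.2
  rw [map_sub, X.symm_apply_apply, e3, e2, modelOp_apply k' l']
  simp only [Prod.snd_add, Prod.snd_sub]
  abel

/-- Moving all isomorphisms to one side leaves two model operators related as in
`add_le_add_of_compactEq_modelOp`; applying it in both directions gives equality. -/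
theorem add_eq_add_of_compactEq_modelOp {W W' : Type*} [NormedAddCommGroup W] [NormedSpace ℝ W]
    [CompleteSpace W] [NormedAddCommGroup W'] [NormedSpace ℝ W'] [CompleteSpace W']
    {k l k' l' : ℕ} {A A' : E →L[ℝ] F}
    {X : (EuclideanSpace ℝ (Fin l) × W) ≃L[ℝ] F} {Y : E ≃L[ℝ] (EuclideanSpace ℝ (Fin k) × W)}
    {X' : (EuclideanSpace ℝ (Fin l') × W') ≃L[ℝ] F}
    {Y' : E ≃L[ℝ] (EuclideanSpace ℝ (Fin k') × W')} {S : F ≃L[ℝ] F} {T : E ≃L[ℝ] E}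
    (hA : CompactEq A (X.toContinuousLinearMap.comp ((modelOp k l W).comp Y.toContinuousLinearMap)))
    (hA' : CompactEq A' (X'.toContinuousLinearMap.comp ((modelOp k' l' W').comp Y'.toContinuousLinearMap)))
    (h : CompactEq A' (S.toContinuousLinearMap.comp (A.comp T.toContinuousLinearMap))) : k + l' = k' + l := by
  have key : CompactEq (X'.toContinuousLinearMap.comp ((modelOp k' l' W').comp Y'.toContinuousLinearMap))
      (S.toContinuousLinearMap.comp ((X.toContinuousLinearMap.comp ((modelOp k l W).comp Y.toContinuousLinearMap)).comp
        T.toContinuousLinearMap)) :=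
    (hA'.symm.trans h).trans ((hA.comp_clm _).clm_comp _)
  have h1 := (key.clm_comp X'.symm.toContinuousLinearMap).comp_clm Y'.symm.toContinuousLinearMap
  have h2 := (key.symm.clm_comp
    (S.symm.trans X.symm).toContinuousLinearMap).comp_clm (T.symm.toContinuousLinearMap.comp Y.symm.toContinuousLinearMap)
  have r1 := add_le_add_of_compactEq_modelOp (k := k') (l := l') ((X.trans S).trans X'.symm)
    (Y'.symm.trans (T.trans Y)) (by
      convert h1 using 1 <;> ext z <;> simp)
  have r2 := add_le_add_of_compactEq_modelOp (k := k) (l := l)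
    (X'.trans (S.symm.trans X.symm)) ((Y.symm.trans T.symm).trans Y') (by
      convert h2 using 1 <;> ext z <;> simp)
  omega

/-! ### Block form of linearized fillings -/

/-- Two operators with the splittings that fillings of one and the same section provide agree up to
isomorphisms and compact operators. -/
structure IsFilledSplit (A : E →L[ℝ] F) (P : E →L[ℝ] E) (Q : F →L[ℝ] F) (L : E →L[ℝ] F)
    (Θ : F →L[ℝ] E) : Prop where
  compact : CompactEq L (A - Q.comp A)
  PP : ∀ x, P (P x) = P x
  LP : ∀ x, L (P x) = 0
  QL : ∀ x, Q (L x) = 0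
  ΘL : ∀ x, Θ (L x) = x - P x
  LΘ : ∀ y, L (Θ y) = y - Q y
  ΘQ : ∀ y, Θ (Q y) = 0

namespace IsFilledSplit

variable {A : E →L[ℝ] F} {P : E →L[ℝ] E} {Q : F →L[ℝ] F} {L : E →L[ℝ] F} {Θ : F →L[ℝ] E}

/-- The isomorphism `1 - Q A Θ` which makes the operator block diagonal. -/
def reduce (h : IsFilledSplit A P Q L Θ) : F ≃L[ℝ] F :=
  ContinuousLinearEquiv.equivOfInverse
    (ContinuousLinearMap.id ℝ F - Q.comp (A.comp Θ)) (ContinuousLinearMap.id ℝ F + Q.comp (A.comp Θ))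
    (fun y => by simp [h.ΘQ]) (fun y => by simp [h.ΘQ])

/-- In blocks for the projections `P` and `Q`, the part of `A` from the range of `P` to the kernel
of `Q` is compact, and the part between the kernels is, modulo compacts, the isomorphism `L` with
inverse `Θ`. Row elimination with `Q A Θ` therefore removes the remaining off-diagonal block `Q A (1
- P)`. -/
theorem compactEq_reduce (h : IsFilledSplit A P Q L Θ) :
    CompactEq (h.reduce.toContinuousLinearMap.comp A) (A.comp P + L) := by
  let κ := L - (A - Q.comp A)
  have hκ : IsCompactOperator κ := h.compact
  have hA : ∀ x, A x = Q (A x) + L x - κ x := fun x => by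
    simp [κ]
    abel
  have h1 : IsCompactOperator (κ.comp P) := IsCompactOperator.comp_clm hκ P
  have h2 : IsCompactOperator ((Q.comp (A.comp Θ)).comp κ) :=
    IsCompactOperator.clm_comp hκ (Q.comp (A.comp Θ))
  have h3 : IsCompactOperator ((κ.comp P - κ) + (Q.comp (A.comp Θ)).comp κ) :=
    IsCompactOperator.add (IsCompactOperator.sub h1 hκ) h2
  have e : h.reduce.toContinuousLinearMap.comp A - (A.comp P + L)
      = (κ.comp P - κ) + (Q.comp (A.comp Θ)).comp κ := by
    ext x
    have e0 : h.reduce.toContinuousLinearMap (A x) = A x - Q (A (Θ (A x))) := rfl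
    have e1 : Θ (A x) = x - P x - Θ (κ x) := by
      rw [hA x, map_sub, map_add, h.ΘQ, h.ΘL, zero_add]
    have e2 := hA (P x)
    rw [h.LP] at e2
    have e3 := hA x
    change h.reduce.toContinuousLinearMap (A x) - (A (P x) + L x)
      = (κ (P x) - κ x) + Q (A (Θ (κ x)))
    rw [e0, e1]
    simp only [map_sub]
    nth_rewrite 1 [e3]
    nth_rewrite 2 [e2]
    abel
  rw [CompactEq, e]
  exact h3

/-- Two filled splittings with equal tangential parts differ by isomorphisms and a compact
operator. -/
theorem exists_compactEq {A' : E →L[ℝ] F} {P' : E →L[ℝ] E} {Q' : F →L[ℝ] F} {L' : E →L[ℝ] F}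
    {Θ' : F →L[ℝ] E} (h : IsFilledSplit A P Q L Θ) (h' : IsFilledSplit A' P' Q' L' Θ')
    (hP : ∀ x, P' (P x) = P x) (hP' : ∀ x, P (P' x) = P' x)
    (hQ : ∀ x, Q' (Q x) = Q x) (hQ' : ∀ x, Q (Q' x) = Q' x)
    (hA : CompactEq (A'.comp P) (A.comp P)) :
    ∃ (S : F ≃L[ℝ] F) (T : E ≃L[ℝ] E),
      CompactEq A' (S.toContinuousLinearMap.comp (A.comp T.toContinuousLinearMap)) := by
  have hLP : ∀ x, L (P' x) = 0 := fun x => by rw [← hP', h.LP]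
  have hLP' : ∀ x, L' (P x) = 0 := fun x => by rw [← hP, h'.LP]
  have hΘQ : ∀ x, Θ (Q' x) = 0 := fun x => by rw [← hQ', h.ΘQ]
  have hΘQ' : ∀ x, Θ' (Q x) = 0 := fun x => by rw [← hQ, h'.ΘQ]
  -- `P` and `P'` have the same range but possibly different kernels. `U` is the identity on that
  -- range and maps one kernel to the other along it. `V` is likewise the identity on the common
  -- range of `Q` and `Q'`, and goes between their kernels by undoing `L` and applying `L'`; thus `V
  -- L = L' = L' U`.
  let U : E ≃L[ℝ] E := ContinuousLinearEquiv.equivOfInverse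
    (P + (ContinuousLinearMap.id ℝ E - P')) (P' + (ContinuousLinearMap.id ℝ E - P))
    (fun x => by simp [hP, hP', h.PP, h'.PP]) (fun x => by simp [hP, hP', h.PP, h'.PP])
  let V : F ≃L[ℝ] F := ContinuousLinearEquiv.equivOfInverse
    (Q + L'.comp Θ) (Q' + L.comp Θ')
    (fun x => by simp [hQ, h'.QL, hΘQ', h'.ΘL, h.LΘ, hLP])
    (fun x => by simp [hQ', h.QL, hΘQ, h.ΘL, h'.LΘ, hLP'])
  let κ := L - (A - Q.comp A)
  have hκ : IsCompactOperator κ := h.compact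
  have hκP : IsCompactOperator (κ.comp P) := IsCompactOperator.comp_clm hκ P
  have key : CompactEq ((A'.comp P' + L').comp U.toContinuousLinearMap)
      (V.toContinuousLinearMap.comp (A.comp P + L)) := by
    have e : (A'.comp P' + L').comp U.toContinuousLinearMap
        - V.toContinuousLinearMap.comp (A.comp P + L)
        = (A'.comp P - A.comp P) - κ.comp P + (L'.comp Θ).comp (κ.comp P) := by
      ext x
      have eU : U.toContinuousLinearMap x = P x + (x - P' x) := rfl
      have eV : ∀ y, V.toContinuousLinearMap y = Q y + L' (Θ y) := fun _ => rfl
      have eA : A (P x) = Q (A (P x)) - κ (P x) := by simp [κ, h.LP]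
      have eA' : Θ (A (P x)) = - Θ (κ (P x)) := by rw [eA, map_sub, h.ΘQ, zero_sub]
      change A' (P' (U.toContinuousLinearMap x)) + L' (U.toContinuousLinearMap x)
        - V.toContinuousLinearMap (A (P x) + L x)
        = (A' (P x) - A (P x)) - κ (P x) + L' (Θ (κ (P x)))
      rw [eU, eV]
      simp only [map_add, map_sub, map_neg, hP, h'.PP, hLP', h'.LP, h.QL, h.ΘL, eA', sub_self, map_zero]
      nth_rewrite 2 [eA]
      abel
    rw [CompactEq, e]
    exact IsCompactOperator.add (IsCompactOperator.sub hA hκP)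
      (IsCompactOperator.clm_comp hκP (L'.comp Θ))
  have h1 := (h'.compactEq_reduce.comp_clm U.toContinuousLinearMap).trans
    (key.trans (h.compactEq_reduce.symm.clm_comp V.toContinuousLinearMap))
  have h2 := (h1.clm_comp h'.reduce.symm.toContinuousLinearMap).comp_clm
    U.symm.toContinuousLinearMap
  refine ⟨(h.reduce.trans V).trans h'.reduce.symm, U.symm, ?_⟩
  convert h2 using 1 <;> ext x <;> simp

end IsFilledSplit

end Compact

/-! ### Germs and their differentials at the origin -/

section Germs

variable {E : ScBanach.{u}} {F : ScBanach.{v}} {G : ScBanach.{w}} {C : PartialQuadrant E}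
  {C' : PartialQuadrant F} {D : ∀ m, Set (E.X m)} {D' : ∀ m, Set (F.X m)}

theorem PartialQuadrant.RelOpen.isScGerm {U : Set (E.X 0)} (h : C.RelOpen U) (h0 : 0 ∈ U) :
    C.IsScGerm (lev E U) where
  rel_open m := by
    obtain ⟨V, hV, rfl⟩ := h
    exact ⟨E.ι m ⁻¹' V, hV.preimage (E.ι m).continuous, rfl⟩
  zero_mem m := by
    change E.ι m 0 ∈ U
    rwa [map_zero]
  anti _ _ hx := hx

theorem PartialQuadrant.IsScGerm.relOpen (h : C.IsScGerm D) : C.RelOpen (D 0) := h.rel_open 0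

theorem PartialQuadrant.IsScGerm.subset_lev (h : C.IsScGerm D) (m : ℕ) :
    D m ⊆ lev E (D 0) m := h.isScDom.ι_mem m

theorem PartialQuadrant.IsScGerm.subset_carrier (h : C.IsScGerm D) (m : ℕ) :
    D m ⊆ lev E C.carrier m := by
  obtain ⟨V, -, e⟩ := h.rel_open m
  rw [e]
  exact inter_subset_right

theorem PartialQuadrant.IsScGerm.mem_nhdsWithin (h : C.IsScGerm D) (m : ℕ) :
    D m ∈ 𝓝[lev E C.carrier m] (0 : E.X m) := by
  obtain ⟨V, hV, e⟩ := h.rel_open m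
  have h0 := h.zero_mem m
  rw [e] at h0 ⊢
  exact inter_mem (mem_nhdsWithin_of_mem_nhds (hV.mem_nhds h0.1)) self_mem_nhdsWithin

theorem HasScDerivAt.unique_zero {f : E.X 0 → F.X 0} {S T : E.X 0 →L[ℝ] F.X 0}
    (hD : C.IsScGerm D) (hS : HasScDerivAt E F D f 0 S) (hT : HasScDerivAt E F D f 0 T) : S = T :=
  hS.unique (hD.isScDom.uniqueDiff 1 _ (hD.zero_mem 1)) hT

theorem ScSmooth.exists_hasScDerivAt {f : E.X 0 → F.X 0} (hf : ScSmooth E F D f) {x : E.X 1}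
    (hx : x ∈ D 1) : ∃ T, HasScDerivAt E F D f x T := by
  obtain ⟨S, hS, -⟩ := ScCk.exists_deriv (hf 1)
  exact ⟨_, hS x hx⟩

theorem ScSmooth.mono {D₂ : ∀ m, Set (E.X m)} {f : E.X 0 → F.X 0} (hf : ScSmooth E F D f)
    (hD : IsScDom E D) (hD₂ : IsScDom E D₂) (h : ∀ m, D₂ m ⊆ D m) : ScSmooth E F D₂ f :=
  hf.comp_scLin (ScLin.id E) hD₂ hD h

/-- The chain rule at the origin. -/
theorem HasScDerivAt.comp_zero {f : F.X 0 → G.X 0} {g : E.X 0 → F.X 0} {S : F.X 0 →L[ℝ] G.X 0}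
    {T : E.X 0 →L[ℝ] F.X 0} (hD : C.IsScGerm D) (hD' : C'.IsScGerm D') (hf : ScSmooth F G D' f)
    (hS : HasScDerivAt F G D' f 0 S) (hg : Sc0 E F D g) (hg0 : g 0 = 0)
    (hT : HasScDerivAt E F D g 0 T) (hgC : ∀ x ∈ D 0, g x ∈ C'.carrier) :
    HasScDerivAt E G D (fun x => f (g x)) 0 (S.comp T) := by
  obtain ⟨S', hS', hSc⟩ := ScCk.exists_deriv (hf 1)
  obtain ⟨γ, hγ, eγ⟩ := hg 1
  have h0 : γ 0 = 0 := F.ι_injective 1 (by rw [eγ 0 (hD.zero_mem 1), map_zero, map_zero, hg0])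
  have hcont := hγ 0 (hD.zero_mem 1)
  -- The levels of a germ may shrink, so `g` need not map `D 1` into `D' 1`. It does so near `0`, by
  -- continuity on level `1` and because its values lie in the quadrant.
  have hmem : ∀ᶠ y in 𝓝[D 1] 0, γ y ∈ D' 1 := by
    have h1 : Tendsto γ (𝓝[D 1] 0) (𝓝[lev F C'.carrier 1] 0) := by
      refine tendsto_nhdsWithin_iff.2 ⟨by simpa [ContinuousWithinAt, h0] using hcont, ?_⟩
      refine eventually_nhdsWithin_of_forall fun y hy => ?_
      change F.ι 1 (γ y) ∈ C'.carrier
      rw [eγ y hy]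
      exact hgC _ (hD.isScDom.ι_mem 1 y hy)
    exact h1 (hD'.mem_nhdsWithin 1)
  have := HasScDerivAt.comp hD'.isScDom hS' hSc hT (hD.zero_mem 1) hcont eγ hmem
  rwa [h0, (hS' 0 (hD'.zero_mem 1)).unique_zero hD' hS] at this

theorem Sc0.scMapsTo_lev {f : E.X 0 → F.X 0} (hf : Sc0 E F D f) {U : Set (F.X 0)}
    (h : ∀ m, ∀ x ∈ D m, f (E.ι m x) ∈ U) : ScMapsTo E F D (lev F U) f := fun m x hx => by
  obtain ⟨φ, -, e⟩ := hf m
  refine ⟨φ x, ?_, e x hx⟩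
  change F.ι m (φ x) ∈ U
  rw [e x hx]
  exact h m x hx

theorem ScMapsTo.bundle {g : E.X 0 → F.X 0} (hg : ScMapsTo E F D D' g) {β : E.X 0 → G.X 0}
    (hβ : Sc0 E G D β) : ScMapsTo E (F.prod G) D (bundleDom F G D') (fun x => (g x, β x)) :=
  fun m x hx => by
    obtain ⟨y, hy, e⟩ := hg m x hx
    obtain ⟨φ, -, eφ⟩ := hβ m
    refine ⟨(y, φ x), hy, ?_⟩
    rw [ScBanach.ι_prod]
    exact Prod.ext e (eφ x hx)

theorem ScMapsTo.self {U : Set (E.X 0)} {r : E.X 0 → E.X 0} (hr : IsTameRetraction C U r) :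
    ScMapsTo E E (lev E U) (lev E U) r :=
  hr.smooth.sc0.scMapsTo_lev fun _ _ hx => hr.mapsTo hx

end Germs

/-! ### Strong bundle maps -/

namespace IsStrongBundleMap

variable {E E' : ScBanach.{u}} {F : ScBanach.{v}} {F' : ScBanach.{w}}
  {D : ∀ m, Set (E.X m)} {D' : ∀ m, Set (E'.X m)} {φ : E.X 0 → E'.X 0}
  {Γ : E.X 0 → F.X 0 →ₗ[ℝ] F'.X 0}

theorem smooth_base (h : IsStrongBundleMap D D' φ Γ) (hD : IsScDom E D) : ScSmooth E E' D φ :=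
  (h.smooth_zero.comp_scLin ((ScLin.id E).prodMk (ScLin.zero E F)) hD (hD.bundleDom F)
    fun _ _ hx => hx).scLin_comp (ScLin.fst E' F') hD

theorem smooth_fiber (h : IsStrongBundleMap D D' φ Γ) (hD : IsScDom E D) :
    ScSmooth (E.prod F) F' (bundleDom E F D) (fun z => Γ z.1 z.2) :=
  h.smooth_zero.scLin_comp (ScLin.snd E' F') (hD.bundleDom F)

theorem continuousOn_fiber (h : IsStrongBundleMap D D' φ Γ) (hD : IsScDom E D) :
    ContinuousOn (fun z : E.X 0 × F.X 0 => Γ z.1 z.2) (D 0 ×ˢ univ) :=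
  ((h.smooth_fiber hD).sc0.continuousOn).mono fun _ hz => hz.1

/-- The operator on the fiber over a point of the base. -/
def fiberMap (h : IsStrongBundleMap D D' φ Γ) (hD : IsScDom E D) (x : E.X 0) (hx : x ∈ D 0) :
    F.X 0 →L[ℝ] F'.X 0 where
  toLinearMap := Γ x
  cont := by
    have := (h.continuousOn_fiber hD).comp_continuous
      (f := fun ξ : F.X 0 => (x, ξ)) (by fun_prop) fun ξ => ⟨hx, mem_univ _⟩
    exact this

@[simp] theorem fiberMap_apply (h : IsStrongBundleMap D D' φ Γ) (hD : IsScDom E D) (x : E.X 0)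
    (hx : x ∈ D 0) (ξ : F.X 0) : h.fiberMap hD x hx ξ = Γ x ξ := rfl

/-- The differential at the origin of a section obtained by applying a bundle map to a section
that vanishes at the origin. -/
theorem hasScDerivAt_apply {H : ScBanach.{u}} {D₂ : ∀ m, Set (H.X m)} {C : PartialQuadrant H}
    (hD₂ : C.IsScGerm D₂) (h : IsStrongBundleMap D D' φ Γ) (hD : IsScDom E D)
    {α : H.X 0 → E.X 0} (hα : Sc0 H E D₂ α) (hαD : ∀ x ∈ D₂ 0, α x ∈ D 0) (h0 : (0 : E.X 0) ∈ D 0)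
    (hα0 : α 0 = 0) {β : H.X 0 → F.X 0} {T : H.X 0 →L[ℝ] F.X 0}
    (hβ : HasScDerivAt H F D₂ β 0 T) (hβ0 : β 0 = 0) :
    HasScDerivAt H F' D₂ (fun y => Γ (α y) (β y)) 0 ((h.fiberMap hD 0 h0).comp T) := by
  refine HasScDerivAt.family_apply (Λ := fun x ξ => Γ x ξ) (h.continuousOn_fiber hD)
    (fun _ _ _ _ => map_smul _ _ _) (fun _ _ _ _ => map_add _ _ _) hβ (by rw [map_zero, hβ0])
    (hD₂.zero_mem 1) ?_ (fun y hy => hαD _ (hD₂.isScDom.ι_mem 1 y hy)) (fun η => ?_)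
  · exact (hα.continuousOn.comp (H.ι 1).continuous.continuousOn
      fun y hy => hD₂.isScDom.ι_mem 1 y hy) 0 (hD₂.zero_mem 1)
  · rw [map_zero, hα0, fiberMap_apply]

end IsStrongBundleMap

/-! ### The linearization of a sc-Fredholm germ -/

/-- Along a line `t ↦ (0, (0, t w))` the map `B` is Lipschitz near `t = 0` with arbitrarily small
constant, so its derivative there vanishes. This reaches `w` of level `1`; density does the rest. -/
theorem deriv_fiber_eq_zero_of_contractive {s d : ℕ} {W : ScBanach.{u}}
    {D : ∀ m, Set (((eucl s).prod ((eucl d).prod W)).X m)}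
    (hD : (stdQuadrant s ((eucl d).prod W)).IsScGerm D)
    {B : ((eucl s).prod ((eucl d).prod W)).X 0 → W.X 0}
    (hB : ∀ ε : ℝ, 0 < ε → ∃ δ : ℝ, 0 < δ ∧
      ∀ (v : (eucl s).X 0) (q : (eucl d).X 0) (w w' : W.X 0),
        (v, (q, w)) ∈ D 0 → (v, (q, w')) ∈ D 0 →
        ‖v‖ + ‖q‖ + ‖w‖ < δ → ‖v‖ + ‖q‖ + ‖w'‖ < δ →
        ‖B (v, (q, w)) - B (v, (q, w'))‖ ≤ ε * ‖w - w'‖)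
    {T : ((eucl s).prod ((eucl d).prod W)).X 0 →L[ℝ] W.X 0}
    (hT : HasScDerivAt ((eucl s).prod ((eucl d).prod W)) W D B 0 T) (w : W.X 0) :
    T (0, (0, w)) = 0 := by
  let H := (eucl s).prod ((eucl d).prod W)
  suffices h : ∀ w : W.X 1, T (0, (0, W.ι 1 w)) = 0 by
    have := (W.dense_range_ι 1).equalizer (g := fun w => T (0, (0, w))) (h := fun _ => 0)
      (by fun_prop) (by fun_prop) (funext h)
    exact congrFun this w
  intro w
  -- The `W`-directions carry no sign condition, so the line stays in the domain for small `t` of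
  -- either sign.
  have hmap : Tendsto (fun t : ℝ => ((0, (0, t • w)) : H.X 1)) (𝓝 0) (𝓝[D 1] 0) := by
    have h1 : Tendsto (fun t : ℝ => ((0, (0, t • w)) : H.X 1)) (𝓝 0)
        (𝓝[lev H (stdQuadrant s ((eucl d).prod W)).carrier 1] 0) := by
      refine tendsto_nhdsWithin_iff.2 ⟨?_, Eventually.of_forall fun t => ?_⟩
      · have : Continuous fun t : ℝ => ((0, (0, t • w)) : H.X 1) := by fun_prop
        refine (this.tendsto 0).mono_right (le_of_eq ?_)
        rw [zero_smul]
        rfl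
      · rw [PartialQuadrant.mem_lev_carrier]
        intro i
        exact le_refl (0 : ℝ)
    exact tendsto_nhdsWithin_iff.2 ⟨h1.mono_right nhdsWithin_le_nhds,
      h1.eventually (hD.mem_nhdsWithin 1)⟩
  have hderiv : HasDerivAt (fun t : ℝ => B (H.ι 1 (0, (0, t • w)))) (T (0, (0, W.ι 1 w))) 0 := by
    have h1 : HasDerivAt (fun t : ℝ => ((0, (0, t • w)) : H.X 1)) (0, (0, w)) 0 :=
      (hasDerivAt_const _ _).prodMk ((hasDerivAt_const _ _).prodMk
        (by simpa using (hasDerivAt_id (0 : ℝ)).smul_const w))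
    have h2 : HasFDerivWithinAt (fun y : H.X 1 => B (H.ι 1 y)) (T.comp (H.ι 1)) (D 1)
      ((0, (0, (0 : ℝ) • w)) : H.X 1) := by
      rw [zero_smul]
      exact hT
    have h3 : ∀ᶠ t : ℝ in 𝓝 0, ((0, (0, t • w)) : H.X 1) ∈ D 1 :=
      hmap.eventually self_mem_nhdsWithin
    have h4 := h2.comp_hasDerivWithinAt_of_eq (s := {t : ℝ | ((0, (0, t • w)) : H.X 1) ∈ D 1})
      (0 : ℝ) h1.hasDerivWithinAt (fun t ht => ht) rfl
    have h5 := h4.hasDerivAt h3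
    exact h5
  have hlin : ∀ t : ℝ, H.ι 1 (0, (0, t • w)) = (0, (0, t • W.ι 1 w)) := fun t => by
    rw [ScBanach.ι_prod, ScBanach.ι_prod, map_zero, map_zero, map_smul]
  have hle : ∀ ε : ℝ, 0 < ε → ‖T (0, (0, W.ι 1 w))‖ ≤ ε * ‖W.ι 1 w‖ := by
    intro ε hε
    obtain ⟨δ, hδ, h⟩ := hB ε hε
    have hev : ∀ᶠ t : ℝ in 𝓝 0, ‖B (H.ι 1 (0, (0, t • w))) - B (H.ι 1 (0, (0, (0 : ℝ) • w)))‖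
        ≤ (ε * ‖W.ι 1 w‖) * ‖t - 0‖ := by
      have h1 : ∀ᶠ t : ℝ in 𝓝 0, ((0, (0, t • w)) : H.X 1) ∈ D 1 :=
        hmap.eventually self_mem_nhdsWithin
      have h2 : ∀ᶠ t : ℝ in 𝓝 0, ‖t • W.ι 1 w‖ < δ := by
        have : Continuous fun t : ℝ => ‖t • W.ι 1 w‖ := by fun_prop
        exact (this.tendsto 0).eventually (gt_mem_nhds (by simpa using hδ))
      filter_upwards [h1, h2] with t ht1 ht2
      have h3 := hD.isScDom.ι_mem 1 _ ht1
      rw [hlin] at h3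
      have h4 := h 0 0 (t • W.ι 1 w) 0 h3 (hD.zero_mem 0) (by simpa using ht2) (by simpa using hδ)
      rw [hlin, hlin, zero_smul]
      refine h4.trans_eq ?_
      rw [sub_zero, sub_zero, norm_smul]
      ring
    exact hderiv.le_of_lip' (by positivity) hev
  have : ‖T (0, (0, W.ι 1 w))‖ ≤ 0 := by
    refine le_of_forall_pos_le_add fun ε hε => ?_
    have h1 := hle (ε / (‖W.ι 1 w‖ + 1)) (by positivity)
    have h2 : ε / (‖W.ι 1 w‖ + 1) * ‖W.ι 1 w‖ ≤ ε := by
      rw [div_mul_eq_mul_div, div_le_iff₀ (by positivity)]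
      nlinarith [norm_nonneg (W.ι 1 w)]
    linarith
  exact norm_le_zero_iff.1 this

/-- The identification `ℝˢ × (ℝᵈ × W) ≅ ℝ^(s+d) × W`. -/
def euclAssoc (s d : ℕ) (W : Type*) [NormedAddCommGroup W] [NormedSpace ℝ W] :
    (EuclideanSpace ℝ (Fin s) × (EuclideanSpace ℝ (Fin d) × W)) ≃L[ℝ]
      EuclideanSpace ℝ (Fin (s + d)) × W :=
  (ContinuousLinearEquiv.prodAssoc ℝ _ _ _).symm.trans
    ((ContinuousLinearEquiv.ofFinrankEq (by simp)).prodCongr (ContinuousLinearEquiv.refl ℝ W))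

/-- The differential of a basic germ at the origin is a compact perturbation of a projection. -/
theorem IsBasicGerm.compactEq {s d k' : ℕ} {W : ScBanach.{u}}
    {D : ∀ m, Set (((eucl s).prod ((eucl d).prod W)).X m)}
    {b : ((eucl s).prod ((eucl d).prod W)).X 0 → ((eucl k').prod W).X 0} (hb : IsBasicGerm D b)
    {T : ((eucl s).prod ((eucl d).prod W)).X 0 →L[ℝ] ((eucl k').prod W).X 0}
    (hT : HasScDerivAt ((eucl s).prod ((eucl d).prod W)) ((eucl k').prod W) D b 0 T) :
    CompactEq T ((modelOp (s + d) k' (W.X 0)).comp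
      (euclAssoc s d (W.X 0)).toContinuousLinearMap) := by
  obtain ⟨B, hBs, -, hbB, hB⟩ := hb.form
  obtain ⟨S, hS⟩ := hBs.exists_hasScDerivAt (hb.germ.zero_mem 1)
  have hz := deriv_fiber_eq_zero_of_contractive hb.germ (fun ε hε => by
    obtain ⟨δ, hδ, h⟩ := hB ε hε 0
    exact ⟨δ, hδ, fun v q w w' h1 h2 h3 h4 => h v q w w' h1 h2 h3 h4 _ _ rfl rfl⟩) hS
  let p : ((eucl s).prod ((eucl d).prod W)).X 0 →L[ℝ] W.X 0 :=
    (ContinuousLinearMap.snd ℝ _ _).comp (ContinuousLinearMap.snd ℝ _ _)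
  have hp : HasScDerivAt ((eucl s).prod ((eucl d).prod W)) W D (fun y => y.2.2) 0 p :=
    (p.comp (((eucl s).prod ((eucl d).prod W)).ι 1)).hasFDerivWithinAt
  have h1 : HasScDerivAt ((eucl s).prod ((eucl d).prod W)) W D (fun y => y.2.2 - B y) 0 (p - S) :=
    HasFDerivWithinAt.fun_sub hp hS
  have h2 : HasScDerivAt ((eucl s).prod ((eucl d).prod W)) W D (fun y => (b y).2) 0
      ((ContinuousLinearMap.snd ℝ _ _).comp T) :=
    hT.clm_comp (G := W) (ContinuousLinearMap.snd ℝ _ _)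
  have h3 := (h2.congr (hb.germ.zero_mem 1) fun y hy =>
    (hbB _ (hb.germ.isScDom.ι_mem 1 y hy)).symm).unique_zero hb.germ h1
  refine isCompactOperator_prod (isCompactOperator_of_finiteDimensional_rng _) ?_
  let a : ((eucl s).prod ((eucl d).prod W)).X 0 →L[ℝ]
      EuclideanSpace ℝ (Fin s) × EuclideanSpace ℝ (Fin d) :=
    (ContinuousLinearMap.fst ℝ _ _).prod
      ((ContinuousLinearMap.fst ℝ _ _).comp (ContinuousLinearMap.snd ℝ _ _))
  let j : EuclideanSpace ℝ (Fin s) × EuclideanSpace ℝ (Fin d) →L[ℝ]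
      ((eucl s).prod ((eucl d).prod W)).X 0 :=
    (ContinuousLinearMap.fst ℝ _ _).prod
      ((ContinuousLinearMap.inl ℝ _ _).comp (ContinuousLinearMap.snd ℝ _ _))
  -- As `S` kills the `W`-directions, it factors through the finite-dimensional parameter space and
  -- is compact.
  have hc : IsCompactOperator (-((S.comp j).comp a)) :=
    IsCompactOperator.neg (IsCompactOperator.comp_clm
      (isCompactOperator_of_finiteDimensional_dom (S.comp j)) a)
  refine cast (congrArg IsCompactOperator (funext fun y => ?_)) hc
  have h4 : (T y).2 = y.2.2 - S y := DFunLike.congr_fun h3 y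
  have h5 : S y = S (j (a y)) := by
    have e : y = j (a y) + (0, (0, y.2.2)) :=
      Prod.ext (add_zero _).symm (Prod.ext (add_zero _).symm (zero_add _).symm)
    nth_rewrite 1 [e]
    rw [map_add, hz, add_zero]
  change -(S (j (a y))) = (T y).2 - y.2.2
  rw [h4, h5]
  abel

namespace FredholmData

variable {E : ScBanach.{u}} {C : PartialQuadrant E} {F : ScBanach.{v}} {O : Set (E.X 0)}
  {K : Set (E.X 0 × F.X 0)} {σ : E.X 0 → F.X 0} {W : ScBanach.{u}} {s d k' : ℕ}
  (D : FredholmData C F O K σ W s d k')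

theorem mem_base_iff (x : E.X 0) : x ∈ O ↔ x ∈ D.U 0 ∧ D.r x = x := by
  constructor
  · intro hx
    obtain ⟨y, hy, rfl⟩ := D.image_base.symm.subset hx
    exact ⟨D.retraction.tame.mapsTo hy, D.retraction.tame.idem y hy⟩
  · rintro ⟨hx, h⟩
    exact D.image_base.subset ⟨x, hx, h⟩

theorem r_mem {x : E.X 0} (hx : x ∈ D.U 0) : D.r x ∈ O := 
  D.image_base.subset (mem_image_of_mem _ hx)

theorem Γ_of_mem {x : E.X 0} {η : F.X 0} (h : (x, η) ∈ K) : D.Γ x η = η := by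
  obtain ⟨y, hy, ξ, e⟩ := D.image_total.symm.subset h
  obtain ⟨rfl, rfl⟩ := Prod.mk.inj e
  exact D.retraction.idem y hy ξ

theorem Γ_mem {x : E.X 0} (hx : x ∈ O) (ξ : F.X 0) : (x, D.Γ x ξ) ∈ K := by
  obtain ⟨h1, h2⟩ := (D.mem_base_iff x).1 hx
  exact D.image_total.subset ⟨x, h1, ξ, by rw [h2]⟩

theorem Γ_r_Γ_r {x : E.X 0} (hx : x ∈ D.U 0) (ξ : F.X 0) :
    D.Γ (D.r x) (D.Γ (D.r x) ξ) = D.Γ (D.r x) ξ :=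
  D.Γ_of_mem (D.Γ_mem (D.r_mem hx) ξ)

theorem germ_base : C.IsScGerm (lev E (D.U 0)) := D.germ.relOpen.isScGerm (D.germ.zero_mem 0)

theorem isScDom : IsScDom E D.U := D.germ.isScDom

theorem r_zero (hO : 0 ∈ O) : D.r 0 = 0 := ((D.mem_base_iff 0).1 hO).2

theorem smooth_r : ScSmooth E E D.U D.r :=
  D.retraction.tame.smooth.mono D.germ_base.isScDom D.isScDom D.germ.subset_lev

theorem scMapsTo_r : ScMapsTo E E D.U (lev E (D.U 0)) D.r := fun m x hx =>
  ScMapsTo.self D.retraction.tame m x (D.germ.subset_lev m hx)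

/-- Applying the bundle retraction to a smooth section. -/
theorem smooth_Γ_r {f : E.X 0 → F.X 0} (hf : ScSmooth E F D.U f) :
    ScSmooth E F D.U (fun x => D.Γ (D.r x) (f x)) :=
  (D.retraction.bundle.smooth_fiber D.germ_base.isScDom).comp (D.smooth_r.prodMk hf D.isScDom)
    D.isScDom (D.germ_base.isScDom.bundleDom F) (D.scMapsTo_r.bundle hf.sc0)

theorem smooth_defect : ScSmooth E F D.U (fun x => D.h x - D.Γ (D.r x) (D.h x)) :=
  D.h_smooth.sub (D.smooth_Γ_r D.h_smooth) D.isScDom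

theorem smooth_ψ : ScSmooth E ((eucl s).prod ((eucl d).prod W)) D.U D.ψ :=
  D.bundle.smooth_base D.isScDom

theorem smooth_ψinv : ScSmooth ((eucl s).prod ((eucl d).prod W)) E D.U' D.ψinv :=
  D.bundle_inv.smooth_base D.germ'.isScDom

theorem ψ_mem {x : E.X 0} (hx : x ∈ D.U 0) : D.ψ x ∈ D.U' 0 := by
  obtain ⟨y, hy, e⟩ := D.bundle.base 0 x hx
  have e' : y = D.ψ x := e
  rwa [← e']

theorem ψinv_mem {y : ((eucl s).prod ((eucl d).prod W)).X 0} (hy : y ∈ D.U' 0) :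
    D.ψinv y ∈ D.U 0 := by
  obtain ⟨x, hx, e⟩ := D.bundle_inv.base 0 y hy
  have e' : x = D.ψinv y := e
  rwa [← e']

theorem ψinv_zero : D.ψinv 0 = 0 := by
  have := (D.left_inv 0 (D.germ.zero_mem 0)).1
  rwa [D.ψ_zero] at this

/-- A map into the shifted space has a compact differential. -/
theorem exists_compact_deriv {f : E.X 0 → F.X 0} {f₁ : E.X 0 → F.X 1}
    (hf₁ : ScSmooth E F.shift D.U f₁) (e : ∀ x ∈ D.U 0, F.ι 1 (f₁ x) = f x) :
    ∃ T : E.X 0 →L[ℝ] F.X 0, HasScDerivAt E F D.U f 0 T ∧ IsCompactOperator T := by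
  obtain ⟨S, hS⟩ := hf₁.exists_hasScDerivAt (D.germ.zero_mem 1)
  refine ⟨(F.incl 0).comp S, ?_, IsCompactOperator.comp_clm (F.incl_compact 0) S⟩
  exact (hS.clm_comp (G := F) (F.incl 0)).congr (D.germ.zero_mem 1) fun y hy =>
    (e _ (D.isScDom.ι_mem 1 y hy)).symm

/-- The linearization of the difference of the filling and the sc⁺-section. -/
theorem exists_filledSplit (hO : 0 ∈ O) (hK : ∀ x ∈ O, (x, σ x) ∈ K) :
    ∃ (A H : E.X 0 →L[ℝ] F.X 0) (Q : F.X 0 →L[ℝ] F.X 0) (Θ : F.X 0 →L[ℝ] E.X 0),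
      HasScDerivAt E F D.U D.h 0 H ∧ CompactEq A H ∧ (∀ ξ, Q ξ = D.Γ 0 ξ) ∧
      IsFilledSplit A D.Dr Q D.DL Θ ∧
      ∃ (X : (EuclideanSpace ℝ (Fin k') × W.X 0) ≃L[ℝ] F.X 0)
        (Y : E.X 0 ≃L[ℝ] (EuclideanSpace ℝ (Fin (s + d)) × W.X 0)),
        CompactEq A (X.toContinuousLinearMap.comp
          ((modelOp (s + d) k' (W.X 0)).comp Y.toContinuousLinearMap)) := by
  have h0U := D.germ.zero_mem 0
  have h0U1 := D.germ.zero_mem 1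
  have hr0 := D.r_zero hO
  have hσ0 : D.Γ 0 (D.h 0) = D.h 0 := by
    rw [← D.fill_eq 0 hO]
    exact D.Γ_of_mem (hK 0 hO)
  -- the operators
  obtain ⟨s₁, es, hs⟩ := D.𝔰_plus
  obtain ⟨κ, hκ, hκc⟩ := D.exists_compact_deriv hs es
  obtain ⟨H, hH⟩ := D.h_smooth.exists_hasScDerivAt h0U1
  have hA : HasScDerivAt E F D.U (fun x => D.h x - D.𝔰 x) 0 (H - κ) := HasFDerivWithinAt.fun_sub hH hκ
  -- This is why `𝔰` is subtracted: a bundle map applied to a section can be differentiated by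
  -- `hasScDerivAt_apply` only where the section vanishes.
  have hf0 : D.h 0 - D.𝔰 0 = 0 := by rw [D.𝔰_zero, sub_self]
  let Q : F.X 0 →L[ℝ] F.X 0 := D.retraction.bundle.fiberMap D.germ_base.isScDom 0 h0U
  have hQ : ∀ ξ, Q ξ = D.Γ 0 ξ := fun _ => rfl
  have hQQ : ∀ y, Q (Q y) = Q y := fun y => by
    have := D.Γ_r_Γ_r h0U y
    rwa [hr0] at this
  -- the defect of the filling, up to a compact operator
  have hQA : HasScDerivAt E F D.U (fun x => D.Γ (D.r x) (D.h x - D.𝔰 x)) 0 (Q.comp (H - κ)) :=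
    D.retraction.bundle.hasScDerivAt_apply D.germ D.germ_base.isScDom D.smooth_r.sc0
      (fun x hx => D.retraction.tame.mapsTo hx) h0U hr0 hA hf0
  -- The defects of `h` and of `h - 𝔰` differ by the defect of `𝔰`. That one takes values in `𝔽¹`,
  -- since the bundle retraction preserves `𝔽¹`, so its differential is compact.
  have hcompact : CompactEq D.DL ((H - κ) - Q.comp (H - κ)) := by
    obtain ⟨Γ₁, eΓ, hΓ₁⟩ := D.retraction.bundle.smooth_one
    have h1 : ScSmooth E F.shift D.U (fun x => s₁ x - Γ₁ (D.r x) (s₁ x)) := by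
      refine hs.sub ?_ D.isScDom
      exact (hΓ₁.scLin_comp (ScLin.snd E F.shift) (D.germ_base.isScDom.bundleDom F.shift)).comp
        (D.smooth_r.prodMk hs D.isScDom) D.isScDom (D.germ_base.isScDom.bundleDom F.shift)
        (D.scMapsTo_r.bundle hs.sc0)
    obtain ⟨τ, hτ, hτc⟩ := D.exists_compact_deriv (f := fun x => D.𝔰 x - D.Γ (D.r x) (D.𝔰 x)) h1
      fun x hx => by rw [map_sub, eΓ _ (D.retraction.tame.mapsTo hx), es x hx]
    have h2 : HasScDerivAt E F D.U (fun x => ((D.h x - D.𝔰 x) - D.Γ (D.r x) (D.h x - D.𝔰 x)) +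
        (D.𝔰 x - D.Γ (D.r x) (D.𝔰 x))) 0 (((H - κ) - Q.comp (H - κ)) + τ) :=
      HasFDerivWithinAt.fun_add (HasFDerivWithinAt.fun_sub hA hQA) hτ
    have h3 : D.DL = ((H - κ) - Q.comp (H - κ)) + τ := by
      refine D.hasDeriv_L.unique_zero D.germ (h2.congr h0U1 fun y _ => ?_)
      rw [map_sub]
      abel
    rw [CompactEq, h3, add_sub_cancel_left]
    exact hτc
  have hPP : ∀ x, D.Dr (D.Dr x) = D.Dr x := by
    have h1 := HasScDerivAt.comp_zero D.germ_base D.germ_base D.retraction.tame.smooth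
      D.hasDeriv_r D.retraction.tame.smooth.sc0 hr0 D.hasDeriv_r
      (fun x hx => D.germ_base.subset_carrier 0 (D.retraction.tame.mapsTo hx))
    have h2 := (D.hasDeriv_r.congr (D.germ_base.zero_mem 1) fun y hy =>
      D.retraction.tame.idem _ hy).unique_zero D.germ_base h1
    exact fun x => (DFunLike.congr_fun h2 x).symm
  -- The defect vanishes on `O`, where `h` is the section `σ` of `K`; this is differentiated along
  -- `r`.
  have hLP : ∀ x, D.DL (D.Dr x) = 0 := by
    have h1 := HasScDerivAt.comp_zero D.germ_base D.germ D.smooth_defect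
      D.hasDeriv_L D.retraction.tame.smooth.sc0 hr0 D.hasDeriv_r
      (fun x hx => D.germ_base.subset_carrier 0 (D.retraction.tame.mapsTo hx))
    have h2 : HasScDerivAt E F (lev E (D.U 0)) (fun _ => 0) 0 (0 : E.X 0 →L[ℝ] F.X 0) :=
      (ScLin.zero E F).hasScDerivAt 0
    have h3 := (h2.congr (D.germ_base.zero_mem 1) fun y hy => by
      have hO' := D.r_mem hy
      rw [((D.mem_base_iff _).1 hO').2, ← D.fill_eq _ hO', D.Γ_of_mem (hK _ hO'),
        sub_self]).unique_zero D.germ_base h1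
    exact fun x => (DFunLike.congr_fun h3 x).symm
  -- Idempotency of `Γ (r x)` annihilates the defect; the product rule applies because the defect is
  -- zero at `0`.
  have hQL : ∀ x, Q (D.DL x) = 0 := by
    have h1 := D.retraction.bundle.hasScDerivAt_apply D.germ D.germ_base.isScDom D.smooth_r.sc0
      (fun x hx => D.retraction.tame.mapsTo hx) h0U hr0 D.hasDeriv_L (by rw [hr0, hσ0, sub_self])
    have h2 : HasScDerivAt E F D.U (fun _ => 0) 0 (0 : E.X 0 →L[ℝ] F.X 0) :=
      (ScLin.zero E F).hasScDerivAt 0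
    have h3 := (h2.congr h0U1 fun y hy => by
      rw [map_sub, D.Γ_r_Γ_r (D.isScDom.ι_mem 1 y hy), sub_self]).unique_zero D.germ h1
    exact fun x => (DFunLike.congr_fun h3 x).symm
  obtain ⟨e, he⟩ := D.fill_iso 0
  have he' : ∀ x, (e x : F.X 0) = D.DL x := he
  have hmemQ : ∀ y, (ContinuousLinearMap.id ℝ (F.X 0) - Q) y ∈ lvlSub F (LinearMap.ker (D.Γ 0)) 0 :=
    fun y => by
      change D.Γ 0 (y - Q y) = 0
      rw [map_sub, ← hQ, ← hQ, hQQ, sub_self]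
  -- The inverse of the filling isomorphism, extended by zero on the range of `Q`.
  let Θ : F.X 0 →L[ℝ] E.X 0 := (Submodule.subtypeL _).comp
    (e.symm.toContinuousLinearMap.comp ((ContinuousLinearMap.id ℝ (F.X 0) - Q).codRestrict _ hmemQ))
  have hΘ : ∀ y, Θ y = (e.symm ⟨y - Q y, hmemQ y⟩ : E.X 0) := fun _ => rfl
  have hmemP : ∀ x, x - D.Dr x ∈ lvlSub E (LinearMap.ker (D.Dr : E.X 0 →ₗ[ℝ] E.X 0)) 0 := fun x => by
    change D.Dr (x - D.Dr x) = 0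
    rw [map_sub, hPP, sub_self]
  refine ⟨H - κ, H, Q, Θ, hH, ?_, hQ, ⟨hcompact, hPP, hLP, hQL, fun x => ?_, fun y => ?_,
    fun y => ?_⟩, ?_⟩
  · rw [CompactEq, sub_sub_cancel_left]
    exact IsCompactOperator.neg hκc
  · have h1 : (⟨D.DL x - Q (D.DL x), hmemQ _⟩ : lvlSub F (LinearMap.ker (D.Γ 0)) 0)
        = e ⟨x - D.Dr x, hmemP x⟩ := by
      refine Subtype.ext ?_
      rw [he']
      change D.DL x - Q (D.DL x) = D.DL (x - D.Dr x)
      rw [hQL, map_sub, hLP]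
    rw [hΘ, h1, e.symm_apply_apply]
  · rw [hΘ, ← he', e.apply_symm_apply]
  · rw [hΘ]
    have h1 : (⟨Q y - Q (Q y), hmemQ _⟩ : lvlSub F (LinearMap.ker (D.Γ 0)) 0) = 0 :=
      Subtype.ext (by
        change Q y - Q (Q y) = 0
        rw [hQQ, sub_self])
    rw [h1, map_zero]
    rfl
  -- the normal form
  obtain ⟨T, hT⟩ := D.smooth_ψ.exists_hasScDerivAt h0U1
  obtain ⟨T', hT'⟩ := D.smooth_ψinv.exists_hasScDerivAt (D.germ'.zero_mem 1)
  obtain ⟨S, hS⟩ := D.basic.smooth.exists_hasScDerivAt (D.germ'.zero_mem 1)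
  have hTT' : ∀ x, T' (T x) = x := by
    have h1 := HasScDerivAt.comp_zero D.germ D.germ' D.smooth_ψinv hT' D.smooth_ψ.sc0 D.ψ_zero hT
      (fun x hx => D.germ'.subset_carrier 0 (D.ψ_mem hx))
    have h2 : HasScDerivAt E E D.U (fun x => x) 0 (ContinuousLinearMap.id ℝ (E.X 0)) :=
      (ScLin.id E).hasScDerivAt 0
    have h3 := (h2.congr h0U1 fun y hy =>
      (D.left_inv _ (D.isScDom.ι_mem 1 y hy)).1).unique_zero D.germ h1
    exact fun x => (DFunLike.congr_fun h3 x).symm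
  have hT'T : ∀ y, T (T' y) = y := by
    have h1 := HasScDerivAt.comp_zero D.germ' D.germ D.smooth_ψ hT D.smooth_ψinv.sc0 D.ψinv_zero hT'
      (fun x hx => D.germ.subset_carrier 0 (D.ψinv_mem hx))
    have h2 : HasScDerivAt ((eucl s).prod ((eucl d).prod W)) ((eucl s).prod ((eucl d).prod W)) D.U'
        (fun x => x) 0 (ContinuousLinearMap.id ℝ _) :=
      (ScLin.id ((eucl s).prod ((eucl d).prod W))).hasScDerivAt 0
    have h3 := (h2.congr (D.germ'.zero_mem 1) fun y hy =>
      (D.right_inv _ (D.germ'.isScDom.ι_mem 1 y hy)).1).unique_zero D.germ' h1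
    exact fun x => (DFunLike.congr_fun h3 x).symm
  let g : F.X 0 →L[ℝ] ((eucl k').prod W).X 0 := D.bundle.fiberMap D.isScDom 0 h0U
  let g' : ((eucl k').prod W).X 0 →L[ℝ] F.X 0 :=
    D.bundle_inv.fiberMap D.germ'.isScDom 0 (D.germ'.zero_mem 0)
  have hgg' : ∀ ξ, g' (g ξ) = ξ := fun ξ => by
    have := (D.left_inv 0 h0U).2 ξ
    rwa [D.ψ_zero] at this
  have hg'g : ∀ η, g (g' η) = η := fun η => by
    have := (D.right_inv 0 (D.germ'.zero_mem 0)).2 η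
    rwa [D.ψinv_zero] at this
  have hb : HasScDerivAt E ((eucl k').prod W) D.U
      (fun x => D.G (D.ψinv (D.ψ x)) (D.h (D.ψinv (D.ψ x)) - D.𝔰 (D.ψinv (D.ψ x)))) 0 (S.comp T) :=
    HasScDerivAt.comp_zero D.germ D.germ' D.basic.smooth hS D.smooth_ψ.sc0 D.ψ_zero hT
      (fun x hx => D.germ'.subset_carrier 0 (D.ψ_mem hx))
  -- Undoing the bundle chart writes `h - 𝔰` as `Ginv` over `ψ` applied to the basic germ at `ψ x`;
  -- again the argument vanishes at `0`.
  have hAeq : H - κ = g'.comp (S.comp T) := by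
    have h1 := D.bundle_inv.hasScDerivAt_apply D.germ D.germ'.isScDom D.smooth_ψ.sc0
      (fun x hx => D.ψ_mem hx) (D.germ'.zero_mem 0) D.ψ_zero hb (by
        rw [D.ψ_zero, D.ψinv_zero, hf0, map_zero])
    refine hA.unique_zero D.germ (h1.congr h0U1 fun y hy => ?_)
    obtain ⟨e1, e2⟩ := D.left_inv _ (D.isScDom.ι_mem 1 y hy)
    rw [e1, e2]
  let X : (EuclideanSpace ℝ (Fin k') × W.X 0) ≃L[ℝ] F.X 0 :=
    ContinuousLinearEquiv.equivOfInverse g' g hg'g hgg'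
  let Y : E.X 0 ≃L[ℝ] (EuclideanSpace ℝ (Fin s) × (EuclideanSpace ℝ (Fin d) × W.X 0)) :=
    ContinuousLinearEquiv.equivOfInverse T T' hTT' hT'T
  refine ⟨X, Y.trans (euclAssoc s d (W.X 0)), ?_⟩
  rw [hAeq]
  exact ((D.basic.compactEq hS).comp_clm T).clm_comp g'

/-- The index of a sc-Fredholm germ does not depend on the structures used to compute it. -/
theorem index_eq {W₂ : ScBanach.{u}} {s₂ d₂ k₂ : ℕ} (D : FredholmData C F O K σ W s d k')
    (D₂ : FredholmData C F O K σ W₂ s₂ d₂ k₂)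
    (hO : 0 ∈ O) (hK : ∀ x ∈ O, (x, σ x) ∈ K) : s + d + k₂ = s₂ + d₂ + k' := by
  obtain ⟨A, H, Q, Θ, hH, hAH, hQ, hsplit, X, Y, hXY⟩ := D.exists_filledSplit hO hK
  obtain ⟨A₂, H₂, Q₂, Θ₂, hH₂, hAH₂, hQ₂, hsplit₂, X₂, Y₂, hXY₂⟩ := D₂.exists_filledSplit hO hK
  -- One retraction lands in `O`, which the other fixes pointwise. So the two differentials are
  -- projections with the same range.
  have hP : ∀ {W W₂ : ScBanach.{u}} {s d k' s₂ d₂ k₂ : ℕ} (D : FredholmData C F O K σ W s d k')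
      (D₂ : FredholmData C F O K σ W₂ s₂ d₂ k₂) (x), D₂.Dr (D.Dr x) = D.Dr x := by
    intro W W₂ s d k' s₂ d₂ k₂ D D₂
    have h1 := HasScDerivAt.comp_zero D.germ_base D₂.germ_base D₂.retraction.tame.smooth
      D₂.hasDeriv_r D.retraction.tame.smooth.sc0 (D.r_zero hO) D.hasDeriv_r
      (fun x hx => D.germ_base.subset_carrier 0 (D.retraction.tame.mapsTo hx))
    have h2 := (D.hasDeriv_r.congr (D.germ_base.zero_mem 1) fun y hy =>
      ((D₂.mem_base_iff _).1 (D.r_mem hy)).2).unique_zero D.germ_base h1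
    exact fun x => (DFunLike.congr_fun h2 x).symm
  -- Both fillings equal `σ` on `O`, hence agree after composition with `r`; they may differ off
  -- `O`.
  have hHP : H₂.comp D.Dr = H.comp D.Dr := by
    have h1 := HasScDerivAt.comp_zero D.germ_base D.germ D.h_smooth hH
      D.retraction.tame.smooth.sc0 (D.r_zero hO) D.hasDeriv_r
      (fun x hx => D.germ_base.subset_carrier 0 (D.retraction.tame.mapsTo hx))
    have h2 := HasScDerivAt.comp_zero D.germ_base D₂.germ D₂.h_smooth hH₂
      D.retraction.tame.smooth.sc0 (D.r_zero hO) D.hasDeriv_r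
      (fun x hx => D.germ_base.subset_carrier 0 (D.retraction.tame.mapsTo hx))
    refine h2.unique_zero D.germ_base (h1.congr (D.germ_base.zero_mem 1) fun y hy => ?_)
    rw [← D.fill_eq _ (D.r_mem hy), ← D₂.fill_eq _ (D.r_mem hy)]
  have hAP : CompactEq (A₂.comp D.Dr) (A.comp D.Dr) := by
    have h1 := hAH₂.comp_clm D.Dr
    rw [hHP] at h1
    exact h1.trans (hAH.symm.comp_clm D.Dr)
  obtain ⟨S, T, h⟩ := hsplit.exists_compactEq hsplit₂ (hP D D₂) (hP D₂ D)
    (fun x => by rw [hQ, hQ₂]; exact D₂.Γ_of_mem (D.Γ_mem hO x))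
    (fun x => by rw [hQ, hQ₂]; exact D.Γ_of_mem (D₂.Γ_mem hO x)) hAP
  exact add_eq_add_of_compactEq_modelOp hXY hXY₂ h

end FredholmData

/-! ### Slices of tame retractions -/

/-- A bounded operator that restricts to bounded operators on all levels is a linear sc-operator. -/
theorem exists_scLin {E : ScBanach.{u}} {F : ScBanach.{v}} (T : E.X 0 →L[ℝ] F.X 0)
    (h : ∀ m, ∃ φ : E.X m → F.X m, Continuous φ ∧ ∀ ξ, F.ι m (φ ξ) = T (E.ι m ξ)) :
    ∃ L : ScLin E F, L.lvl 0 = T := by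
  choose φ hφ e using h
  refine ⟨⟨fun m =>
    { toFun := φ m
      map_add' := fun x y => F.ι_injective m (by simp [e])
      map_smul' := fun c x => F.ι_injective m (by simp [e])
      cont := hφ m }, fun m x => F.ι_injective m ?_⟩, ?_⟩
  · change F.ι m (φ m (E.incl m x)) = F.ι (m + 1) (φ (m + 1) x)
    rw [e, e, E.ι_succ]
  · ext x
    exact e 0 x

/-- The differential of a sc-smooth map at a smooth point is a linear sc-operator. -/
theorem ScSmooth.exists_scLin_deriv {E : ScBanach.{u}} {F : ScBanach.{v}} {U : Set (E.X 0)}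
    {f : E.X 0 → F.X 0} (hf : ScSmooth E F (lev E U) f) {x : E.X 1} (hx : x ∈ lev E U 1)
    (hxs : E.IsSmoothPt (E.ι 1 x)) :
    ∃ L : ScLin E F, HasScDerivAt E F (lev E U) f x (L.lvl 0) := by
  obtain ⟨-, Tf, hT, hT0⟩ := hf 1
  obtain ⟨T, hd, eT⟩ := hT x hx
  obtain ⟨L, rfl⟩ := exists_scLin T fun m => by
    -- Level `m` of the tangent space has base points in `E (m + 1)`, so boundedness on level `m`
    -- uses that `x` lifts to that level.
    obtain ⟨y, hy⟩ := hxs (m + 1)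
    have hyx : E.shift.ι m y = x := E.ι_injective 1 (by rw [E.ι_one_shift, hy])
    obtain ⟨g, hg, e⟩ := hT0 m
    have hmem : ∀ ξ : E.X m, ((y, ξ) : E.tan.X m) ∈ tanDom E (lev E U) m := fun ξ => by
      change E.ι (m + 1) y ∈ U
      rw [hy]
      exact hx
    refine ⟨fun ξ => (g (y, ξ)).2, continuous_snd.comp (hg.comp_continuous (by fun_prop) hmem),
      fun ξ => ?_⟩
    have h1 := e (y, ξ) (hmem ξ)
    rw [ScBanach.ι_prod, ScBanach.ι_prod] at h1
    have h2 := congrArg Prod.snd h1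
    simp only [hyx] at h2
    exact h2.trans (eT _).2
  exact ⟨L, hd⟩

/-- The image of a sc-splitting under a split surjection whose kernel is finite dimensional, smooth
and contained in the first factor. -/
theorem IsScSplitting.map {H : ScBanach.{u}} {E : ScBanach.{v}} {A B : Submodule ℝ (H.X 0)}
    (h : IsScSplitting H A B) (M : ScLin H E) (j : ScLin E H)
    (hMj : ∀ m x, M.lvl m (j.lvl m x) = x)
    [FiniteDimensional ℝ (LinearMap.ker (M.lvl 0 : H.X 0 →ₗ[ℝ] E.X 0))]
    (hA : LinearMap.ker (M.lvl 0 : H.X 0 →ₗ[ℝ] E.X 0) ≤ A)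
    (hs : ∀ z ∈ LinearMap.ker (M.lvl 0 : H.X 0 →ₗ[ℝ] E.X 0), H.IsSmoothPt z) :
    IsScSplitting E (A.map (M.lvl 0 : H.X 0 →ₗ[ℝ] E.X 0))
      (B.map (M.lvl 0 : H.X 0 →ₗ[ℝ] E.X 0)) := by
  set M₀ : H.X 0 →ₗ[ℝ] E.X 0 := (M.lvl 0 : H.X 0 →ₗ[ℝ] E.X 0) with hM₀
  have hker : ∀ z, z - j.lvl 0 (M₀ z) ∈ LinearMap.ker M₀ := fun z => by
    rw [LinearMap.mem_ker, map_sub, sub_eq_zero]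
    exact (hMj 0 _).symm
  -- Writing the image as a preimage under the section `j` shows that it is closed: a closed
  -- subspace plus a finite-dimensional one is closed.
  have hmap : ∀ B : Submodule ℝ (H.X 0), B.map M₀ = (B ⊔ LinearMap.ker M₀).comap
      (j.lvl 0 : E.X 0 →ₗ[ℝ] H.X 0) := by
    intro B
    ext y
    constructor
    · rintro ⟨z, hz, rfl⟩
      have := sub_mem (Submodule.mem_sup_left hz : z ∈ B ⊔ LinearMap.ker M₀)
        (Submodule.mem_sup_right (hker z))
      rwa [sub_sub_cancel] at this
    · intro hy
      obtain ⟨b, hb, c, hc, e⟩ := Submodule.mem_sup.1 hy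
      refine ⟨b, hb, ?_⟩
      have := congrArg M₀ e
      rw [map_add, LinearMap.mem_ker.1 hc, add_zero] at this
      exact this.trans (hMj 0 y)
  -- A preimage in `B` of a level-`m` vector `y` differs from `j y` by a kernel vector. Kernel
  -- vectors are smooth, so the preimage is of level `m` too.
  have hlift : ∀ (B : Submodule ℝ (H.X 0)) (m : ℕ) (y : E.X m), y ∈ lvlSub E (B.map M₀) m →
      ∃ z ∈ lvlSub H B m, M.lvl m z = y := by
    rintro B m y ⟨z, hz, e⟩
    obtain ⟨c, hc⟩ := hs _ (hker z) m
    have e' : M₀ z = E.ι m y := e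
    have hz' : H.ι m (j.lvl m y + c) = z := by
      rw [map_add, hc, j.ι_lvl, e', add_sub_cancel]
    refine ⟨j.lvl m y + c, by
      change H.ι m (j.lvl m y + c) ∈ B
      rwa [hz'], E.ι_injective m ?_⟩
    rw [M.ι_lvl, hz']
    exact e'
  have hsub : ∀ B : Submodule ℝ (H.X 0), IsScSubspace H B → IsScSubspace E (B.map M₀) := by
    intro B hB
    constructor
    · rw [hmap]
      exact (Submodule.isClosed_sup_finiteDimensional B (LinearMap.ker M₀) hB.1).preimage
        (j.lvl 0).continuous
    · intro m y hy
      obtain ⟨z, hz, rfl⟩ := hlift B m y hy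
      refine map_mem_closure (M.lvl m).continuous (hB.2 m hz) ?_
      rintro w ⟨hw, hws⟩
      refine ⟨⟨H.ι m w, hw, (M.ι_lvl m w).symm⟩, fun k => ?_⟩
      obtain ⟨w', e⟩ := hws k
      exact ⟨M.lvl k w', by rw [M.ι_lvl, M.ι_lvl, e]⟩
  refine ⟨hsub A h.1, hsub B h.2.1, fun m => ⟨?_, ?_⟩⟩
  -- If images of `a ∈ A` and `b ∈ B` coincide, then `b - a` is in the kernel, hence in `A`, so `b ∈
  -- A` and `b = 0`.
  · rw [Submodule.disjoint_def]
    rintro y ⟨a, ha, ea⟩ ⟨b, hb, eb⟩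
    have h1 : b - a ∈ LinearMap.ker M₀ := by
      rw [LinearMap.mem_ker, map_sub]
      exact sub_eq_zero.2 (eb.trans ea.symm)
    have h2 : b ∈ A := by
      have := add_mem (hA h1) ha
      rwa [sub_add_cancel] at this
    have h3 : b = 0 := Submodule.disjoint_def.1 (h.2.2 0).disjoint b h2 hb
    refine E.ι_injective m ?_
    have eb' : M₀ b = E.ι m y := eb
    rw [map_zero, ← eb', h3, map_zero]
  · rw [codisjoint_iff, Submodule.eq_top_iff']
    intro y
    have h1 : j.lvl m y ∈ lvlSub H A m ⊔ lvlSub H B m := by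
      rw [(h.2.2 m).sup_eq_top]
      trivial
    obtain ⟨a, ha, b, hb, e⟩ := Submodule.mem_sup.1 h1
    refine Submodule.mem_sup.2 ⟨M.lvl m a, ⟨_, ha, (M.ι_lvl m a).symm⟩, M.lvl m b,
      ⟨_, hb, (M.ι_lvl m b).symm⟩, ?_⟩
    rw [← map_add, e, hMj]

section Slice

variable {n : ℕ} {E : ScBanach.{u}} {C : PartialQuadrant E}

theorem relOpen_slice {U : Set (((eucl n).prod E).X 0)} (h : (euclProd n C).RelOpen U) :
    C.RelOpen (sliceBase n U) := by
  obtain ⟨V, hV, rfl⟩ := h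
  exact ⟨(fun x => (0, x)) ⁻¹' V, hV.preimage (by fun_prop), rfl⟩

theorem isScGerm_slice {D : ∀ m, Set (((eucl n).prod E).X m)} (h : (euclProd n C).IsScGerm D) :
    C.IsScGerm (fun m => (ScLin.inr (eucl n) E).lvl m ⁻¹' D m) where
  rel_open m := by
    obtain ⟨V, hV, e⟩ := h.rel_open m
    refine ⟨(ScLin.inr (eucl n) E).lvl m ⁻¹' V, hV.preimage (ContinuousLinearMap.continuous _), ?_⟩
    rw [e, preimage_inter]
    congr 1
    ext x
    rw [mem_preimage, PartialQuadrant.mem_lev_carrier, PartialQuadrant.mem_lev_carrier]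
    rfl
  zero_mem m := by
    rw [mem_preimage, map_zero]
    exact h.zero_mem m
  anti m x hx := by
    rw [mem_preimage, (ScLin.inr (eucl n) E).comm]
    exact h.anti m _ hx

theorem lev_sliceBase (U : Set (((eucl n).prod E).X 0)) (m : ℕ) :
    lev E (sliceBase n U) m = (ScLin.inr (eucl n) E).lvl m ⁻¹' lev _ U m := by
  ext x
  change ((0, E.ι m x) : ((eucl n).prod E).X 0) ∈ U ↔ ((eucl n).prod E).ι m (0, x) ∈ U
  rw [ScBanach.ι_prod, map_zero]

/-- The slice of a sliced retraction. -/
def sliceRetr (n : ℕ) {E : ScBanach.{u}} (r : ((eucl n).prod E).X 0 → ((eucl n).prod E).X 0)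
    (x : E.X 0) : E.X 0 :=
  (r ((0, x) : ((eucl n).prod E).X 0)).2

variable {U : Set (((eucl n).prod E).X 0)} {r : ((eucl n).prod E).X 0 → ((eucl n).prod E).X 0}

theorem slice_retr_eq (hr : ∀ x ∈ U, (r x).1 = x.1) {x : E.X 0} (hx : x ∈ sliceBase n U) :
    r (0, x) = (0, sliceRetr n r x) :=
  Prod.ext (hr _ hx) rfl

theorem smooth_sliceRetr (hU : (euclProd n C).RelOpen U)
    (h : ScSmooth ((eucl n).prod E) ((eucl n).prod E) (lev _ U) r) :
    ScSmooth E E (lev E (sliceBase n U)) (sliceRetr n r) :=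
  (h.comp_scLin (ScLin.inr (eucl n) E) (relOpen_slice hU).isScDom hU.isScDom fun m x hx => by
    rw [lev_sliceBase] at hx
    exact hx).scLin_comp (ScLin.snd (eucl n) E) (relOpen_slice hU).isScDom

/-- The differential in the parameter directions of a sliced retraction is tangent to the corner. -/
theorem deriv_parameter_mem_corner (h : IsTameRetraction (euclProd n C) U r) {x : E.X 1}
    (hx : E.ι 1 x ∈ sliceBase n U) (hrx : r (0, E.ι 1 x) = (0, E.ι 1 x))
    {S : ((eucl n).prod E).X 0 →L[ℝ] ((eucl n).prod E).X 0}
    (hS : HasScDerivAt ((eucl n).prod E) ((eucl n).prod E) (lev _ U) r (0, x) S)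
    (p : EuclideanSpace ℝ (Fin n)) : (S (p, 0)).2 ∈ C.corner (E.ι 1 x) := by
  intro i hi
  let H := (eucl n).prod E
  let c : H.X 0 →L[ℝ] ℝ := (EuclideanSpace.proj i).comp ((ContinuousLinearMap.fst ℝ _ _).comp
    ((C.Ψ.lvl 0).toContinuousLinearMap.comp (ContinuousLinearMap.snd ℝ _ _)))
  have hc : ∀ z : H.X 0, c z = (C.Ψ.lvl 0 z.2).1 i := fun _ => rfl
  have hι : ∀ t : ℝ, H.ι 1 (t • p, x) = (t • p, E.ι 1 x) := fun t => by
    rw [ScBanach.ι_prod, eucl_ι]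
  have hline : HasDerivAt (fun t : ℝ => ((t • p, x) : H.X 1)) (p, 0) 0 :=
    (by simpa using (hasDerivAt_id (0 : ℝ)).smul_const p : HasDerivAt (fun t : ℝ => t • p) p 0
      ).prodMk (hasDerivAt_const _ _)
  have hmem : ∀ᶠ t : ℝ in 𝓝 0, ((t • p, x) : H.X 1) ∈ lev H U 1 := by
    obtain ⟨V, hV, e⟩ := h.rel_open
    have h0 : ((0, E.ι 1 x) : H.X 0) ∈ V ∩ (euclProd n C).carrier := e ▸ hx
    have hcont : Continuous fun t : ℝ => ((t • p, E.ι 1 x) : H.X 0) := by fun_prop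
    have h1 : ∀ᶠ t : ℝ in 𝓝 0, ((t • p, E.ι 1 x) : H.X 0) ∈ V :=
      (hcont.tendsto 0).eventually (hV.mem_nhds (by rw [zero_smul]; exact h0.1))
    filter_upwards [h1] with t ht
    change H.ι 1 (t • p, x) ∈ U
    rw [hι, e]
    exact ⟨ht, h0.2⟩
  have hderiv : HasDerivAt (fun t : ℝ => c (r (H.ι 1 (t • p, x)))) (c (S (p, 0))) 0 := by
    have h2 : HasFDerivWithinAt (fun y : H.X 1 => r (H.ι 1 y)) (S.comp (H.ι 1)) (lev H U 1)
        (((0 : ℝ) • p, x) : H.X 1) := by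
      rw [zero_smul]
      exact hS
    have h4 := (h2.comp_hasDerivWithinAt_of_eq (s := {t : ℝ | ((t • p, x) : H.X 1) ∈ lev H U 1})
      (0 : ℝ) hline.hasDerivWithinAt (fun t ht => ht) rfl).hasDerivAt hmem
    have h5 := c.hasFDerivAt.comp_hasDerivAt (0 : ℝ) h4
    have e : (S.comp (H.ι 1)) (p, 0) = S (p, 0) := by
      rw [ContinuousLinearMap.comp_apply, ScBanach.ι_prod, eucl_ι, map_zero]
    rw [e] at h5
    exact h5
  -- The coordinate is nonnegative on the quadrant and zero at `t = 0`. The parameter direction is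
  -- unconstrained, so this is a two-sided minimum and the derivative vanishes.
  have hmin : IsLocalMin (fun t : ℝ => c (r (H.ι 1 (t • p, x)))) 0 := by
    filter_upwards [hmem] with t ht
    have h0 : c (r (H.ι 1 ((0 : ℝ) • p, x))) = 0 := by
      rw [hι, zero_smul, hrx, hc]
      exact hi
    rw [h0]
    obtain ⟨V, hV, e⟩ := h.rel_open
    have h1 : r (H.ι 1 (t • p, x)) ∈ V ∩ (euclProd n C).carrier := e ▸ h.mapsTo ht
    exact h1.2 i
  exact hmin.hasDerivAt_eq_zero hderiv

/-- The slice of a sliced tame retraction is a tame retraction. -/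
theorem IsTameRetraction.slice (h : IsTameRetraction (euclProd n C) U r)
    (hr : ∀ x ∈ U, (r x).1 = x.1) : IsTameRetraction C (sliceBase n U) (sliceRetr n r) where
  rel_open := relOpen_slice h.rel_open
  mapsTo x hx := by
    have := h.mapsTo hx
    rwa [slice_retr_eq hr hx] at this
  smooth := smooth_sliceRetr h.rel_open h.smooth
  idem x hx := by
    have := h.idem _ hx
    exact (congrArg (fun z => (r z).2) (slice_retr_eq hr hx)).symm.trans (congrArg Prod.snd this)
  -- The half-line coordinates of `euclProd n C` are those of `C`, so both degeneracy indices unfold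
  -- to the given ones.
  degen_eq x hx := h.degen_eq _ hx
  splitting := by
    rintro x ⟨x₀, hx₀, ex₀⟩ hxs T hT
    let H := (eucl n).prod E
    have hx : E.ι 1 x ∈ sliceBase n U := by
      rw [← ex₀]
      have := h.mapsTo hx₀
      rwa [slice_retr_eq hr hx₀] at this
    have hrx : r (0, E.ι 1 x) = (0, E.ι 1 x) := by
      have := h.idem _ hx₀
      rwa [slice_retr_eq hr hx₀, ex₀] at this
    have hιx : H.ι 1 (0, x) = (0, E.ι 1 x) := by rw [ScBanach.ι_prod, map_zero]
    have hxU : ((0, x) : H.X 1) ∈ lev H U 1 := by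
      change H.ι 1 (0, x) ∈ U
      rw [hιx]
      exact hx
    have hxs' : H.IsSmoothPt (H.ι 1 (0, x)) := fun m => by
      obtain ⟨y, hy⟩ := hxs m
      exact ⟨(0, y), by rw [hιx, ScBanach.ι_prod, hy, map_zero]⟩
    obtain ⟨S, hS⟩ := h.smooth.exists_scLin_deriv hxU hxs'
    obtain ⟨A, hsplit, hA⟩ := h.splitting (0, x)
      (by rw [hιx]; exact ⟨_, hx, hrx⟩) hxs' _ hS
    have hS1 : ∀ z, (S.lvl 0 z).1 = z.1 := by
      have h1 : HasScDerivAt H (eucl n) (lev H U) (fun y => (r y).1) (0, x) _ :=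
        hS.clm_comp (G := eucl n) (ContinuousLinearMap.fst ℝ _ _)
      have h2 : HasScDerivAt H (eucl n) (lev H U) (fun y => y.1) (0, x) _ :=
        (ScLin.fst (eucl n) E).hasScDerivAt _
      have h3 := (h2.congr hxU fun y hy => hr _ hy).unique
        (h.rel_open.isScDom.uniqueDiff 1 _ hxU) h1
      exact fun z => (DFunLike.congr_fun h3 z).symm
    have hST : ∀ ξ, T ξ = (S.lvl 0 (0, ξ)).2 := by
      have h1 : HasScDerivAt E E (lev E (sliceBase n U)) (sliceRetr n r) x _ :=
        (hS.comp_scLin (ScLin.inr (eucl n) E) (fun y hy => by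
          rw [lev_sliceBase] at hy
          exact hy)).clm_comp (G := E) (ContinuousLinearMap.snd ℝ _ _)
      have h2 := hT.unique ((relOpen_slice h.rel_open).isScDom.uniqueDiff 1 _ hx) h1
      exact fun ξ => DFunLike.congr_fun h2 ξ
    -- `M` projects along the graph of `P`, whose vectors `S (p, 0)` are tangent to `O`. The plain
    -- projection would not do: its kernel `ℝⁿ × 0` need not be tangent.
    let P : ScLin (eucl n) E := (ScLin.snd (eucl n) E).comp
      (S.comp ((ScLin.id (eucl n)).prodMk (ScLin.zero (eucl n) E)))
    let M : ScLin H E := (ScLin.snd (eucl n) E).sub (P.comp (ScLin.fst (eucl n) E))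
    have hM : ∀ m (z : H.X m), M.lvl m z = z.2 - P.lvl m z.1 := fun _ _ => rfl
    have hP : ∀ p, P.lvl 0 p = (S.lvl 0 (p, 0)).2 := fun _ => rfl
    have hker : ∀ z ∈ LinearMap.ker (M.lvl 0 : H.X 0 →ₗ[ℝ] E.X 0), z = (z.1, P.lvl 0 z.1) := by
      intro z hz
      exact Prod.ext rfl (sub_eq_zero.1 hz)
    have : FiniteDimensional ℝ (LinearMap.ker (M.lvl 0 : H.X 0 →ₗ[ℝ] E.X 0)) := by
      have hle : LinearMap.ker (M.lvl 0 : H.X 0 →ₗ[ℝ] E.X 0) ≤ LinearMap.range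
          (((ContinuousLinearMap.id ℝ (EuclideanSpace ℝ (Fin n))).prod (P.lvl 0) :
            EuclideanSpace ℝ (Fin n) →L[ℝ] H.X 0) : EuclideanSpace ℝ (Fin n) →ₗ[ℝ] H.X 0) :=
        fun z hz => ⟨z.1, (hker z hz).symm⟩
      exact Submodule.finiteDimensional_of_le hle
    have hsplit' := hsplit.map M (ScLin.inr (eucl n) E)
      (fun m y => by
        rw [hM]
        change y - P.lvl m 0 = y
        rw [map_zero, sub_zero])
      (fun z hz => ⟨(z.1, 0), by
        rw [hker z hz]
        exact Prod.ext (hS1 _) rfl⟩)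
      (fun z hz m => ⟨(z.1, P.lvl m z.1), by
        rw [ScBanach.ι_prod, P.ι_lvl, eucl_ι]
        exact (hker z hz).symm⟩)
    have hrange : (LinearMap.range (S.lvl 0 : H.X 0 →ₗ[ℝ] H.X 0)).map
        (M.lvl 0 : H.X 0 →ₗ[ℝ] E.X 0) = LinearMap.range (T : E.X 0 →ₗ[ℝ] E.X 0) := by
      have hMS : ∀ z : H.X 0, M.lvl 0 (S.lvl 0 z) = T z.2 := fun z => by
        have e : z = (z.1, 0) + (0, z.2) := Prod.ext (add_zero _).symm (zero_add _).symm
        rw [hM, hS1, hP, hST]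
        nth_rewrite 1 [e]
        rw [map_add, Prod.snd_add, add_sub_cancel_left]
      ext y
      constructor
      · rintro ⟨_, ⟨z, rfl⟩, rfl⟩
        exact ⟨z.2, (hMS z).symm⟩
      · rintro ⟨ξ, rfl⟩
        exact ⟨_, ⟨(0, ξ), rfl⟩, hMS (0, ξ)⟩
    rw [hrange] at hsplit'
    refine ⟨_, hsplit', ?_⟩
    rintro _ ⟨a, ha, rfl⟩
    have h1 : a.2 ∈ C.corner (E.ι 1 x) := fun i hi => by
      refine hA ha i ?_
      rw [hιx]
      exact hi
    exact sub_mem h1 (deriv_parameter_mem_corner h hx hrx hS a.1)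

end Slice

/-! ### Slices of bundle retractions -/

section Pullback

variable {E E' E₀ E₀' : ScBanach.{u}} {F : ScBanach.{v}} {F' : ScBanach.{w}} {F₀ : ScBanach.{v}}
  {F₀' : ScBanach.{w'}}
  {D : ∀ m, Set (E.X m)} {D' : ∀ m, Set (E'.X m)} {D₀ : ∀ m, Set (E₀.X m)}
  {D₀' : ∀ m, Set (E₀'.X m)}

theorem ScSmooth.pullback_bundle {f : (E.prod F).X 0 → F'.X 0}
    (hf : ScSmooth (E.prod F) F' (bundleDom E F D) f) (hD : IsScDom E D) (hD₀ : IsScDom E₀ D₀)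
    {α : E₀.X 0 → E.X 0} (hα : ScSmooth E₀ E D₀ α) (hαD : ScMapsTo E₀ E D₀ D α)
    (N₀ : ScLin F₀ F) (N : ScLin F' F₀') :
    ScSmooth (E₀.prod F₀) F₀' (bundleDom E₀ F₀ D₀)
      (fun z => N.lvl 0 (f (α z.1, N₀.lvl 0 z.2))) := by
  have hB := hD₀.bundleDom F₀
  have h1 : ScSmooth (E₀.prod F₀) E (bundleDom E₀ F₀ D₀) (fun z => α z.1) :=
    hα.comp_scLin (ScLin.fst E₀ F₀) hB hD₀ fun m z hz => hz
  have h2 : ScSmooth (E₀.prod F₀) F (bundleDom E₀ F₀ D₀) (fun z => N₀.lvl 0 z.2) :=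
    (N₀.comp (ScLin.snd E₀ F₀)).scSmooth _
  refine (hf.comp (h1.prodMk h2 hB) hB (hD.bundleDom F) (ScMapsTo.bundle ?_ h2.sc0)).scLin_comp N hB
  intro m z hz
  obtain ⟨y, hy, e⟩ := hαD m z.1 hz
  exact ⟨y, hy, by rw [e, ScBanach.ι_prod]⟩

/-- The pullback of a strong bundle map along a sc-smooth map of the base, with linear changes of
the fibers. -/
theorem IsStrongBundleMap.pullback {φ : E.X 0 → E'.X 0} {Γ : E.X 0 → F.X 0 →ₗ[ℝ] F'.X 0}
    (h : IsStrongBundleMap D D' φ Γ) (hD : IsScDom E D) (hD₀ : IsScDom E₀ D₀)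
    {α : E₀.X 0 → E.X 0} (hα : ScSmooth E₀ E D₀ α) (hαD : ScMapsTo E₀ E D₀ D α)
    (N₀ : ScLin F₀ F) (N : ScLin F' F₀') {φ₀ : E₀.X 0 → E₀'.X 0} (hφ₀ : ScSmooth E₀ E₀' D₀ φ₀)
    (hφD : ScMapsTo E₀ E₀' D₀ D₀' φ₀) {Γ₀ : E₀.X 0 → F₀.X 0 →ₗ[ℝ] F₀'.X 0}
    (hΓ₀ : ∀ x ξ, Γ₀ x ξ = N.lvl 0 (Γ (α x) (N₀.lvl 0 ξ))) : IsStrongBundleMap D₀ D₀' φ₀ Γ₀ where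
  base := hφD
  smooth_zero := by
    have hB := hD₀.bundleDom F₀
    have h1 : ScSmooth (E₀.prod F₀) E₀' (bundleDom E₀ F₀ D₀) (fun z => φ₀ z.1) :=
      hφ₀.comp_scLin (ScLin.fst E₀ F₀) hB hD₀ fun m z hz => hz
    simp only [hΓ₀]
    exact h1.prodMk ((h.smooth_fiber hD).pullback_bundle hD hD₀ hα hαD N₀ N) hB
  smooth_one := by
    have hB := hD₀.bundleDom F₀.shift
    have h1 : ScSmooth (E₀.prod F₀.shift) E₀' (bundleDom E₀ F₀.shift D₀) (fun z => φ₀ z.1) :=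
      hφ₀.comp_scLin (ScLin.fst E₀ F₀.shift) hB hD₀ fun m z hz => hz
    obtain ⟨Γ₁, e, hΓ₁⟩ := h.smooth_one
    have h2 := (hΓ₁.scLin_comp (ScLin.snd E' F'.shift) (hD.bundleDom F.shift)).pullback_bundle
      hD hD₀ hα hαD N₀.shift N.shift
    refine ⟨fun x ξ => N.lvl 1 (Γ₁ (α x) (N₀.lvl 1 ξ)), fun x hx ξ => ?_, h1.prodMk h2 hB⟩
    obtain ⟨y, hy, ey⟩ := hαD 0 x hx
    have ey' : y = α x := ey
    rw [N.ι_lvl, e _ (ey' ▸ hy), N₀.ι_lvl, hΓ₀]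

end Pullback

section SliceBundle

variable {n : ℕ} {E : ScBanach.{u}} {C : PartialQuadrant E} {F : ScBanach.{v}}
  {U : Set (((eucl n).prod E).X 0)} {r : ((eucl n).prod E).X 0 → ((eucl n).prod E).X 0}
  {Γ : ((eucl n).prod E).X 0 → F.X 0 →ₗ[ℝ] F.X 0}

/-- The restriction to the slice over `0 ∈ ℝⁿ` of a function on `ℝⁿ × E`. -/
def restrictSlice (n : ℕ) {E : ScBanach.{u}} {β : Type*} (f : ((eucl n).prod E).X 0 → β)
    (x : E.X 0) : β :=
  f ((0, x) : ((eucl n).prod E).X 0)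

theorem scMapsTo_inr {D : ∀ m, Set (((eucl n).prod E).X m)} :
    ScMapsTo E ((eucl n).prod E) (fun m => (ScLin.inr (eucl n) E).lvl m ⁻¹' D m) D
      ((ScLin.inr (eucl n) E).lvl 0) :=
  fun m _ hx => ⟨_, hx, (ScLin.inr (eucl n) E).ι_lvl m _⟩

/-- The slice of a sliced tame bundle retraction is a tame bundle retraction. -/
theorem IsTameBundleRetraction.slice (h : IsTameBundleRetraction (euclProd n C) F U r Γ)
    (hr : ∀ x ∈ U, (r x).1 = x.1) :
    IsTameBundleRetraction C F (sliceBase n U) (sliceRetr n r) (restrictSlice n Γ) where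
  tame := h.tame.slice hr
  bundle := by
    have hU := (relOpen_slice h.tame.rel_open).isScDom
    refine h.bundle.pullback h.tame.rel_open.isScDom hU (α := (ScLin.inr (eucl n) E).lvl 0)
      ((ScLin.inr (eucl n) E).scSmooth _) ?_ (ScLin.id F) (ScLin.id F) (h.tame.slice hr).smooth
      (ScMapsTo.self (h.tame.slice hr)) (fun _ _ => rfl)
    intro m x hx
    rw [lev_sliceBase] at hx
    exact scMapsTo_inr m x hx
  idem x hx ξ := by
    have := h.idem _ hx ξ
    rwa [slice_retr_eq hr hx] at this

/-- Since `r` preserves the parameter, a point of `O` over `0` can only come from points over `0`.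
-/
theorem image_sliceRetr (hr : ∀ x ∈ U, (r x).1 = x.1) :
    sliceRetr n r '' sliceBase n U = sliceBase n (r '' U) := by
  ext y
  constructor
  · rintro ⟨x, hx, rfl⟩
    exact ⟨_, hx, slice_retr_eq hr hx⟩
  · rintro ⟨⟨p, x⟩, hx, e⟩
    have hp : (0 : EuclideanSpace ℝ (Fin n)) = p := (congrArg Prod.fst e).symm.trans (hr _ hx)
    subst hp
    exact ⟨x, hx, congrArg Prod.snd e⟩

theorem bundleImage_slice (hr : ∀ x ∈ U, (r x).1 = x.1) :
    bundleImage (sliceBase n U) (sliceRetr n r) (restrictSlice n Γ)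
      = sliceTotal n (bundleImage U r Γ) := by
  ext ⟨y, η⟩
  constructor
  · rintro ⟨x, hx, ξ, e⟩
    obtain ⟨rfl, rfl⟩ := Prod.mk.inj e
    exact ⟨_, hx, ξ, Prod.ext (slice_retr_eq hr hx).symm rfl⟩
  · rintro ⟨⟨p, x⟩, hx, ξ, e⟩
    have e1 : ((0, y) : ((eucl n).prod E).X 0) = r (p, x) := congrArg Prod.fst e
    have hp : (0 : EuclideanSpace ℝ (Fin n)) = p := (congrArg Prod.fst e1).trans (hr _ hx)
    subst hp
    refine ⟨x, hx, ξ, Prod.ext (congrArg Prod.snd e1) ?_⟩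
    exact (congrArg (fun z => z.2) e : _)

end SliceBundle

section SliceData

variable {n : ℕ} {E : ScBanach.{u}} {C : PartialQuadrant E} {F : ScBanach.{v}}
  {O : Set (((eucl n).prod E).X 0)} {K : Set (((eucl n).prod E).X 0 × F.X 0)}
  {σ : ((eucl n).prod E).X 0 → F.X 0}

/-- The slice of a sliced section germ is a section germ. -/
theorem IsSectionGerm.slice (h : IsSectionGerm (euclProd n C) F O K σ)
    {U : Set (((eucl n).prod E).X 0)} {r : ((eucl n).prod E).X 0 → ((eucl n).prod E).X 0}
    {Γ : ((eucl n).prod E).X 0 → F.X 0 →ₗ[ℝ] F.X 0}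
    (hR : IsTameBundleRetraction (euclProd n C) F U r Γ) (hr : ∀ x ∈ U, (r x).1 = x.1)
    (hO : r '' U = O) (hK : bundleImage U r Γ = K) :
    IsSectionGerm C F (sliceBase n O) (sliceTotal n K) (sliceSection n σ) where
  retract := ⟨_, _, _, hR.slice hr, by rw [image_sliceRetr hr, hO], by rw [bundleImage_slice hr, hK]⟩
  zero_mem := h.zero_mem
  smooth := by
    refine ⟨fun x hx => h.smooth.1 _ hx, _, _, hR.tame.slice hr, by rw [image_sliceRetr hr, hO], ?_⟩
    obtain ⟨-, U₂, r₂, hr₂, hO₂, hσ⟩ := h.smooth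
    -- The retraction `r₂` witnessing smoothness of `σ` need not be sliced. It fixes `O`, so `σ ∘ r
    -- = (σ ∘ r₂) ∘ r` is smooth for the sliced `r`.
    have hfix : ∀ x ∈ U, r x ∈ U₂ ∧ r₂ (r x) = r x := fun x hx => by
      obtain ⟨y, hy, e⟩ : r x ∈ r₂ '' U₂ := by
        rw [hO₂, ← hO]
        exact mem_image_of_mem r hx
      rw [← e]
      exact ⟨hr₂.mapsTo hy, hr₂.idem y hy⟩
    have h1 := hσ.comp hR.tame.smooth hR.tame.rel_open.isScDom hr₂.rel_open.isScDom
      (hR.tame.smooth.sc0.scMapsTo_lev fun m x hx => (hfix _ hx).1)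
    have hU := (relOpen_slice hR.tame.rel_open).isScDom
    refine (h1.comp_scLin (ScLin.inr (eucl n) E) hU hR.tame.rel_open.isScDom fun m x hx => by
      rw [lev_sliceBase] at hx
      exact hx).congr fun m x hx => ?_
    change σ (0, sliceRetr n r (E.ι m x)) = σ (r₂ (r (0, E.ι m x)))
    rw [(hfix _ hx).2, slice_retr_eq hr hx]

end SliceData

/-! ### Slices of Fredholm data -/

/-- The product of the identity of the first factor with a linear sc-isomorphism. -/
@[simps] def ScEquiv.prodRight (E : ScBanach.{u}) {F : ScBanach.{v}} {G : ScBanach.{w}}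
    (e : ScEquiv F G) : ScEquiv (E.prod F) (E.prod G) where
  lvl m := (ContinuousLinearEquiv.refl ℝ (E.X m)).prodCongr (e.lvl m)
  comm m x := Prod.ext rfl (e.comm m x.2)

/-- The identification `ℝᵏ × (W × ℝⁿ) ≅ ℝ^(k+n) × W`. -/
def euclShuffle (k n : ℕ) (W : ScBanach.{u}) :
    ScEquiv ((eucl k).prod (W.prod (eucl n))) ((eucl (k + n)).prod W) where
  lvl m := (((ContinuousLinearEquiv.refl ℝ (EuclideanSpace ℝ (Fin k))).prodCongr
      (ContinuousLinearEquiv.prodComm ℝ (W.X m) (EuclideanSpace ℝ (Fin n)))).trans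
    (ContinuousLinearEquiv.prodAssoc ℝ (EuclideanSpace ℝ (Fin k)) (EuclideanSpace ℝ (Fin n))
      (W.X m)).symm).trans
    ((ContinuousLinearEquiv.ofFinrankEq (by simp)).prodCongr (ContinuousLinearEquiv.refl ℝ (W.X m)))
  comm _ _ := rfl

theorem euclShuffle_snd (k n : ℕ) (W : ScBanach.{u}) (m : ℕ)
    (x : ((eucl k).prod (W.prod (eucl n))).X m) : ((euclShuffle k n W).lvl m x).2 = x.2.1 := rfl

/-- The image of a germ under a linear sc-isomorphism that preserves the half-line coordinates. -/
theorem isScGerm_preimage {s : ℕ} {E' E'' : ScBanach.{u}} (e : ScEquiv E'' E')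
    {D : ∀ m, Set (((eucl s).prod E').X m)} (h : (stdQuadrant s E').IsScGerm D) :
    (stdQuadrant s E'').IsScGerm (fun m => (e.prodRight (eucl s)).lvl m ⁻¹' D m) where
  rel_open m := by
    obtain ⟨V, hV, eV⟩ := h.rel_open m
    refine ⟨(e.prodRight (eucl s)).lvl m ⁻¹' V, hV.preimage (ContinuousLinearEquiv.continuous _), ?_⟩
    rw [eV, preimage_inter]
    congr 1
    ext x
    rw [mem_preimage, PartialQuadrant.mem_lev_carrier, PartialQuadrant.mem_lev_carrier]
    rfl
  zero_mem m := by
    rw [mem_preimage, map_zero]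
    exact h.zero_mem m
  anti m x hx := by
    rw [mem_preimage, (e.prodRight (eucl s)).comm]
    exact h.anti m _ hx

/-- A function which is `C¹` near the origin of a sc-domain is Lipschitz there. -/
theorem IsScDom.exists_lipschitz {E : ScBanach.{u}} {D : ∀ m, Set (E.X m)} (hD : IsScDom E D)
    {V : Type*} [NormedAddCommGroup V] [NormedSpace ℝ V] (m : ℕ) (h0 : (0 : E.X m) ∈ D m)
    {f : E.X m → V} (hf : ContDiffOn ℝ 1 f (D m)) :
    ∃ (c δ : ℝ), 0 ≤ c ∧ 0 < δ ∧ ∀ x ∈ D m, ∀ y ∈ D m, ‖x‖ < δ → ‖y‖ < δ →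
      ‖f x - f y‖ ≤ c * ‖x - y‖ := by
  obtain ⟨ρ, hρ, -, hconv⟩ := hD.exists_convex_nhds m 0 h0 1 one_pos
  have h1 : ContDiffWithinAt ℝ 1 f (Metric.ball 0 ρ ∩ D m) 0 := (hf 0 h0).mono inter_subset_right
  obtain ⟨c, t, ht, hlip⟩ := h1.exists_lipschitzOnWith hconv
  obtain ⟨ρ', hρ', ht'⟩ := Metric.mem_nhdsWithin_iff.1 ht
  have hmem : ∀ x ∈ D m, ‖x‖ < min ρ ρ' → x ∈ t := fun x hx hn =>
    ht' ⟨mem_ball_zero_iff.2 (hn.trans_le (min_le_right _ _)),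
      mem_ball_zero_iff.2 (hn.trans_le (min_le_left _ _)), hx⟩
  refine ⟨c, min ρ ρ', c.2, lt_min hρ hρ', fun x hx y hy hnx hny => ?_⟩
  exact hlip.norm_sub_le (hmem x hx hnx) (hmem y hy hny)

namespace FredholmData

variable {n s : ℕ} {E' : ScBanach.{u}} {F : ScBanach.{v}}
  {O : Set (((eucl n).prod ((eucl s).prod E')).X 0)}
  {K : Set (((eucl n).prod ((eucl s).prod E')).X 0 × F.X 0)}
  {σ : ((eucl n).prod ((eucl s).prod E')).X 0 → F.X 0} {W : ScBanach.{u}} {d k' : ℕ}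
  (D : FredholmData (euclProd n (stdQuadrant s E')) F O K σ (W.prod (eucl n)) s d k')
  (ψ' : ScEquiv E' ((eucl d).prod W))

/-- The differential of a sliced retraction preserves the parameter. -/
theorem fst_Dr (hr : ∀ x ∈ D.U 0, (D.r x).1 = x.1) (z : ((eucl n).prod ((eucl s).prod E')).X 0) :
    (D.Dr z).1 = z.1 := by
  have h1 : HasScDerivAt _ (eucl n) (lev _ (D.U 0)) (fun y => (D.r y).1) 0 _ :=
    D.hasDeriv_r.clm_comp (G := eucl n) (ContinuousLinearMap.fst ℝ _ _)
  have h2 : HasScDerivAt _ (eucl n) (lev _ (D.U 0)) (fun y => y.1) 0 _ :=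
    (ScLin.fst (eucl n) ((eucl s).prod E')).hasScDerivAt _
  have h3 := (h2.congr (D.germ_base.zero_mem 1) fun y hy => hr _ hy).unique_zero D.germ_base h1
  exact (DFunLike.congr_fun h3 z).symm

/-- The germ of neighborhoods on the slice. -/
def sliceU (m : ℕ) : Set (((eucl s).prod E').X m) :=
  (ScLin.inr (eucl n) ((eucl s).prod E')).lvl m ⁻¹' D.U m

/-- The germ of neighborhoods in the linear model of the slice. -/
def sliceU' (m : ℕ) : Set (((eucl s).prod ((eucl d).prod W)).X m) :=
  (ψ'.symm.prodRight (eucl s)).lvl m ⁻¹' D.sliceU m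

theorem germ_sliceU : (stdQuadrant s E').IsScGerm D.sliceU := isScGerm_slice D.germ

theorem germ_sliceU' : (stdQuadrant s ((eucl d).prod W)).IsScGerm (D.sliceU' ψ') :=
  isScGerm_preimage ψ'.symm D.germ_sliceU

/-- The kernels of the differentials of the retraction and of its slice agree. -/
def kerSliceEquiv (hr : ∀ x ∈ D.U 0, (D.r x).1 = x.1) {T : ((eucl s).prod E').X 0 →L[ℝ]
      ((eucl s).prod E').X 0} (hT : ∀ ξ, T ξ = (D.Dr (0, ξ)).2) (m : ℕ) :
    lvlSub ((eucl s).prod E') (LinearMap.ker (T : _ →ₗ[ℝ] ((eucl s).prod E').X 0)) m ≃L[ℝ]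
      lvlSub ((eucl n).prod ((eucl s).prod E'))
        (LinearMap.ker (D.Dr : _ →ₗ[ℝ] ((eucl n).prod ((eucl s).prod E')).X 0)) m :=
  have hι : ∀ ξ, ((eucl n).prod ((eucl s).prod E')).ι m (0, ξ) = (0, ((eucl s).prod E').ι m ξ) :=
    fun ξ => by rw [ScBanach.ι_prod, map_zero]
  -- The differential preserves the parameter, so its kernel vectors have parameter `0`.
  have hker : ∀ z, z ∈ lvlSub ((eucl n).prod ((eucl s).prod E'))
      (LinearMap.ker (D.Dr : _ →ₗ[ℝ] ((eucl n).prod ((eucl s).prod E')).X 0)) m →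
      z = (0, z.2) := fun z hz => by
    have h1 : D.Dr (((eucl n).prod ((eucl s).prod E')).ι m z) = 0 := hz
    have h2 := D.fst_Dr hr (((eucl n).prod ((eucl s).prod E')).ι m z)
    rw [h1, ScBanach.ι_prod, eucl_ι] at h2
    exact Prod.ext h2.symm rfl
  ContinuousLinearEquiv.equivOfInverse
    (((ContinuousLinearMap.inr ℝ ((eucl n).X m) (((eucl s).prod E').X m)).comp
        (Submodule.subtypeL _)).codRestrict _ fun ξ => by
      change D.Dr (((eucl n).prod ((eucl s).prod E')).ι m (0, ξ.1)) = 0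
      rw [hι]
      have h1 : T (((eucl s).prod E').ι m ξ.1) = 0 := ξ.2
      exact Prod.ext (D.fst_Dr hr _) ((hT _).symm.trans h1))
    (((ContinuousLinearMap.snd ℝ ((eucl n).X m) (((eucl s).prod E').X m)).comp
        (Submodule.subtypeL _)).codRestrict _ fun z => by
      change T (((eucl s).prod E').ι m z.1.2) = 0
      have h1 : D.Dr (((eucl n).prod ((eucl s).prod E')).ι m z.1) = 0 := z.2
      rw [hker _ z.2, hι] at h1
      rw [hT, h1]
      rfl)
    (fun _ => rfl) (fun z => Subtype.ext (hker _ z.2).symm)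


/-- The map from the linear model of the slice to the model of the total space. -/
def sliceModel (y : ((eucl s).prod ((eucl d).prod W)).X 0) :
    ((eucl s).prod ((eucl d).prod (W.prod (eucl n)))).X 0 :=
  D.ψ (0, (ψ'.symm.prodRight (eucl s)).lvl 0 y)

theorem smooth_sliceModel : ScSmooth ((eucl s).prod ((eucl d).prod W))
    ((eucl s).prod ((eucl d).prod (W.prod (eucl n)))) (D.sliceU' ψ') (D.sliceModel ψ') :=
  D.smooth_ψ.comp_scLin ((ScLin.inr (eucl n) ((eucl s).prod E')).comp
    (ψ'.symm.prodRight (eucl s)).toScLin) (D.germ_sliceU' ψ').isScDom D.isScDom fun _ _ hy => hy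

theorem scMapsTo_sliceModel : ScMapsTo ((eucl s).prod ((eucl d).prod W))
    ((eucl s).prod ((eucl d).prod (W.prod (eucl n)))) (D.sliceU' ψ') D.U' (D.sliceModel ψ') := by
  intro m y hy
  obtain ⟨z, hz, e⟩ := D.bundle.base m _ hy
  refine ⟨z, hz, e.trans ?_⟩
  rw [ScLin.ι_lvl, ScEquiv.ι_lvl]
  rfl

theorem sliceModel_zero : D.sliceModel ψ' 0 = 0 := by
  rw [sliceModel, map_zero]
  exact D.ψ_zero

/-- The slice of the basic germ is a basic germ. -/
theorem isBasicGerm_slice {lam : ((eucl n).prod ((eucl s).prod E')).X 0 → EuclideanSpace ℝ (Fin n)}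
    (hψ : ∀ x ∈ D.U 0, D.ψ x = (x.2.1, ((ψ'.lvl 0 x.2.2).1, ((ψ'.lvl 0 x.2.2).2, lam x))))
    (hlam : ∀ m, ContDiffOn ℝ 1 (fun x : ((eucl n).prod ((eucl s).prod E')).X m =>
      lam (((eucl n).prod ((eucl s).prod E')).ι m x)) (D.U m)) :
    IsBasicGerm (k' := k' + n) (D.sliceU' ψ') (fun y => (euclShuffle k' n W).lvl 0
      (D.G (0, (ψ'.symm.prodRight (eucl s)).lvl 0 y)
        (D.h (0, (ψ'.symm.prodRight (eucl s)).lvl 0 y) -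
          D.𝔰 (0, (ψ'.symm.prodRight (eucl s)).lvl 0 y)))) := by
  have hdom := (D.germ_sliceU' ψ').isScDom
  -- Before the regrouping of the target, the new germ is the given basic germ composed with
  -- `sliceModel`.
  have hbα : ∀ y ∈ D.sliceU' ψ' 0, D.G (0, (ψ'.symm.prodRight (eucl s)).lvl 0 y)
      (D.h (0, (ψ'.symm.prodRight (eucl s)).lvl 0 y) -
        D.𝔰 (0, (ψ'.symm.prodRight (eucl s)).lvl 0 y))
      = D.G (D.ψinv (D.sliceModel ψ' y)) (D.h (D.ψinv (D.sliceModel ψ' y)) -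
        D.𝔰 (D.ψinv (D.sliceModel ψ' y))) := fun y hy => by
    have hy' : ((0, (ψ'.symm.prodRight (eucl s)).lvl 0 y) : ((eucl n).prod ((eucl s).prod E')).X 0)
        ∈ D.U 0 := hy
    rw [sliceModel, (D.left_inv _ hy').1]
  have hα : ∀ y ∈ D.sliceU' ψ' 0, D.sliceModel ψ' y = (y.1, (y.2.1, (y.2.2,
      lam (0, (ψ'.symm.prodRight (eucl s)).lvl 0 y)))) := fun y hy => by
    have hy' : ((0, (ψ'.symm.prodRight (eucl s)).lvl 0 y) : ((eucl n).prod ((eucl s).prod E')).X 0)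
        ∈ D.U 0 := hy
    have e : ψ'.lvl 0 (ψ'.symm.lvl 0 y.2) = y.2 := (ψ'.lvl 0).apply_symm_apply y.2
    rw [sliceModel, hψ _ hy']
    change (y.1, ((ψ'.lvl 0 (ψ'.symm.lvl 0 y.2)).1, ((ψ'.lvl 0 (ψ'.symm.lvl 0 y.2)).2, _))) = _
    rw [e]
  refine ⟨D.germ_sliceU' ψ', ?_, ?_, ?_⟩
  · refine ((D.basic.smooth.comp (D.smooth_sliceModel ψ') hdom D.germ'.isScDom
      (D.scMapsTo_sliceModel ψ')).scLin_comp (euclShuffle k' n W).toScLin hdom).congr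
      fun m y hy => ?_
    rw [hbα _ (hdom.ι_mem m y hy)]
    rfl
  · have e : ((0 : EuclideanSpace ℝ (Fin n)), (0 : ((eucl s).prod E').X 0)) = 0 := rfl
    rw [map_zero, e, D.𝔰_zero, sub_self, map_zero, map_zero]
  obtain ⟨B, hBs, hB0, hbB, hB⟩ := D.basic.form
  -- Only the `W`-component of the old contraction term is kept; its `ℝⁿ`-component has become part
  -- of the finite-dimensional target.
  refine ⟨fun y => (B (D.sliceModel ψ' y)).1, ?_, ?_, fun y hy => ?_, fun ε hε m => ?_⟩
  · exact (hBs.comp (D.smooth_sliceModel ψ') hdom D.germ'.isScDom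
      (D.scMapsTo_sliceModel ψ')).scLin_comp (ScLin.fst W (eucl n)) hdom
  · change (B (D.sliceModel ψ' 0)).1 = 0
    rw [D.sliceModel_zero, hB0]
    rfl
  · obtain ⟨z, hz, ez⟩ := D.scMapsTo_sliceModel ψ' 0 y hy
    have ez' : z = D.sliceModel ψ' y := ez
    rw [euclShuffle_snd, hbα y hy, hbB _ (ez' ▸ hz), Prod.fst_sub]
    nth_rewrite 1 [hα y hy]
    rfl
  · let H := (eucl n).prod ((eucl s).prod E')
    let H₁ := (eucl s).prod ((eucl d).prod W)
    let Λ : ScLin H₁ H := (ScLin.inr (eucl n) ((eucl s).prod E')).comp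
      (ψ'.symm.prodRight (eucl s)).toScLin
    have hΛ : ∀ y, Λ.lvl 0 y = (0, (ψ'.symm.prodRight (eucl s)).lvl 0 y) := fun _ => rfl
    let lm : H₁.X m → EuclideanSpace ℝ (Fin n) := fun y => lam (H.ι m (Λ.lvl m y))
    have hlm : ContDiffOn ℝ 1 lm (D.sliceU' ψ' m) :=
      (hlam m).comp (Λ.lvl m).contDiff.contDiffOn fun y hy => hy
    obtain ⟨c, δ₁, hc, hδ₁, hlip⟩ := hdom.exists_lipschitz m ((D.germ_sliceU' ψ').zero_mem m) hlm
    have hlm0 : lm 0 = 0 := by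
      have h1 := hα 0 ((D.germ_sliceU' ψ').zero_mem 0)
      rw [D.sliceModel_zero, ← hΛ] at h1
      have h2 : lam (Λ.lvl 0 0) = 0 := (congrArg (fun z => z.2.2.2) h1).symm
      change lam (H.ι m (Λ.lvl m 0)) = 0
      rw [Λ.ι_lvl, map_zero, h2]
    -- Replacing `w` by `(w, lm)` stretches differences by at most `1 + c`. By `lm 0 = 0` it
    -- stretches the smallness condition by the same factor, hence the radius `δ₂ / (1 + c)` below.
    obtain ⟨δ₂, hδ₂, hcon⟩ := hB (ε / (1 + c)) (by positivity) m
    have hnorm : ∀ (v : (eucl s).X m) (q : (eucl d).X m) (w : W.X m),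
        ‖((v, (q, w)) : H₁.X m)‖ ≤ ‖v‖ + ‖q‖ + ‖w‖ := fun v q w => by
      have h1 := norm_nonneg v
      have h2 := norm_nonneg q
      have h3 := norm_nonneg w
      exact max_le (by linarith) (max_le (by linarith) (by linarith))
    -- the lift of a point of the slice to the model of the total space
    have hlift : ∀ (v : (eucl s).X m) (q : (eucl d).X m) (w : W.X m),
        (v, (q, w)) ∈ D.sliceU' ψ' m → ‖v‖ + ‖q‖ + ‖w‖ < min δ₁ (δ₂ / (1 + c)) →
        ((v, (q, (w, lm (v, (q, w))))) ∈ D.U' m ∧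
          ((eucl s).prod ((eucl d).prod (W.prod (eucl n)))).ι m (v, (q, (w, lm (v, (q, w)))))
            = D.sliceModel ψ' (H₁.ι m (v, (q, w)))) ∧
        ‖v‖ + ‖q‖ + ‖((w, lm (v, (q, w))) : (W.prod (eucl n)).X m)‖ < δ₂ := by
      intro v q w hy hn
      constructor
      · obtain ⟨z, hz, ez⟩ := D.scMapsTo_sliceModel ψ' m _ hy
        have h1 : ((eucl s).prod ((eucl d).prod (W.prod (eucl n)))).ι m
            (v, (q, (w, lm (v, (q, w))))) = D.sliceModel ψ' (H₁.ι m (v, (q, w))) := by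
          rw [hα _ (hdom.ι_mem m _ hy), ← hΛ, ← Λ.ι_lvl]
          have e1 : H₁.ι m (v, (q, w)) = ((eucl s).ι m v, ((eucl d).ι m q, W.ι m w)) := by
            rw [ScBanach.ι_prod, ScBanach.ι_prod]
          rw [e1, ScBanach.ι_prod, ScBanach.ι_prod, ScBanach.ι_prod, eucl_ι n]
        have h2 : z = (v, (q, (w, lm (v, (q, w))))) :=
          ScBanach.ι_injective _ m (ez.trans h1.symm)
        exact ⟨h2 ▸ hz, h1⟩
      · have h1 := hlip _ hy 0 ((D.germ_sliceU' ψ').zero_mem m)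
          ((hnorm v q w).trans_lt (hn.trans_le (min_le_left _ _))) (by rwa [norm_zero])
        rw [hlm0, sub_zero, sub_zero] at h1
        have h2 : c * ‖((v, (q, w)) : H₁.X m)‖ ≤ c * (‖v‖ + ‖q‖ + ‖w‖) :=
          mul_le_mul_of_nonneg_left (hnorm v q w) hc
        have h3 := hn.trans_le (min_le_right _ _)
        rw [lt_div_iff₀ (by positivity)] at h3
        have h4 : ‖((w, lm (v, (q, w))) : (W.prod (eucl n)).X m)‖
            ≤ ‖w‖ + ‖lm (v, (q, w))‖ :=
          max_le (le_add_of_nonneg_right (norm_nonneg _)) (le_add_of_nonneg_left (norm_nonneg _))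
        linarith
    refine ⟨min δ₁ (δ₂ / (1 + c)), lt_min hδ₁ (by positivity),
      fun v q w w' hy hy' hn hn' z z' hz hz' => ?_⟩
    obtain ⟨⟨hm, e⟩, hn₂⟩ := hlift v q w hy hn
    obtain ⟨⟨hm', e'⟩, hn₂'⟩ := hlift v q w' hy' hn'
    obtain ⟨β, -, hβ⟩ := hBs.sc0 m
    have h1 := hcon v q _ _ hm hm' hn₂ hn₂' _ _ (hβ _ hm) (hβ _ hm')
    have hzβ : ∀ (y : H₁.X m) (z : W.X m) (x : ((eucl s).prod ((eucl d).prod (W.prod (eucl n)))).X m),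
        x ∈ D.U' m → ((eucl s).prod ((eucl d).prod (W.prod (eucl n)))).ι m x
          = D.sliceModel ψ' (H₁.ι m y) → W.ι m z = (B (D.sliceModel ψ' (H₁.ι m y))).1 →
        z = (β x).1 := by
      intro y z x hx e hz
      refine W.ι_injective m ?_
      have h2 := hβ x hx
      rw [e, ScBanach.ι_prod] at h2
      rw [hz, ← h2]
    rw [hzβ _ z _ hm e hz, hzβ _ z' _ hm' e' hz']
    have h2 := hlip _ hy _ hy' ((hnorm v q w).trans_lt (hn.trans_le (min_le_left _ _)))
      ((hnorm v q w').trans_lt (hn'.trans_le (min_le_left _ _)))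
    have h3 : ‖((v, (q, w)) : H₁.X m) - (v, (q, w'))‖ = ‖w - w'‖ := by
      simp [Prod.norm_def]
    rw [h3] at h2
    have h4 : ‖((w, lm (v, (q, w))) : (W.prod (eucl n)).X m) - (w', lm (v, (q, w')))‖
        ≤ (1 + c) * ‖w - w'‖ := by
      have h5 := norm_nonneg (w - w')
      have h6 : 0 ≤ c * ‖w - w'‖ := by positivity
      refine max_le ?_ ?_
      · change ‖w - w'‖ ≤ _
        linarith
      · change ‖lm (v, (q, w)) - lm (v, (q, w'))‖ ≤ _
        linarith
    calc ‖(β (v, (q, (w, lm (v, (q, w)))))).1 - (β (v, (q, (w', lm (v, (q, w')))))).1‖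
        ≤ ‖β (v, (q, (w, lm (v, (q, w))))) - β (v, (q, (w', lm (v, (q, w')))))‖ :=
          le_max_left _ _
      _ ≤ ε / (1 + c) * ((1 + c) * ‖w - w'‖) :=
          h1.trans (mul_le_mul_of_nonneg_left h4 (by positivity))
      _ = ε * ‖w - w'‖ := by
          field_simp

end FredholmData

theorem ScEquiv.scMapsTo_preimage {E : ScBanach.{u}} {F : ScBanach.{v}} (e : ScEquiv E F)
    (D : ∀ m, Set (E.X m)) :
    ScMapsTo E F D (fun m => e.symm.lvl m ⁻¹' D m) (e.lvl 0) := by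
  intro m x hx
  refine ⟨e.lvl m x, ?_, e.ι_lvl m x⟩
  change (e.lvl m).symm (e.lvl m x) ∈ D m
  rwa [ContinuousLinearEquiv.symm_apply_apply]

namespace FredholmData

variable {n s : ℕ} {E' : ScBanach.{u}} {F : ScBanach.{v}}
  {O : Set (((eucl n).prod ((eucl s).prod E')).X 0)}
  {K : Set (((eucl n).prod ((eucl s).prod E')).X 0 × F.X 0)}
  {σ : ((eucl n).prod ((eucl s).prod E')).X 0 → F.X 0} {W : ScBanach.{u}} {d k' : ℕ}
  (D : FredholmData (euclProd n (stdQuadrant s E')) F O K σ (W.prod (eucl n)) s d k')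
  (ψ' : ScEquiv E' ((eucl d).prod W))

theorem hasDeriv_slice_r : HasScDerivAt ((eucl s).prod E') ((eucl s).prod E')
    (lev ((eucl s).prod E') (sliceBase n (D.U 0))) (sliceRetr n D.r) 0
    ((ContinuousLinearMap.snd ℝ _ _).comp (D.Dr.comp (ContinuousLinearMap.inr ℝ _ _))) :=
  (D.hasDeriv_r.comp_scLin (x := (0 : ((eucl s).prod E').X 1))
    (ScLin.inr (eucl n) ((eucl s).prod E')) fun y hy => by
      rw [lev_sliceBase] at hy
      exact hy).clm_comp (G := (eucl s).prod E') (ContinuousLinearMap.snd ℝ _ _)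

/-- The slice over `0 ∈ ℝⁿ` of the structures of a sliced sc-Fredholm germ. -/
def slice (hr : ∀ x ∈ D.U 0, (D.r x).1 = x.1)
    {lam : ((eucl n).prod ((eucl s).prod E')).X 0 → EuclideanSpace ℝ (Fin n)}
    (hψ : ∀ x ∈ D.U 0, D.ψ x = (x.2.1, ((ψ'.lvl 0 x.2.2).1, ((ψ'.lvl 0 x.2.2).2, lam x))))
    (hlam : ∀ m, ContDiffOn ℝ 1 (fun x : ((eucl n).prod ((eucl s).prod E')).X m =>
      lam (((eucl n).prod ((eucl s).prod E')).ι m x)) (D.U m)) :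
    FredholmData (stdQuadrant s E') F (sliceBase n O) (sliceTotal n K) (sliceSection n σ) W s d
      (k' + n) where
  U := D.sliceU
  germ := D.germ_sliceU
  r := sliceRetr n D.r
  Γ := restrictSlice n D.Γ
  retraction := D.retraction.slice hr
  image_base := (image_sliceRetr hr).trans (congrArg (sliceBase n) D.image_base)
  image_total := (bundleImage_slice hr).trans (congrArg (sliceTotal n) D.image_total)
  h := restrictSlice n D.h
  h_smooth := D.h_smooth.comp_scLin (ScLin.inr (eucl n) ((eucl s).prod E'))
    D.germ_sliceU.isScDom D.isScDom fun _ _ hx => hx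
  fill_eq x hx := D.fill_eq _ hx
  fill_mem x hx e := D.fill_mem (0, x) hx (by rwa [slice_retr_eq hr hx])
  Dr := (ContinuousLinearMap.snd ℝ _ _).comp (D.Dr.comp (ContinuousLinearMap.inr ℝ _ _))
  hasDeriv_r := D.hasDeriv_slice_r
  DL := D.DL.comp (ContinuousLinearMap.inr ℝ _ _)
  hasDeriv_L := by
    refine (D.hasDeriv_L.comp_scLin (x := (0 : ((eucl s).prod E').X 1))
      (ScLin.inr (eucl n) ((eucl s).prod E')) fun y hy => hy).congr (D.germ_sliceU.zero_mem 1)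
      fun y hy => ?_
    have hy' : ((eucl s).prod E').ι 1 y ∈ sliceBase n (D.U 0) := D.germ_sliceU.isScDom.ι_mem 1 y hy
    change D.h (0, ((eucl s).prod E').ι 1 y) - D.Γ (0, sliceRetr n D.r (((eucl s).prod E').ι 1 y))
        (D.h (0, ((eucl s).prod E').ι 1 y)) = D.h (0, ((eucl s).prod E').ι 1 y)
      - D.Γ (D.r (0, ((eucl s).prod E').ι 1 y)) (D.h (0, ((eucl s).prod E').ι 1 y))
    rw [slice_retr_eq hr hy']
  fill_iso m := by
    obtain ⟨e, he⟩ := D.fill_iso m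
    -- The fiber kernel over `0` is unchanged by slicing, and the kernels of the two base
    -- differentials are identified by inclusion at `p = 0`.
    refine ⟨(D.kerSliceEquiv hr (fun _ => rfl) m).trans e, fun x => ?_⟩
    refine (he _).trans ?_
    change D.DL (((eucl n).prod ((eucl s).prod E')).ι m (0, x.1))
      = D.DL (0, ((eucl s).prod E').ι m x.1)
    rw [ScBanach.ι_prod, map_zero]
  𝔰 := restrictSlice n D.𝔰
  𝔰_plus := by
    obtain ⟨s₁, e, hs⟩ := D.𝔰_plus
    exact ⟨restrictSlice n s₁, fun x hx => e _ hx,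
      hs.comp_scLin (ScLin.inr (eucl n) ((eucl s).prod E')) D.germ_sliceU.isScDom D.isScDom
        fun _ _ hx => hx⟩
  𝔰_zero := D.𝔰_zero
  U' := D.sliceU' ψ'
  germ' := D.germ_sliceU' ψ'
  -- The coordinate `lam` is dropped from the chart. It survives in `sliceModel`, which supplies the
  -- base point in `Ginv`.
  ψ := (ψ'.prodRight (eucl s)).lvl 0
  ψinv := (ψ'.symm.prodRight (eucl s)).lvl 0
  G x := ((euclShuffle k' n W).lvl 0 : _ →ₗ[ℝ] _) ∘ₗ D.G (0, x)
  Ginv y := D.Ginv (D.sliceModel ψ' y) ∘ₗ ((euclShuffle k' n W).symm.lvl 0 : _ →ₗ[ℝ] _)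
  bundle := D.bundle.pullback D.isScDom D.germ_sliceU.isScDom
    ((ScLin.inr (eucl n) ((eucl s).prod E')).scSmooth _) scMapsTo_inr (ScLin.id F)
    (euclShuffle k' n W).toScLin ((ψ'.prodRight (eucl s)).toScLin.scSmooth _)
    ((ψ'.prodRight (eucl s)).scMapsTo_preimage D.sliceU) fun _ _ => rfl
  bundle_inv := D.bundle_inv.pullback D.germ'.isScDom (D.germ_sliceU' ψ').isScDom
    (D.smooth_sliceModel ψ') (D.scMapsTo_sliceModel ψ') (euclShuffle k' n W).symm.toScLin
    (ScLin.id F) ((ψ'.symm.prodRight (eucl s)).toScLin.scSmooth _)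
    (fun m y hy => ⟨_, hy, (ψ'.symm.prodRight (eucl s)).ι_lvl m y⟩) fun _ _ => rfl
  left_inv x hx := by
    have e : (ψ'.symm.prodRight (eucl s)).lvl 0 ((ψ'.prodRight (eucl s)).lvl 0 x) = x :=
      ((ψ'.prodRight (eucl s)).lvl 0).symm_apply_apply x
    refine ⟨e, fun ξ => ?_⟩
    have e₁ : (euclShuffle k' n W).symm.lvl 0 ((euclShuffle k' n W).lvl 0 (D.G (0, x) ξ))
      = D.G (0, x) ξ := ((euclShuffle k' n W).lvl 0).symm_apply_apply _
    change D.Ginv (D.ψ (0, (ψ'.symm.prodRight (eucl s)).lvl 0 ((ψ'.prodRight (eucl s)).lvl 0 x)))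
      ((euclShuffle k' n W).symm.lvl 0 ((euclShuffle k' n W).lvl 0 (D.G (0, x) ξ))) = ξ
    rw [e, e₁]
    exact (D.left_inv _ hx).2 ξ
  right_inv y hy := by
    refine ⟨((ψ'.prodRight (eucl s)).lvl 0).apply_symm_apply y, fun η => ?_⟩
    have hy' : ((0, (ψ'.symm.prodRight (eucl s)).lvl 0 y) : ((eucl n).prod ((eucl s).prod E')).X 0)
        ∈ D.U 0 := hy
    have h1 := (D.right_inv _ (D.ψ_mem hy')).2 ((euclShuffle k' n W).symm.lvl 0 η)
    rw [(D.left_inv _ hy').1] at h1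
    refine (congrArg ((euclShuffle k' n W).lvl 0) h1).trans ?_
    exact ((euclShuffle k' n W).lvl 0).apply_symm_apply η
  ψ_zero := map_zero _
  basic := D.isBasicGerm_slice ψ' hψ hlam

end FredholmData

end ScFred

end

/-! ### The slice of a sliced sc-Fredholm germ and its index -/

theorem lemma3p9 (n s : ℕ) (E' : ScFred.ScBanach.{u}) (F : ScFred.ScBanach.{v})
    (O : Set (((ScFred.eucl n).prod ((ScFred.eucl s).prod E')).X 0))
    (K : Set (((ScFred.eucl n).prod ((ScFred.eucl s).prod E')).X 0 × F.X 0))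
    (σ : ((ScFred.eucl n).prod ((ScFred.eucl s).prod E')).X 0 → F.X 0)
    (hK : ScFred.IsSlicedBundleRetract n (ScFred.stdQuadrant s E') F O K)
    (hσ : ScFred.IsSlicedFredholmGerm n s E' F O K σ) :
    ScFred.IsTameFredholmGerm s E' F (ScFred.sliceBase n O) (ScFred.sliceTotal n K)
        (ScFred.sliceSection n σ) ∧
      ∀ i j : ℤ,
        ScFred.HasFredholmIndex (ScFred.euclProd n (ScFred.stdQuadrant s E')) F O K σ i →
        ScFred.HasFredholmIndex (ScFred.stdQuadrant s E') F (ScFred.sliceBase n O)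
          (ScFred.sliceTotal n K) (ScFred.sliceSection n σ) j →
        j = i - n := by
  obtain ⟨hsec, W, d, k', D, ψ', lam, hr, hψ, hlam⟩ := hσ
  have hslice := hsec.slice D.retraction hr D.image_base D.image_total
  refine ⟨⟨hslice, W, d, k' + n, D.slice ψ' hr hψ hlam, ψ', fun _ _ => rfl⟩, ?_⟩
  rintro i j ⟨-, W₁, s₁, d₁, k₁, ⟨D₁⟩, rfl⟩ ⟨-, W₂, s₂, d₂, k₂, ⟨D₂⟩, rfl⟩
  -- Arbitrary structures are compared with the sliced pair `D` and `D.slice`, whose indices `s + d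
  -- - k'` and `s + d - (k' + n)` differ by `n`.
  have h₁ := D.index_eq D₁ hsec.zero_mem hsec.smooth.1
  have h₂ := (D.slice ψ' hr hψ hlam).index_eq D₂ hslice.zero_mem hslice.smooth.1
  omega
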